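/- Let $\Omega\subset\mathbb{R}^3$ be a bounded convex domain whose boundary is of class $C^2$ with positive Gaussian curvature. Let $0\le\gamma\le 1$, let $B=B(|v-v_*|,\theta)$ be a measurable cross-section satisfying Grad's angular cutoff assumption $$0\le B(|v-v_*|,\theta)\le C_B\,|v-v_*|^{\gamma}\cos\theta\sin\theta ,\qquad 0\le\theta\le\tfrac{\pi}{2},$$ and let $$Q(F,G)(v)=\int_{\mathbb{R}^3}\int_0^{2\pi}\int_0^{\pi/2}\bigl(F(v')G(v'_*)-F(v)G(v_*)\bigr)B(|v-v_*|,\theta)\,d\theta\, d\varepsilon\, dv_*$$ be the collision operator, where $v'=v+((v_*-v)\cdot\alpha)\alpha$, $v'_*=v_*-((v_*-v)\cdot\alpha)\alpha$, and $\alpha=\cos\theta\, e_1+\sin\theta\cos\varepsilon\, e_2+\sin\theta\sin\varepsilon\, e_3$ with $e_1=\frac{v_*-v}{|v_*-v|}$ and $\{e_1,e_2,e_3\}$ an orthonormal basis. Put $M(v)=\pi^{-3/2}e^{-|v|^2}$ and let $L f=M^{-1/2}\bigl(Q(M,M^{1/2}f)+Q(M^{1/2}f,M)\bigr)$ be the linearized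 collision operator. Write $L=-\nu+K$, where $$\nu(v)=\int_{\mathbb{R}^3}\int_0^{2\pi}\int_0^{\pi/2}M(v_*)B(|v-v_*|,\theta)\,d\theta\, d\varepsilon\, dv_*$$ is the collision frequency (acting by multiplication) and $K$ acts in the velocity variable only. Assume that there is $\nu_0>0$ with $\nu(v)\ge\nu_0(1+|v|)^\gamma$ for all $v\in\mathbb{R}^3$. For a function $h$ on $\Omega\times\mathbb{R}^3$ put $$(S_\Omega h)(x,v)=\int_0^{\tau_-(x,v)}e^{-\nu(v)s}\,h(x-sv,v)\,ds,\qquad \tau_-(x,v)=\inf\{t>0:\ x-tv\notin\Omega\},$$ and for $0<s<1$ let $L^2_v(\mathbb{R}^3;H^s_x(\Omega))$ be the space of all $f\in L^2(\Omega\times\mathbb{R}^3)$ for which $$\|f\|^2_{L^2_v(\mathbb{R}^3;H^s_x(\Omega))}=\|f\|^2_{L^2(\Omega\times\mathbb{R}^3)}+\int_{\mathbb{R}^3}\int_\Omega\int_\Omega\frac{|f(x,v)-f(y,v)|^2}{|x-y|^{3+2s}}\,dx\,dy\,dv$$ is finite. Then $(S_\Omega K)^4=S_\Omega KS_\Omega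 KS_\Omega KS_\Omega K$ is a well-defined bounded linear operator from $L^2(\Omega\times\mathbb{R}^3)$ to $L^2_v(\mathbb{R}^3;H^{1-\epsilon}_x(\Omega))$ for every $\epsilon\in(0,\frac12)$: there is a constant $C$, independent of $f$, such that $$\|(S_\Omega K)^4f\|_{L^2_v(\mathbb{R}^3;H^{1-\epsilon}_x(\Omega))}\le C\,\|f\|_{L^2(\Omega\times\mathbb{R}^3)}\qquad\text{for all } f\in L^2(\Omega\times\mathbb{R}^3).$$ Consequently, for every $f\in L^2(\Omega\times\mathbb{R}^3)$, in particular for every $L^2$ solution $f$ of the stationary linearized Boltzmann equation $v\cdot\nabla_xf=Lf$ in $\Omega$ with prescribed incoming boundary data, the term $f_4:=(S_\Omega K)^4f$ belongs to $L^2_v(\mathbb{R}^3;H^{1-\epsilon}_x(\Omega))$ for every $\epsilon\in(0,\frac12)$. -/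

import Mathlib

open MeasureTheory Set Filter Topology
open scoped ENNReal NNReal RealInnerProductSpace

noncomputable section

namespace LinBoltzmann

/-- Three-dimensional Euclidean space (positions and velocities). -/
abbrev E3 : Type := EuclideanSpace ℝ (Fin 3)

/-! ### Domains with `C²` boundary of positive Gaussian curvature -/

/-- `φ` is a `C²` defining function of `Ω` near the point `q`: it is `C²` near `q`, has
non-vanishing differential at `q`, and `Ω` coincides with `{φ < 0}` near `q`. -/
def IsLocalDefiningFunction (Ω : Set E3) (q : E3) (φ : E3 → ℝ) : Prop :=
  ContDiffAt ℝ 2 φ q ∧ fderiv ℝ φ q ≠ 0 ∧ ∀ᶠ x in 𝓝 q, (x ∈ Ω ↔ φ x < 0)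

/-- The second fundamental form at `q` of the level surface of `φ` through `q`, evaluated on
tangent vectors `u, w`. -/
def secondFundForm (φ : E3 → ℝ) (q u w : E3) : ℝ :=
  fderiv ℝ (fderiv ℝ φ) q u w / ‖fderiv ℝ φ q‖

/-- `κ` is the Gaussian curvature of `∂Ω` at `q`: the determinant of the second fundamental form
in an orthonormal basis `u, w` of the tangent plane of `∂Ω` at `q`. -/
def IsGaussianCurvature (Ω : Set E3) (q : E3) (κ : ℝ) : Prop :=
  ∃ φ : E3 → ℝ, IsLocalDefiningFunction Ω q φ ∧
    ∃ u w : E3, ‖u‖ = 1 ∧ ‖w‖ = 1 ∧ ⟪u, w⟫ = 0 ∧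
      fderiv ℝ φ q u = 0 ∧ fderiv ℝ φ q w = 0 ∧
      κ = secondFundForm φ q u u * secondFundForm φ q w w - secondFundForm φ q u w ^ 2

/-- `Ω` is a bounded convex domain with `C²` boundary of positive Gaussian curvature. -/
structure IsPositiveCurvatureDomain (Ω : Set E3) : Prop where
  isOpen : IsOpen Ω
  nonempty : Ω.Nonempty
  convex : Convex ℝ Ω
  isBounded : Bornology.IsBounded Ω
  c2_boundary : ∀ q ∈ frontier Ω, ∃ φ : E3 → ℝ, IsLocalDefiningFunction Ω q φ
  curvature_pos : ∀ q ∈ frontier Ω, ∃ κ : ℝ, 0 < κ ∧ IsGaussianCurvature Ω q κ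

/-! ### The linearized collision operator -/

/-- The standard Maxwellian `M(v) = π^{-3/2} e^{-|v|²}`. -/
def maxwellian (v : E3) : ℝ := Real.pi ^ (-(3 / 2) : ℝ) * Real.exp (-‖v‖ ^ 2)

/-- A unit vector orthogonal to the unit vector `n`. -/
def frameTwo (n : E3) : E3 :=
  if n 0 = 0 ∧ n 1 = 0 then !₂[1, 0, 0]
  else (√(n 0 ^ 2 + n 1 ^ 2))⁻¹ • !₂[-n 1, n 0, 0]

/-- The cross product `n × frameTwo n`, which completes `n, frameTwo n` to an orthonormal basis
when `n` is a unit vector. -/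
def frameThree (n : E3) : E3 :=
  !₂[n 1 * frameTwo n 2 - n 2 * frameTwo n 1,
     n 2 * frameTwo n 0 - n 0 * frameTwo n 2,
     n 0 * frameTwo n 1 - n 1 * frameTwo n 0]

/-- The direction `α = cos θ e₁ + sin θ cos ε e₂ + sin θ sin ε e₃`, where
`e₁ = (v_* - v) / |v_* - v|`. -/
def collisionDir (v vs : E3) (θ ε : ℝ) : E3 :=
  let e₁ : E3 := ‖vs - v‖⁻¹ • (vs - v)
  Real.cos θ • e₁ + (Real.sin θ * Real.cos ε) • frameTwo e₁ +
    (Real.sin θ * Real.sin ε) • frameThree e₁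

/-- The velocity `v'` after the collision. -/
def postV (v vs : E3) (θ ε : ℝ) : E3 :=
  v + ⟪vs - v, collisionDir v vs θ ε⟫ • collisionDir v vs θ ε

/-- The velocity `v'_*` after the collision. -/
def postVs (v vs : E3) (θ ε : ℝ) : E3 :=
  vs - ⟪vs - v, collisionDir v vs θ ε⟫ • collisionDir v vs θ ε

/-- The bilinear collision operator `Q(F, G)` with cross-section `B(|v - v_*|, θ)`. -/
def collisionQ (B : ℝ → ℝ → ℝ) (F G : E3 → ℝ) (v : E3) : ℝ :=
  ∫ vs : E3, ∫ ε in (0 : ℝ)..(2 * Real.pi), ∫ θ in (0 : ℝ)..(Real.pi / 2),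
    (F (postV v vs θ ε) * G (postVs v vs θ ε) - F v * G vs) * B ‖v - vs‖ θ

/-- The linearized collision operator
`L f = M^{-1/2} (Q(M, M^{1/2} f) + Q(M^{1/2} f, M))`. -/
def linearizedL (B : ℝ → ℝ → ℝ) (f : E3 → ℝ) (v : E3) : ℝ :=
  (√(maxwellian v))⁻¹ *
    (collisionQ B maxwellian (fun w => √(maxwellian w) * f w) v +
      collisionQ B (fun w => √(maxwellian w) * f w) maxwellian v)

/-- The collision frequency `ν(v) = ∫∫∫ M(v_*) B(|v - v_*|, θ) dθ dε dv_*`. -/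
def collisionFreq (B : ℝ → ℝ → ℝ) (v : E3) : ℝ :=
  ∫ vs : E3, ∫ _ε in (0 : ℝ)..(2 * Real.pi), ∫ θ in (0 : ℝ)..(Real.pi / 2),
    maxwellian vs * B ‖v - vs‖ θ

/-- The operator `K` of the decomposition `L f = -ν f + K f`, acting in the velocity variable of
a function of `(x, v)`. -/
def opK (B : ℝ → ℝ → ℝ) (f : E3 × E3 → ℝ) (p : E3 × E3) : ℝ :=
  linearizedL B (fun w => f (p.1, w)) p.2 + collisionFreq B p.2 * f p

/-- Grad's angular cutoff: `0 ≤ B(|v - v_*|, θ) ≤ C |v - v_*|^γ cos θ sin θ`. -/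
def IsAngularCutoff (B : ℝ → ℝ → ℝ) (γ : ℝ) : Prop :=
  ∃ C : ℝ, ∀ V : ℝ, 0 ≤ V → ∀ θ ∈ Icc (0 : ℝ) (Real.pi / 2),
    0 ≤ B V θ ∧ B V θ ≤ C * V ^ γ * Real.cos θ * Real.sin θ

/-! ### The transport operator in `Ω` -/

/-- The backward exit time `τ₋(x, v) = inf {t > 0 : x - t v ∉ Ω}`. -/
def exitTime (Ω : Set E3) (x v : E3) : ℝ := sInf {t : ℝ | 0 < t ∧ x - t • v ∉ Ω}

/-- The operator `(S_Ω h)(x, v) = ∫_0^{τ₋(x, v)} e^{-ν(v) s} h(x - s v, v) ds`, with `ν` the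
collision frequency of `B`. -/
def opS (Ω : Set E3) (B : ℝ → ℝ → ℝ) (h : E3 × E3 → ℝ) (p : E3 × E3) : ℝ :=
  ∫ s in (0 : ℝ)..(exitTime Ω p.1 p.2),
    Real.exp (-(collisionFreq B p.2 * s)) * h (p.1 - s • p.2, p.2)

/-- The `i`-th Picard iterate `f_i = (S_Ω K)^i f`. -/
def picard (Ω : Set E3) (B : ℝ → ℝ → ℝ) (i : ℕ) (f : E3 × E3 → ℝ) : E3 × E3 → ℝ :=
  (fun g => opS Ω B (opK B g))^[i] f

/-! ### Function spaces -/

/-- Lebesgue measure on `Ω × ℝ³`. -/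
abbrev phaseMeasure (Ω : Set E3) : Measure (E3 × E3) :=
  ((volume : Measure E3).restrict Ω).prod (volume : Measure E3)

/-- The square of the Slobodeckij seminorm of order `s` in `x`, integrated in `v`. -/
def slobodeckijSq (Ω : Set E3) (s : ℝ) (f : E3 × E3 → ℝ) : ℝ≥0∞ :=
  ∫⁻ v : E3, ∫⁻ y in Ω, ∫⁻ x in Ω,
    ENNReal.ofReal (|f (x, v) - f (y, v)| ^ 2 / ‖x - y‖ ^ (3 + 2 * s))

/-- Membership in `L²_v(ℝ³; H^s_x(Ω))`, for `0 < s < 1`. -/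
def MemL2H (Ω : Set E3) (s : ℝ) (f : E3 × E3 → ℝ) : Prop :=
  MemLp f 2 (phaseMeasure Ω) ∧ slobodeckijSq Ω s f < ∞

/-- The norm of `L²_v(ℝ³; H^s_x(Ω))`, for `0 < s < 1`, with values in `[0, ∞]`. -/
def l2hNorm (Ω : Set E3) (s : ℝ) (f : E3 × E3 → ℝ) : ℝ≥0∞ :=
  (eLpNorm f 2 (phaseMeasure Ω) ^ 2 + slobodeckijSq Ω s f) ^ (1 / 2 : ℝ)

end LinBoltzmann

end

open MeasureTheory Set Filter Topology
open scoped ENNReal NNReal RealInnerProductSpace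

noncomputable section

namespace LinBoltzmann

/-! ### Orthonormal frames and spherical coordinates -/

/-! The mechanism is velocity averaging, applied twice, together with a separate control of what
happens at the boundary.

K is an integral operator in velocity whose kernel is dominated by |v-w|⁻¹ exp(-|v-w|²/8)
(`linearizedL_add_collisionFreq`, `abs_gradKer_le`). The gain terms acquire a kernel through
Carleman's change of variables `lintegral_carleman`. From then on only the measurability and the
size of the kernel matter. Such an operator is bounded on L² with weights (1+|v|)^n. The transport
operator gains one power of the weight, because a ray is damped and stays in Ω for a time at most
diam Ω / |v| (`wNorm_stepOp_le`).

On the whole space, S is the Fourier multiplier 1/(ν + 2πi w·ξ) in x. Bounding ν from below, its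
square is at most a Lorentzian in the component of w along ξ. Integrated against the kernel of K it
gives at most C/|ξ| (`lintegral_gradBound_transSymbol_le`), so K S gains half a derivative in x. In
the seminorms with weight |h|^(-p), where p = 3 + 2s, this is `slobNorm_kerOp_transOp_le` and,
starting from plain L², `slobNorm_kerOp_transOp_le_wNorm`.

For convex Ω, S_Ω h is the restriction to Ω of S applied to h extended by zero (`opS_eq`). The
extension jumps at the boundary. It keeps s derivatives for s < 1/2 provided the function is square
integrable against the boundary weight ∫_{y+h∉Ω} |h|^(-p) dh (`slobNorm_cut_le`). Functions in the
range of S_Ω K have this property, by the Hardy-type inequality `hardy_stepOp`: integrating over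
rays through x bounds the velocity mean square at x by a potential with kernel |x-y|⁻². For convex Ω
the layer of points leaving Ω under translation by h carries |y-z|⁻² mass only O(|h|^(1-η))
(`exitSet_singular_integral_le`), since its slices in the direction h have length at most |h|.

Let g₁, g₂, g₃ be the first iterates. K g₂ cut off to Ω has 1/2 - ε derivatives: averaging acts on K
g₁, and Hardy acts on g₂. Another K S on the whole space raises this to 1 - ε, and the result agrees
with K g₃ inside Ω. The last S is a damped average of translates, so it loses no derivative except
on ray segments lying in the layers (`innerDiff_stepOp_le`). There the chord length produces a
factor |h|^(1-ε), and the remaining weight |h|^(-(4-ε)) is again covered by Hardy, now with velocity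
weights supplied by the earlier steps. This is `innerSlob_iterate_le`. What remains is to identify
the literal iteration `picard` with these whole-space operators almost everywhere. -/

/-- The unit vector with polar angle `θ` and azimuth `ε` in the frame attached to `n`. -/
@[irreducible]
def sphDir (n : E3) (θ ε : ℝ) : E3 :=
  Real.cos θ • n + (Real.sin θ * Real.cos ε) • frameTwo n +
    (Real.sin θ * Real.sin ε) • frameThree n

lemma collisionDir_eq_sphDir (v vs : E3) (θ ε : ℝ) :
    collisionDir v vs θ ε = sphDir (‖vs - v‖⁻¹ • (vs - v)) θ ε := by
  unfold sphDir; rfl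

lemma inner_eq_sum_three (x y : E3) : ⟪x, y⟫ = x 0 * y 0 + x 1 * y 1 + x 2 * y 2 := by
  simp [PiLp.inner_apply, Fin.sum_univ_three]; ring

lemma sum_sq_of_norm_eq_one {n : E3} (hn : ‖n‖ = 1) : n 0 ^ 2 + n 1 ^ 2 + n 2 ^ 2 = 1 := by
  have := inner_eq_sum_three n n
  rw [real_inner_self_eq_norm_sq, hn] at this
  linarith

lemma orthonormal_frame {n : E3} (hn : ‖n‖ = 1) :
    Orthonormal ℝ ![n, frameTwo n, frameThree n] := by
  have h1 := sum_sq_of_norm_eq_one hn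
  -- Both branches of `frameTwo` give a horizontal unit vector orthogonal to n. These three
  -- identities suffice: the remaining inner products are polynomial consequences of them and of |n|
  -- = 1.
  have key : frameTwo n 0 ^ 2 + frameTwo n 1 ^ 2 = 1 ∧ frameTwo n 2 = 0 ∧
      n 0 * frameTwo n 0 + n 1 * frameTwo n 1 = 0 := by
    unfold frameTwo
    split_ifs with h
    · simp [h.1]
    · have hpos : 0 < n 0 ^ 2 + n 1 ^ 2 := by
        rw [not_and_or] at h
        rcases h with h | h
        · positivity
        · positivity
      have hs : (√(n 0 ^ 2 + n 1 ^ 2))⁻¹ ^ 2 * (n 0 ^ 2 + n 1 ^ 2) = 1 := by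
        rw [inv_pow, Real.sq_sqrt hpos.le, inv_mul_cancel₀ hpos.ne']
      refine ⟨?_, by simp, ?_⟩
      · simp; linear_combination hs
      · simp; ring
  obtain ⟨h2, h3, h4⟩ := key
  have e0 : frameThree n 0 = n 1 * frameTwo n 2 - n 2 * frameTwo n 1 := rfl
  have e1 : frameThree n 1 = n 2 * frameTwo n 0 - n 0 * frameTwo n 2 := rfl
  have e2 : frameThree n 2 = n 0 * frameTwo n 1 - n 1 * frameTwo n 0 := rfl
  rw [orthonormal_iff_ite]
  set p := frameTwo n 0
  set q := frameTwo n 1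
  have i00 : ⟪n, n⟫ = 1 := by rw [inner_eq_sum_three]; linear_combination h1
  have i11 : ⟪frameTwo n, frameTwo n⟫ = 1 := by
    rw [inner_eq_sum_three, h3]; linear_combination h2
  have i22 : ⟪frameThree n, frameThree n⟫ = 1 := by
    rw [inner_eq_sum_three, e0, e1, e2, h3]
    linear_combination (p ^ 2 + q ^ 2) * h1 + h2 - (n 0 * p + n 1 * q) * h4
  have i01 : ⟪n, frameTwo n⟫ = 0 := by rw [inner_eq_sum_three, h3]; linear_combination h4
  have i02 : ⟪n, frameThree n⟫ = 0 := by rw [inner_eq_sum_three, e0, e1, e2]; ring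
  have i12 : ⟪frameTwo n, frameThree n⟫ = 0 := by rw [inner_eq_sum_three, e0, e1, e2]; ring
  intro i j
  fin_cases i <;> fin_cases j <;>
    simp only [Fin.zero_eta, Fin.mk_one, Fin.reduceFinMk, Matrix.cons_val_zero, Matrix.cons_val_one,
      Matrix.cons_val, i00, i11, i22, i01, i02, i12, real_inner_comm n,
      real_inner_comm (frameTwo n) (frameThree n)] <;> simp

/-- The orthonormal basis `n, frameTwo n, frameThree n`. -/
def frameBasis {n : E3} (hn : ‖n‖ = 1) : OrthonormalBasis (Fin 3) ℝ E3 :=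
  (basisOfOrthonormalOfCardEqFinrank (orthonormal_frame hn) (by simp)).toOrthonormalBasis
    (by simpa using orthonormal_frame hn)

lemma frameBasis_apply {n : E3} (hn : ‖n‖ = 1) (i : Fin 3) :
    frameBasis hn i = ![n, frameTwo n, frameThree n] i := by
  simp [frameBasis]

lemma frameBasis_repr_symm {n : E3} (hn : ‖n‖ = 1) (x : Fin 3 → ℝ) :
    (frameBasis hn).repr.symm (WithLp.toLp 2 x) =
      x 0 • n + x 1 • frameTwo n + x 2 • frameThree n := by
  rw [← OrthonormalBasis.sum_repr_symm]
  simp [Fin.sum_univ_three, frameBasis_apply]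

lemma lintegral_frame {n : E3} (hn : ‖n‖ = 1) {F : E3 → ℝ≥0∞} (hF : Measurable F) :
    ∫⁻ w, F w = ∫⁻ a : ℝ, ∫⁻ b : ℝ, ∫⁻ c : ℝ, F (a • n + b • frameTwo n + c • frameThree n) := by
  have h0 : Measurable fun x : Fin 3 → ℝ => F (x 0 • n + x 1 • frameTwo n + x 2 • frameThree n) := by
    fun_prop
  rw [← (frameBasis hn).measurePreserving_repr_symm.lintegral_comp hF,
    ← (PiLp.volume_preserving_toLp (Fin 3)).lintegral_comp
      (f := fun x => F ((frameBasis hn).repr.symm x))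
      (hF.comp (frameBasis hn).repr.symm.continuous.measurable)]
  simp only [frameBasis_repr_symm]
  rw [← (volume_preserving_piFinSuccAbove (fun _ : Fin 3 => ℝ) 0).symm.lintegral_comp h0,
    Measure.volume_eq_prod, lintegral_prod _ (by fun_prop)]
  refine lintegral_congr fun a => ?_
  rw [← (volume_preserving_piFinTwo (fun _ : Fin 2 => ℝ)).symm.lintegral_comp (by fun_prop),
    Measure.volume_eq_prod, lintegral_prod _ (by fun_prop)]
  rfl

lemma norm_sq_frame {n : E3} (hn : ‖n‖ = 1) (a b c : ℝ) :
    ‖a • n + b • frameTwo n + c • frameThree n‖ ^ 2 = a ^ 2 + b ^ 2 + c ^ 2 := by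
  have := frameBasis_repr_symm hn ![a, b, c]
  simp only [Matrix.cons_val_zero, Matrix.cons_val_one, Matrix.cons_val] at this
  rw [← this, LinearIsometryEquiv.norm_map, EuclideanSpace.norm_sq_eq]
  simp [Fin.sum_univ_three]

lemma inner_frame {n : E3} (hn : ‖n‖ = 1) (a b c : ℝ) :
    ⟪a • n + b • frameTwo n + c • frameThree n, n⟫ = a := by
  have h := orthonormal_iff_ite.1 (orthonormal_frame hn)
  have h00 := h 0 0
  have h10 := h 1 0
  have h20 := h 2 0
  simp only [Matrix.cons_val_zero, Matrix.cons_val_one, Matrix.cons_val] at h00 h10 h20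
  simp only [inner_add_left, real_inner_smul_left, h00, h10, h20]
  simp

lemma norm_sphDir {n : E3} (hn : ‖n‖ = 1) (θ ε : ℝ) : ‖sphDir n θ ε‖ = 1 := by
  have h := norm_sq_frame hn (Real.cos θ) (Real.sin θ * Real.cos ε) (Real.sin θ * Real.sin ε)
  rw [← sphDir] at h
  have : ‖sphDir n θ ε‖ ^ 2 = 1 := by
    rw [h]
    linear_combination Real.sin_sq_add_cos_sq θ + Real.sin θ ^ 2 * Real.sin_sq_add_cos_sq ε
  exact (pow_eq_one_iff_of_nonneg (norm_nonneg _) two_ne_zero).1 this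

lemma inner_sphDir {n : E3} (hn : ‖n‖ = 1) (θ ε : ℝ) : ⟪n, sphDir n θ ε⟫ = Real.cos θ := by
  rw [real_inner_comm, sphDir]; exact inner_frame hn _ _ _

lemma measurable_vec_three {α : Type*} [MeasurableSpace α] {f g h : α → ℝ} (hf : Measurable f)
    (hg : Measurable g) (hh : Measurable h) : Measurable fun a => (!₂[f a, g a, h a] : E3) := by
  have : Measurable fun a => ![f a, g a, h a] := by
    refine measurable_pi_iff.2 fun i => ?_
    fin_cases i
    exacts [hf, hg, hh]
  exact (PiLp.continuous_toLp 2 _).measurable.comp this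

lemma measurable_frameTwo : Measurable frameTwo := by
  unfold frameTwo
  refine Measurable.ite ?_ measurable_const ?_
  · exact (measurableSet_eq_fun (f := fun n : E3 => n 0) (by fun_prop) measurable_const).inter
      (measurableSet_eq_fun (f := fun n : E3 => n 1) (by fun_prop) measurable_const)
  · exact Measurable.smul (f := fun n : E3 => (√(n 0 ^ 2 + n 1 ^ 2))⁻¹) (by fun_prop)
      (measurable_vec_three (by fun_prop) (by fun_prop) measurable_const)

lemma measurable_frameThree : Measurable frameThree := by
  have h : ∀ j : Fin 3, Measurable fun n : E3 => frameTwo n j := fun j =>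
    (by fun_prop : Measurable fun x : E3 => x j).comp measurable_frameTwo
  have c : ∀ j : Fin 3, Measurable fun n : E3 => n j := fun j => by fun_prop
  exact measurable_vec_three (((c 1).mul (h 2)).sub ((c 2).mul (h 1)))
    (((c 2).mul (h 0)).sub ((c 0).mul (h 2))) (((c 0).mul (h 1)).sub ((c 1).mul (h 0)))

lemma measurable_sphDir : Measurable fun q : E3 × ℝ × ℝ => sphDir q.1 q.2.1 q.2.2 := by
  unfold sphDir
  have h2 := measurable_frameTwo
  have h3 := measurable_frameThree
  fun_prop

/-! ### Polar coordinates with the angular ranges of the collision integral -/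

lemma lintegral_plane_polar {F : ℝ → ℝ → ℝ≥0∞} (hF : Measurable fun q : ℝ × ℝ => F q.1 q.2) :
    ∫⁻ b : ℝ, ∫⁻ c : ℝ, F b c = ∫⁻ q in Ioi (0 : ℝ), ∫⁻ ε in Ioo 0 (2 * Real.pi),
      ENNReal.ofReal q * F (q * Real.cos ε) (q * Real.sin ε) := by
  -- The reflection p ↦ -p shifts the angle by π, which moves the standard range (-π, π) to (0, 2π).
  have h1 : ∫⁻ b : ℝ, ∫⁻ c : ℝ, F b c = ∫⁻ p : ℝ × ℝ, F (-p.1) (-p.2) := by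
    rw [← lintegral_prod (fun p : ℝ × ℝ => F p.1 p.2) hF.aemeasurable, ← Measure.volume_eq_prod,
      ← (Measure.measurePreserving_neg (volume : Measure (ℝ × ℝ))).lintegral_comp hF]
    rfl
  rw [h1, ← lintegral_comp_polarCoord_symm, polarCoord_target, Measure.volume_eq_prod,
    ← Measure.prod_restrict, lintegral_prod _ ?_]
  · refine lintegral_congr fun q => ?_
    have e : (fun ε : ℝ => ε + Real.pi) ⁻¹' Ioo 0 (2 * Real.pi) = Ioo (-Real.pi) Real.pi := by
      ext ε; simp only [mem_preimage, mem_Ioo]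
      constructor <;> rintro ⟨h1, h2⟩ <;> constructor <;> linarith
    rw [← (measurePreserving_add_right volume Real.pi).setLIntegral_comp_preimage
      (s := Ioo 0 (2 * Real.pi))
      (f := fun ε => ENNReal.ofReal q * F (q * Real.cos ε) (q * Real.sin ε))
      measurableSet_Ioo (by fun_prop), e]
    simp [polarCoord]
  · refine Measurable.aemeasurable ?_
    simp only [polarCoord, OpenPartialHomeomorph.coe_mk_symm, PartialEquiv.coe_symm_mk]
    fun_prop

lemma lintegral_half_plane_polar {F : ℝ → ℝ → ℝ≥0∞} (hF : Measurable fun q : ℝ × ℝ => F q.1 q.2) :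
    ∫⁻ a : ℝ, ∫⁻ q in Ioi (0 : ℝ), F a q = ∫⁻ R in Ioi (0 : ℝ), ∫⁻ θ in Ioo 0 Real.pi,
      ENNReal.ofReal R * F (R * Real.cos θ) (R * Real.sin θ) := by
  have hG : Measurable fun p : ℝ × ℝ => (univ ×ˢ Ioi 0).indicator (fun q : ℝ × ℝ => F q.1 q.2) p :=
    hF.indicator (MeasurableSet.univ.prod measurableSet_Ioi)
  have h1 : ∫⁻ a : ℝ, ∫⁻ q in Ioi (0 : ℝ), F a q =
      ∫⁻ p : ℝ × ℝ, (univ ×ˢ Ioi 0).indicator (fun q : ℝ × ℝ => F q.1 q.2) p := by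
    rw [Measure.volume_eq_prod, lintegral_prod _ hG.aemeasurable]
    refine lintegral_congr fun a => ?_
    rw [← lintegral_indicator measurableSet_Ioi]
    refine lintegral_congr fun q => ?_
    by_cases hq : 0 < q <;> simp [indicator, hq]
  rw [h1, ← lintegral_comp_polarCoord_symm, polarCoord_target, Measure.volume_eq_prod,
    ← Measure.prod_restrict, lintegral_prod _ ?_]
  · refine setLIntegral_congr_fun measurableSet_Ioi fun R hR => ?_
    have hsub : Ioo 0 Real.pi ⊆ Ioo (-Real.pi) Real.pi :=
      Ioo_subset_Ioo (by linarith [Real.pi_pos]) le_rfl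
    rw [← lintegral_indicator measurableSet_Ioo, ← lintegral_indicator measurableSet_Ioo]
    refine lintegral_congr fun θ => ?_
    have hR' : (0 : ℝ) < R := hR
    by_cases h0 : θ ∈ Ioo 0 Real.pi
    · have hs : 0 < R * Real.sin θ := mul_pos hR' (Real.sin_pos_of_mem_Ioo h0)
      rw [indicator_of_mem (hsub h0), indicator_of_mem h0]
      simp [polarCoord, indicator, hs]
    · rw [indicator_of_notMem h0]
      by_cases h1 : θ ∈ Ioo (-Real.pi) Real.pi
      · have hθ : θ ≤ 0 := by
          by_contra hc; exact h0 ⟨not_le.1 hc, h1.2⟩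
        have hs : ¬ (0 < R * Real.sin θ) := by
          have := Real.sin_nonpos_of_nonpos_of_neg_pi_le hθ h1.1.le
          exact not_lt.2 (mul_nonpos_of_nonneg_of_nonpos hR'.le this)
        rw [indicator_of_mem h1]
        simp only [polarCoord, OpenPartialHomeomorph.coe_mk_symm, PartialEquiv.coe_symm_mk]
        rw [indicator_of_notMem (by simpa using not_lt.1 hs), smul_zero]
      · rw [indicator_of_notMem h1]
  · refine Measurable.aemeasurable ?_
    simp only [polarCoord, OpenPartialHomeomorph.coe_mk_symm, PartialEquiv.coe_symm_mk]
    exact Measurable.smul (f := fun a : ℝ × ℝ => ENNReal.ofReal a.1) (by fun_prop)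
      (hG.comp (g := fun p => (univ ×ˢ Ioi 0).indicator (fun q : ℝ × ℝ => F q.1 q.2) p)
        (f := fun a : ℝ × ℝ => (a.1 * Real.cos a.2, a.1 * Real.sin a.2)) (by fun_prop))

/-- Spherical coordinates in the frame attached to the unit vector `n`. -/
lemma lintegral_spherical {n : E3} (hn : ‖n‖ = 1) {Q : E3 → ℝ≥0∞} (hQ : Measurable Q) :
    ∫⁻ w, Q w = ∫⁻ R in Ioi (0 : ℝ), ∫⁻ θ in Ioo 0 Real.pi, ∫⁻ ε in Ioo 0 (2 * Real.pi),
      ENNReal.ofReal (R ^ 2 * Real.sin θ) * Q (R • sphDir n θ ε) := by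
  rw [lintegral_frame hn hQ]
  -- Polar coordinates (q, ε) in the plane orthogonal to n, followed by (R, θ) in the half plane of
  -- the (a, q): the Jacobians q = R sin θ and R multiply to R² sin θ.
  have h1 : ∀ a : ℝ, ∫⁻ b : ℝ, ∫⁻ c : ℝ, Q (a • n + b • frameTwo n + c • frameThree n) =
      ∫⁻ q in Ioi (0 : ℝ), ∫⁻ ε in Ioo 0 (2 * Real.pi), ENNReal.ofReal q *
        Q (a • n + (q * Real.cos ε) • frameTwo n + (q * Real.sin ε) • frameThree n) := fun a =>
    lintegral_plane_polar (F := fun b c => Q (a • n + b • frameTwo n + c • frameThree n))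
      (by fun_prop)
  simp_rw [h1]
  rw [lintegral_half_plane_polar (F := fun a q => ∫⁻ ε in Ioo 0 (2 * Real.pi), ENNReal.ofReal q *
        Q (a • n + (q * Real.cos ε) • frameTwo n + (q * Real.sin ε) • frameThree n))]
  · refine setLIntegral_congr_fun measurableSet_Ioi fun R hR => ?_
    refine lintegral_congr fun θ => ?_
    have hR' : (0 : ℝ) < R := hR
    rw [← lintegral_const_mul _ (by fun_prop)]
    refine lintegral_congr fun ε => ?_
    rw [← mul_assoc, ← ENNReal.ofReal_mul hR'.le]
    congr 2
    · ring
    · simp only [sphDir, smul_add, smul_smul, mul_assoc]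
  · exact Measurable.lintegral_prod_right' (f := fun z : (ℝ × ℝ) × ℝ => ENNReal.ofReal z.1.2 *
        Q (z.1.1 • n + (z.1.2 * Real.cos z.2) • frameTwo n + (z.1.2 * Real.sin z.2) • frameThree n))
        (by fun_prop)

/-! ### Carleman's change of variables -/

/-- A radial weight whose spherical means have total mass one. -/
@[irreducible]
def radialWeight (z : E3) : ℝ≥0∞ :=
  (Metric.ball 0 1).indicator (fun z : E3 => ENNReal.ofReal ((‖z‖ ^ 2)⁻¹)) z

lemma measurable_radialWeight : Measurable radialWeight := by
  unfold radialWeight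
  exact Measurable.indicator (by fun_prop) measurableSet_ball

lemma measurable_sphDir_const (n : E3) : Measurable fun q : ℝ × ℝ => sphDir n q.1 q.2 :=
  measurable_sphDir.comp (by fun_prop : Measurable fun q : ℝ × ℝ => (n, q.1, q.2))

/-- The weight cancels the Jacobian R² and leaves ∫₀¹ dR = 1. Surface integrals over the sphere
become volume integrals in which the pole n no longer appears, so poles can be changed without
rotating the sphere. -/
lemma lintegral_radialWeight_mul {n : E3} (hn : ‖n‖ = 1) {P : E3 → ℝ≥0∞} (hP : Measurable P) :
    ∫⁻ z, radialWeight z * P (‖z‖⁻¹ • z) = ∫⁻ θ in Ioo 0 Real.pi, ∫⁻ ε in Ioo 0 (2 * Real.pi),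
      ENNReal.ofReal (Real.sin θ) * P (sphDir n θ ε) := by
  have hm := measurable_radialWeight
  rw [lintegral_spherical hn (by fun_prop)]
  have : ∀ R ∈ Ioi (0 : ℝ), (∫⁻ θ in Ioo 0 Real.pi, ∫⁻ ε in Ioo 0 (2 * Real.pi),
      ENNReal.ofReal (R ^ 2 * Real.sin θ) * (radialWeight (R • sphDir n θ ε) *
        P (‖R • sphDir n θ ε‖⁻¹ • R • sphDir n θ ε))) =
      (Iio (1 : ℝ)).indicator (fun _ => ∫⁻ θ in Ioo 0 Real.pi, ∫⁻ ε in Ioo 0 (2 * Real.pi),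
      ENNReal.ofReal (Real.sin θ) * P (sphDir n θ ε)) R := by
    intro R hR
    have hR' : (0 : ℝ) < R := hR
    have hnorm : ∀ θ ε, ‖R • sphDir n θ ε‖ = R := fun θ ε => by
      rw [norm_smul, norm_sphDir hn, mul_one, Real.norm_of_nonneg hR'.le]
    by_cases h1 : R < 1
    · rw [indicator_of_mem (by exact h1)]
      refine setLIntegral_congr_fun measurableSet_Ioo fun θ hθ => ?_
      refine lintegral_congr fun ε => ?_
      rw [radialWeight, indicator_of_mem (by simpa [hnorm] using h1), hnorm, smul_smul,
        inv_mul_cancel₀ hR'.ne', one_smul, ← mul_assoc, ← ENNReal.ofReal_mul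
        (mul_nonneg (sq_nonneg _) (Real.sin_pos_of_mem_Ioo hθ).le)]
      congr 2
      field_simp
    · rw [indicator_of_notMem (by exact h1)]
      simp only [radialWeight]
      simp [hnorm, indicator, h1]
  rw [setLIntegral_congr_fun measurableSet_Ioi this, setLIntegral_indicator measurableSet_Iio,
    Iio_inter_Ioi, setLIntegral_const]
  simp

/-- In spherical coordinates both sides are the integral of Ψ over radius and direction without the
factor R². On the left the radius is the parameter a; on the right the weight |w|⁻² removes the
Jacobian. -/
lemma lintegral_radialWeight_lintegral_ray {Ψ : E3 → ℝ≥0∞} (hΨ : Measurable Ψ) :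
    ∫⁻ z, radialWeight z * ∫⁻ a in Ioi (0 : ℝ), Ψ (a • (‖z‖⁻¹ • z)) =
      ∫⁻ w, ENNReal.ofReal ((‖w‖ ^ 2)⁻¹) * Ψ w := by
  obtain ⟨n, hn⟩ : ∃ n : E3, ‖n‖ = 1 := exists_norm_eq E3 zero_le_one
  have hd := measurable_sphDir_const n
  rw [lintegral_radialWeight_mul hn (P := fun α => ∫⁻ a in Ioi (0 : ℝ), Ψ (a • α))
    (Measurable.lintegral_prod_right' (f := fun z : E3 × ℝ => Ψ (z.2 • z.1)) (by fun_prop)),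
    lintegral_spherical hn (by fun_prop)]
  have hR : ∀ R ∈ Ioi (0 : ℝ), (∫⁻ θ in Ioo 0 Real.pi, ∫⁻ ε in Ioo 0 (2 * Real.pi),
      ENNReal.ofReal (R ^ 2 * Real.sin θ) * (ENNReal.ofReal ((‖R • sphDir n θ ε‖ ^ 2)⁻¹) *
        Ψ (R • sphDir n θ ε))) = ∫⁻ θ in Ioo 0 Real.pi, ∫⁻ ε in Ioo 0 (2 * Real.pi),
      ENNReal.ofReal (Real.sin θ) * Ψ (R • sphDir n θ ε) := by
    intro R hR
    have hR' : (0 : ℝ) < R := hR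
    have hnorm : ∀ θ ε, ‖R • sphDir n θ ε‖ = R := fun θ ε => by
      rw [norm_smul, norm_sphDir hn, mul_one, Real.norm_of_nonneg hR'.le]
    refine setLIntegral_congr_fun measurableSet_Ioo fun θ hθ => ?_
    refine lintegral_congr fun ε => ?_
    rw [hnorm, ← mul_assoc, ← ENNReal.ofReal_mul
        (mul_nonneg (sq_nonneg _) (Real.sin_pos_of_mem_Ioo hθ).le)]
    congr 2
    field_simp
  have hm3 : Measurable fun q : (ℝ × ℝ) × ℝ =>
      ENNReal.ofReal (Real.sin q.1.2) * Ψ (q.1.1 • sphDir n q.1.2 q.2) := by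
    have : Measurable fun q : (ℝ × ℝ) × ℝ => sphDir n q.1.2 q.2 :=
      hd.comp (by fun_prop : Measurable fun q : (ℝ × ℝ) × ℝ => (q.1.2, q.2))
    fun_prop
  rw [setLIntegral_congr_fun measurableSet_Ioi hR]
  symm
  rw [lintegral_lintegral_swap]
  · refine lintegral_congr fun θ => ?_
    rw [lintegral_lintegral_swap]
    · refine lintegral_congr fun ε => ?_
      rw [lintegral_const_mul _ (by fun_prop)]
    · exact (hm3.comp (by fun_prop : Measurable fun q : ℝ × ℝ => ((q.1, θ), q.2))).aemeasurable
  · exact (Measurable.lintegral_prod_right' (f := fun q : (ℝ × ℝ) × ℝ =>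
      ENNReal.ofReal (Real.sin q.1.2) * Ψ (q.1.1 • sphDir n q.1.2 q.2)) hm3).aemeasurable

lemma norm_normalize {w : E3} (hw : w ≠ 0) : ‖‖w‖⁻¹ • w‖ = 1 := by
  rw [norm_smul, norm_inv, norm_norm, inv_mul_cancel₀ (norm_ne_zero_iff.2 hw)]

lemma ae_ne_zero : ∀ᵐ w : E3, w ≠ 0 := by
  simp [ae_iff]

/-- Carleman's change of variables: integrating over a vector `V` and a direction `α` in the
half sphere about `V` amounts to integrating over `w = ⟨V, α⟩ α` and the plane orthogonal to `w`. -/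
lemma lintegral_carleman {F : E3 → E3 → ℝ≥0∞} (hF : Measurable (Function.uncurry F))
    (hpos : ∀ V α, ⟪V, α⟫ ≤ 0 → F V α = 0) :
    ∫⁻ V, ∫⁻ θ in Ioo 0 Real.pi, ∫⁻ ε in Ioo 0 (2 * Real.pi),
        ENNReal.ofReal (Real.sin θ) * F V (sphDir (‖V‖⁻¹ • V) θ ε) =
      ∫⁻ w, ENNReal.ofReal ((‖w‖ ^ 2)⁻¹) * ∫⁻ b : ℝ, ∫⁻ c : ℝ,
        F (w + b • frameTwo (‖w‖⁻¹ • w) + c • frameThree (‖w‖⁻¹ • w)) (‖w‖⁻¹ • w) := by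
  have h2 := measurable_frameTwo
  have h3 := measurable_frameThree
  have hm := measurable_radialWeight
  have hF' : ∀ {α : Type} [MeasurableSpace α] {f g : α → E3}, Measurable f → Measurable g →
      Measurable fun a => F (f a) (g a) := fun hf hg => hF.comp (hf.prodMk hg)
  calc
    -- The pole V/|V| depends on the outer variable. Passing to z removes it, so that V can be
    -- integrated first, with the direction α = z/|z| fixed and V decomposed along α and its
    -- orthogonal plane.
    _ = ∫⁻ V, ∫⁻ z, radialWeight z * F V (‖z‖⁻¹ • z) := by
      refine lintegral_congr_ae (ae_ne_zero.mono fun V hV => ?_)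
      exact (lintegral_radialWeight_mul (norm_normalize hV)
        (hF' measurable_const measurable_id)).symm
    _ = ∫⁻ z, radialWeight z * ∫⁻ V, F V (‖z‖⁻¹ • z) := by
      rw [lintegral_lintegral_swap]
      · refine lintegral_congr fun z => ?_
        exact lintegral_const_mul _ (hF' measurable_id measurable_const)
      · refine Measurable.aemeasurable ?_
        exact Measurable.mul (hm.comp measurable_snd) (hF' measurable_fst (by fun_prop))
    _ = ∫⁻ z, radialWeight z * ∫⁻ a in Ioi (0 : ℝ), (fun w => ∫⁻ b : ℝ, ∫⁻ c : ℝ,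
        F (w + b • frameTwo (‖w‖⁻¹ • w) + c • frameThree (‖w‖⁻¹ • w)) (‖w‖⁻¹ • w))
          (a • (‖z‖⁻¹ • z)) := by
      refine lintegral_congr_ae (ae_ne_zero.mono fun z hz => ?_)
      have hα := norm_normalize hz
      simp only
      congr 1
      set α := ‖z‖⁻¹ • z
      rw [lintegral_frame (F := fun V => F V α) hα (hF' measurable_id measurable_const),
        ← lintegral_indicator measurableSet_Ioi]
      refine lintegral_congr fun a => ?_
      by_cases ha : 0 < a
      · rw [indicator_of_mem (by exact ha)]
        have : ‖a • α‖⁻¹ • a • α = α := by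
          rw [norm_smul, hα, mul_one, Real.norm_of_nonneg ha.le, smul_smul,
            inv_mul_cancel₀ ha.ne', one_smul]
        simp only [this]
      · rw [indicator_of_notMem (by exact ha)]
        have : ∀ b c : ℝ, F (a • α + b • frameTwo α + c • frameThree α) α = 0 := fun b c =>
          hpos _ _ (by rw [inner_frame hα]; exact not_lt.1 ha)
        simp [this]
    _ = _ := by
      refine lintegral_radialWeight_lintegral_ray (Ψ := fun w => ∫⁻ b : ℝ, ∫⁻ c : ℝ,
        F (w + b • frameTwo (‖w‖⁻¹ • w) + c • frameThree (‖w‖⁻¹ • w)) (‖w‖⁻¹ • w)) ?_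
      refine Measurable.lintegral_prod_right' (f := fun q : E3 × ℝ => ∫⁻ c : ℝ,
        F (q.1 + q.2 • frameTwo (‖q.1‖⁻¹ • q.1) + c • frameThree (‖q.1‖⁻¹ • q.1))
          (‖q.1‖⁻¹ • q.1)) ?_
      refine Measurable.lintegral_prod_right' (f := fun q : (E3 × ℝ) × ℝ =>
        F (q.1.1 + q.1.2 • frameTwo (‖q.1.1‖⁻¹ • q.1.1) + q.2 • frameThree (‖q.1.1‖⁻¹ • q.1.1))
          (‖q.1.1‖⁻¹ • q.1.1)) ?_
      exact hF' (by fun_prop) (by fun_prop)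

/-! ### The kernel of the gain terms -/

lemma measurable_maxwellian : Measurable maxwellian := by
  unfold maxwellian; fun_prop

lemma maxwellian_pos (v : E3) : 0 < maxwellian v := by
  unfold maxwellian; positivity

lemma sqrt_maxwellian (v : E3) :
    √(maxwellian v) = √(Real.pi ^ (-(3 / 2) : ℝ)) * Real.exp (-‖v‖ ^ 2 / 2) := by
  rw [maxwellian, Real.sqrt_mul (by positivity), Real.exp_half]

lemma sqrt_maxwellian_le (v : E3) : √(maxwellian v) ≤ Real.exp (-‖v‖ ^ 2 / 2) := by
  rw [sqrt_maxwellian]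
  refine mul_le_of_le_one_left (Real.exp_pos _).le ?_
  refine Real.sqrt_le_one.2 ?_
  exact Real.rpow_le_one_of_one_le_of_nonpos (by linarith [Real.pi_gt_three]) (by norm_num)

/-- The part of the collision integrand which multiplies the unknown at the velocity `v'`, in the
variables `V = v_* - v` and `α`, with respect to the surface measure of the half sphere. -/
def gainIntegrand (β : ℝ → ℝ → ℝ) (v V α : E3) : ℝ≥0∞ :=
  if 0 < ⟪V, α⟫ then
    ENNReal.ofReal (β ‖V‖ (Real.arccos (⟪V, α⟫ / ‖V‖)) / Real.sin (Real.arccos (⟪V, α⟫ / ‖V‖)) *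
      (√(maxwellian (v + V - ⟪V, α⟫ • α)) * √(maxwellian (v + V))))
  else 0

/-- The integral kernel of the gain term with cross-section `β`. -/
@[irreducible]
def gainKer (β : ℝ → ℝ → ℝ) (v w : E3) : ℝ≥0∞ :=
  ENNReal.ofReal ((‖w - v‖ ^ 2)⁻¹) * ∫⁻ b : ℝ, ∫⁻ c : ℝ, gainIntegrand β v
    (w - v + b • frameTwo (‖w - v‖⁻¹ • (w - v)) + c • frameThree (‖w - v‖⁻¹ • (w - v)))
    (‖w - v‖⁻¹ • (w - v))

lemma measurable_gainIntegrand {β : ℝ → ℝ → ℝ} (hβ : Measurable (Function.uncurry β)) :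
    Measurable fun q : E3 × E3 × E3 => gainIntegrand β q.1 q.2.1 q.2.2 := by
  unfold gainIntegrand
  have hM := measurable_maxwellian
  have hb : Measurable fun q : E3 × E3 × E3 =>
      β ‖q.2.1‖ (Real.arccos (⟪q.2.1, q.2.2⟫ / ‖q.2.1‖)) :=
    hβ.comp (f := fun q : E3 × E3 × E3 => (‖q.2.1‖, Real.arccos (⟪q.2.1, q.2.2⟫ / ‖q.2.1‖)))
      (by fun_prop)
  refine Measurable.ite (measurableSet_lt measurable_const (by fun_prop)) ?_ measurable_const
  fun_prop

lemma measurable_gainKer {β : ℝ → ℝ → ℝ} (hβ : Measurable (Function.uncurry β)) :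
    Measurable fun q : E3 × E3 => gainKer β q.1 q.2 := by
  unfold gainKer
  have h2 := measurable_frameTwo
  have h3 := measurable_frameThree
  refine Measurable.mul (by fun_prop) ?_
  refine Measurable.lintegral_prod_right' (f := fun q : (E3 × E3) × ℝ => ∫⁻ c : ℝ,
    gainIntegrand β q.1.1 (q.1.2 - q.1.1 + q.2 • frameTwo (‖q.1.2 - q.1.1‖⁻¹ • (q.1.2 - q.1.1)) +
      c • frameThree (‖q.1.2 - q.1.1‖⁻¹ • (q.1.2 - q.1.1)))
    (‖q.1.2 - q.1.1‖⁻¹ • (q.1.2 - q.1.1))) ?_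
  refine Measurable.lintegral_prod_right' (f := fun q : ((E3 × E3) × ℝ) × ℝ =>
    gainIntegrand β q.1.1.1 (q.1.1.2 - q.1.1.1 +
      q.1.2 • frameTwo (‖q.1.1.2 - q.1.1.1‖⁻¹ • (q.1.1.2 - q.1.1.1)) +
      q.2 • frameThree (‖q.1.1.2 - q.1.1.1‖⁻¹ • (q.1.1.2 - q.1.1.1)))
    (‖q.1.1.2 - q.1.1.1‖⁻¹ • (q.1.1.2 - q.1.1.1))) ?_
  exact (measurable_gainIntegrand hβ).comp (f := fun q : ((E3 × E3) × ℝ) × ℝ =>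
    (q.1.1.1, (q.1.1.2 - q.1.1.1 +
      q.1.2 • frameTwo (‖q.1.1.2 - q.1.1.1‖⁻¹ • (q.1.1.2 - q.1.1.1)) +
      q.2 • frameThree (‖q.1.1.2 - q.1.1.1‖⁻¹ • (q.1.1.2 - q.1.1.1))),
    (‖q.1.1.2 - q.1.1.1‖⁻¹ • (q.1.1.2 - q.1.1.1)))) (by fun_prop)

lemma measurable_collisionDir (v : E3) :
    Measurable fun z : E3 × ℝ × ℝ => collisionDir v z.1 z.2.2 z.2.1 := by
  simp only [collisionDir_eq_sphDir]
  exact measurable_sphDir.comp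
    (f := fun z : E3 × ℝ × ℝ => (‖z.1 - v‖⁻¹ • (z.1 - v), z.2.2, z.2.1)) (by fun_prop)

lemma measurable_postV (v : E3) : Measurable fun z : E3 × ℝ × ℝ => postV v z.1 z.2.2 z.2.1 := by
  have := measurable_collisionDir v
  unfold postV
  fun_prop

lemma measurable_postVs (v : E3) : Measurable fun z : E3 × ℝ × ℝ => postVs v z.1 z.2.2 z.2.1 := by
  have := measurable_collisionDir v
  unfold postVs
  fun_prop

lemma inner_smul_normalize {V : E3} (hV : V ≠ 0) (θ ε : ℝ) :
    ⟪V, sphDir (‖V‖⁻¹ • V) θ ε⟫ = ‖V‖ * Real.cos θ := by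
  have h := inner_sphDir (norm_normalize hV) θ ε
  rw [real_inner_smul_left] at h
  have : ‖V‖ ≠ 0 := norm_ne_zero_iff.2 hV
  rw [← h, ← mul_assoc, mul_inv_cancel₀ this, one_mul]

/-- The gain term in Carleman's variables. -/
lemma lintegral_gain {β : ℝ → ℝ → ℝ} (hβ : Measurable (Function.uncurry β)) (v : E3)
    {ψ : E3 → ℝ≥0∞} (hψ : Measurable ψ) :
    ∫⁻ vs : E3, ∫⁻ ε in Ioc 0 (2 * Real.pi), ∫⁻ θ in Ioc 0 (Real.pi / 2),
      ENNReal.ofReal (β ‖v - vs‖ θ * (√(maxwellian (postVs v vs θ ε)) * √(maxwellian vs))) *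
        ψ (postV v vs θ ε) = ∫⁻ w, gainKer β v w * ψ w := by
  have hM := measurable_maxwellian
  have hI := measurable_gainIntegrand hβ
  have hC := measurable_collisionDir v
  have hp1 := measurable_postV v
  have hp2 := measurable_postVs v
  have hb : Measurable fun z : E3 × ℝ × ℝ => β ‖v - z.1‖ z.2.2 :=
    hβ.comp (f := fun z : E3 × ℝ × ℝ => (‖v - z.1‖, z.2.2)) (by fun_prop)
  have hfull : Measurable fun z : E3 × ℝ × ℝ => ENNReal.ofReal (β ‖v - z.1‖ z.2.2 *
      (√(maxwellian (postVs v z.1 z.2.2 z.2.1)) * √(maxwellian z.1))) *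
        ψ (postV v z.1 z.2.2 z.2.1) := by fun_prop
  have hne : ∀ᵐ vs : E3, vs ≠ v := by simp [ae_iff]
  calc
    -- The factor sin θ of the surface measure compensates the division inside `gainIntegrand`,
    -- where θ is recovered as an arccosine. Angles beyond π/2 contribute nothing because the inner
    -- product is then nonpositive.
    _ = ∫⁻ vs : E3, ∫⁻ θ in Ioo 0 Real.pi, ∫⁻ ε in Ioo 0 (2 * Real.pi),
        ENNReal.ofReal (Real.sin θ) * (gainIntegrand β v (vs - v)
          (sphDir (‖vs - v‖⁻¹ • (vs - v)) θ ε) * ψ (v +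
            ⟪vs - v, sphDir (‖vs - v‖⁻¹ • (vs - v)) θ ε⟫ • sphDir (‖vs - v‖⁻¹ • (vs - v)) θ ε)) := by
      refine lintegral_congr_ae (hne.mono fun vs hvs => ?_)
      have hV : vs - v ≠ 0 := sub_ne_zero.2 hvs
      have hV' : 0 < ‖vs - v‖ := norm_pos_iff.2 hV
      simp only
      rw [lintegral_lintegral_swap]
      · rw [← restrict_Ioo_eq_restrict_Ioc, ← restrict_Ioo_eq_restrict_Ioc]
        rw [← lintegral_indicator measurableSet_Ioo, ← lintegral_indicator measurableSet_Ioo]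
        refine lintegral_congr fun θ => ?_
        by_cases h1 : θ ∈ Ioo 0 (Real.pi / 2)
        · have h2 : θ ∈ Ioo 0 Real.pi := ⟨h1.1, by linarith [h1.2, Real.pi_pos]⟩
          rw [indicator_of_mem h1, indicator_of_mem h2]
          refine lintegral_congr fun ε => ?_
          have hs : 0 < Real.sin θ := Real.sin_pos_of_mem_Ioo h2
          have hc : 0 < Real.cos θ := Real.cos_pos_of_mem_Ioo ⟨by linarith [h1.1, Real.pi_pos], h1.2⟩
          rw [gainIntegrand, inner_smul_normalize hV, if_pos (by positivity),
            mul_div_cancel_left₀ _ hV'.ne', Real.arccos_cos h2.1.le h2.2.le,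
            ← mul_assoc (ENNReal.ofReal (Real.sin θ)), ← ENNReal.ofReal_mul hs.le]
          have e1 : postV v vs θ ε = v + (‖vs - v‖ * Real.cos θ) •
              sphDir (‖vs - v‖⁻¹ • (vs - v)) θ ε := by
            rw [postV, collisionDir_eq_sphDir, inner_smul_normalize hV]
          have e2 : postVs v vs θ ε = v + (vs - v) - (‖vs - v‖ * Real.cos θ) •
              sphDir (‖vs - v‖⁻¹ • (vs - v)) θ ε := by
            rw [postVs, collisionDir_eq_sphDir, inner_smul_normalize hV]; abel_nf
          rw [e1, e2, norm_sub_rev v vs, add_sub_cancel v vs]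
          congr 2
          field_simp
        · rw [indicator_of_notMem h1]
          by_cases h2 : θ ∈ Ioo 0 Real.pi
          · rw [indicator_of_mem h2]
            have hc : Real.cos θ ≤ 0 := by
              refine Real.cos_nonpos_of_pi_div_two_le_of_le ?_ (by linarith [h2.2, Real.pi_pos])
              by_contra hlt
              exact h1 ⟨h2.1, not_le.1 hlt⟩
            have : ∀ ε, gainIntegrand β v (vs - v) (sphDir (‖vs - v‖⁻¹ • (vs - v)) θ ε) = 0 := by
              intro ε
              rw [gainIntegrand, inner_smul_normalize hV, if_neg]
              exact not_lt.2 (mul_nonpos_of_nonneg_of_nonpos hV'.le hc)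
            simp [this]
          · rw [indicator_of_notMem h2]
      · exact (hfull.comp (f := fun q : ℝ × ℝ => (vs, q.1, q.2)) (by fun_prop)).aemeasurable
    _ = ∫⁻ V : E3, ∫⁻ θ in Ioo 0 Real.pi, ∫⁻ ε in Ioo 0 (2 * Real.pi),
        ENNReal.ofReal (Real.sin θ) * (gainIntegrand β v V (sphDir (‖V‖⁻¹ • V) θ ε) *
          ψ (v + ⟪V, sphDir (‖V‖⁻¹ • V) θ ε⟫ • sphDir (‖V‖⁻¹ • V) θ ε)) :=
      lintegral_sub_right_eq_self (fun V : E3 => ∫⁻ θ in Ioo 0 Real.pi,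
        ∫⁻ ε in Ioo 0 (2 * Real.pi), ENNReal.ofReal (Real.sin θ) *
        (gainIntegrand β v V (sphDir (‖V‖⁻¹ • V) θ ε) *
          ψ (v + ⟪V, sphDir (‖V‖⁻¹ • V) θ ε⟫ • sphDir (‖V‖⁻¹ • V) θ ε))) v
    _ = ∫⁻ w : E3, ENNReal.ofReal ((‖w‖ ^ 2)⁻¹) * ∫⁻ b : ℝ, ∫⁻ c : ℝ, (fun V α : E3 =>
        gainIntegrand β v V α * ψ (v + ⟪V, α⟫ • α))
        (w + b • frameTwo (‖w‖⁻¹ • w) + c • frameThree (‖w‖⁻¹ • w)) (‖w‖⁻¹ • w) := by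
      refine lintegral_carleman (F := fun V α : E3 =>
        gainIntegrand β v V α * ψ (v + ⟪V, α⟫ • α)) ?_ ?_
      · refine Measurable.mul ?_ ?_
        · exact hI.comp (f := fun q : E3 × E3 => (v, q.1, q.2)) (by fun_prop)
        · fun_prop
      · intro V α h
        simp [gainIntegrand, not_lt.2 h]
    _ = ∫⁻ w : E3, gainKer β v (v + w) * ψ (v + w) := by
      refine lintegral_congr_ae (ae_ne_zero.mono fun w hw => ?_)
      have hα := norm_normalize hw
      have hw' : ‖w‖ • ‖w‖⁻¹ • w = w := by
        rw [smul_smul, mul_inv_cancel₀ (norm_ne_zero_iff.2 hw), one_smul]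
      have hin : ∀ b c : ℝ, ⟪w + b • frameTwo (‖w‖⁻¹ • w) + c • frameThree (‖w‖⁻¹ • w),
          ‖w‖⁻¹ • w⟫ = ‖w‖ := fun b c => by
        have := inner_frame hα ‖w‖ b c
        rwa [hw'] at this
      simp only [hin, hw', gainKer, add_sub_cancel_left]
      rw [mul_assoc]
      congr 1
      have h2 := measurable_frameTwo
      have h3 := measurable_frameThree
      have hI2 : Measurable fun q : ℝ × ℝ => gainIntegrand β v
          (w + q.1 • frameTwo (‖w‖⁻¹ • w) + q.2 • frameThree (‖w‖⁻¹ • w)) (‖w‖⁻¹ • w) :=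
        hI.comp (f := fun q : ℝ × ℝ => (v,
          w + q.1 • frameTwo (‖w‖⁻¹ • w) + q.2 • frameThree (‖w‖⁻¹ • w), ‖w‖⁻¹ • w)) (by fun_prop)
      rw [← lintegral_mul_const _ (Measurable.lintegral_prod_right' hI2)]
      refine lintegral_congr fun b => ?_
      exact lintegral_mul_const _ (hI2.comp (f := fun c => (b, c)) (by fun_prop))
    _ = _ := lintegral_add_left_eq_self (fun w => gainKer β v w * ψ w) v

/-! ### Bounds for one-dimensional integrals and for the gain kernel -/

lemma lintegral_abs_rpow_lt_top {p : ℝ} (hp : p < 1) (D : ℝ) :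
    ∫⁻ b in Metric.ball (0 : ℝ) D, ENNReal.ofReal (|b| ^ (-p)) < ∞ := by
  have h : IntegrableOn (fun b : ℝ => ‖b‖ ^ (-p)) (Metric.ball 0 D) := by
    rw [integrableOn_fun_norm_addHaar volume (f := fun r : ℝ => r ^ (-p))]
    simp only [Module.finrank_self, Nat.sub_self, pow_zero, one_smul]
    exact (intervalIntegral.intervalIntegrable_rpow' (a := 0) (b := D) (r := -p)
      (by linarith)).1.mono_set Ioo_subset_Ioc_self
  exact h.lintegral_lt_top

lemma lintegral_gaussian_lt_top {a : ℝ} (ha : 0 < a) :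
    ∫⁻ b : ℝ, ENNReal.ofReal (Real.exp (-a * b ^ 2)) < ∞ :=
  (integrable_exp_neg_mul_sq ha).lintegral_lt_top

/-- A bound for `∫ |b|^{-1/2} e^{-a (m + b)²} db` which is uniform in `m`. -/
def singularGaussianBound (a : ℝ) : ℝ≥0∞ :=
  (∫⁻ b in Metric.ball (0 : ℝ) 1, ENNReal.ofReal (|b| ^ (-(1 / 2) : ℝ))) +
    ∫⁻ b : ℝ, ENNReal.ofReal (Real.exp (-a * b ^ 2))

lemma singularGaussianBound_lt_top {a : ℝ} (ha : 0 < a) : singularGaussianBound a < ∞ :=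
  ENNReal.add_lt_top.2 ⟨lintegral_abs_rpow_lt_top (by norm_num) 1, lintegral_gaussian_lt_top ha⟩

lemma lintegral_gaussian_shift_le (a m : ℝ) :
    ∫⁻ b : ℝ, ENNReal.ofReal (Real.exp (-a * (m + b) ^ 2)) ≤ singularGaussianBound a := by
  rw [lintegral_add_left_eq_self (fun b => ENNReal.ofReal (Real.exp (-a * b ^ 2))) m]
  exact le_add_self

/-- For |b| < 1 the Gaussian is at most 1, elsewhere the power is at most 1. Translation invariance
makes the Gaussian part independent of m. -/
lemma lintegral_singular_gaussian_le {a : ℝ} (ha : 0 < a) (m : ℝ) :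
    ∫⁻ b : ℝ, ENNReal.ofReal (|b| ^ (-(1 / 2) : ℝ) * Real.exp (-a * (m + b) ^ 2)) ≤
      singularGaussianBound a := by
  rw [singularGaussianBound, ← lintegral_add_left_eq_self
    (fun b => ENNReal.ofReal (Real.exp (-a * b ^ 2))) m, ← lintegral_indicator measurableSet_ball,
    ← lintegral_add_right _ (by fun_prop)]
  refine lintegral_mono fun b => ?_
  by_cases hb : |b| < 1
  · rw [indicator_of_mem (by simpa using hb)]
    refine le_add_right (ENNReal.ofReal_le_ofReal ?_)
    refine mul_le_of_le_one_right (by positivity) (Real.exp_le_one_iff.2 ?_)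
    nlinarith [sq_nonneg (m + b)]
  · rw [indicator_of_notMem (by simpa using not_lt.1 hb), zero_add]
    refine ENNReal.ofReal_le_ofReal ?_
    refine mul_le_of_le_one_left (Real.exp_pos _).le ?_
    exact Real.rpow_le_one_of_one_le_of_nonpos (not_lt.1 hb) (by norm_num)

/-- Splits the planar singularity 1/r into a product of two integrable one-dimensional ones, so that
planar integrals factor by Tonelli. -/
lemma inv_le_abs_rpow_mul {b c r : ℝ} (hb : b ≠ 0) (hc : c ≠ 0) (hr : 0 < r) (hbr : |b| ≤ r)
    (hcr : |c| ≤ r) : r⁻¹ ≤ |b| ^ (-(1 / 2) : ℝ) * |c| ^ (-(1 / 2) : ℝ) := by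
  have hb' : 0 < |b| := abs_pos.2 hb
  have hc' : 0 < |c| := abs_pos.2 hc
  calc r⁻¹ = r ^ (-(1 / 2) : ℝ) * r ^ (-(1 / 2) : ℝ) := by
        rw [← Real.rpow_add hr, ← Real.rpow_neg_one]; norm_num
    _ ≤ _ := mul_le_mul (Real.rpow_le_rpow_of_nonpos hb' hbr (by norm_num))
        (Real.rpow_le_rpow_of_nonpos hc' hcr (by norm_num)) (by positivity) (by positivity)

lemma exists_frame_coordinates {n : E3} (hn : ‖n‖ = 1) (m : E3) :
    ∃ a b c : ℝ, m = a • n + b • frameTwo n + c • frameThree n := by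
  refine ⟨(frameBasis hn).repr m 0, (frameBasis hn).repr m 1, (frameBasis hn).repr m 2, ?_⟩
  rw [← frameBasis_repr_symm hn (fun i => (frameBasis hn).repr m i)]
  simp

lemma ae_real_ne_zero : ∀ᵐ b : ℝ, b ≠ 0 := by simp [ae_iff]

lemma lintegral_gaussian_product_le {a : ℝ} (ha : 0 < a) (m₂ m₃ : ℝ) :
    ∫⁻ b : ℝ, ∫⁻ c : ℝ, ENNReal.ofReal ((1 + |b| ^ (-(1 / 2) : ℝ) * |c| ^ (-(1 / 2) : ℝ)) *
      (Real.exp (-a * (m₂ + b) ^ 2) * Real.exp (-a * (m₃ + c) ^ 2))) ≤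
      2 * singularGaussianBound a ^ 2 := by
  have e : ∀ b c : ℝ, ENNReal.ofReal ((1 + |b| ^ (-(1 / 2) : ℝ) * |c| ^ (-(1 / 2) : ℝ)) *
      (Real.exp (-a * (m₂ + b) ^ 2) * Real.exp (-a * (m₃ + c) ^ 2))) =
      ENNReal.ofReal (Real.exp (-a * (m₂ + b) ^ 2)) * ENNReal.ofReal (Real.exp (-a * (m₃ + c) ^ 2)) +
      ENNReal.ofReal (|b| ^ (-(1 / 2) : ℝ) * Real.exp (-a * (m₂ + b) ^ 2)) *
        ENNReal.ofReal (|c| ^ (-(1 / 2) : ℝ) * Real.exp (-a * (m₃ + c) ^ 2)) := by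
    intro b c
    rw [← ENNReal.ofReal_mul (by positivity), ← ENNReal.ofReal_mul (by positivity),
      ← ENNReal.ofReal_add (by positivity) (by positivity)]
    congr 1
    ring
  simp_rw [e]
  have hm : Measurable fun c : ℝ => |c| ^ (-(1 / 2) : ℝ) := by fun_prop
  simp_rw [fun b : ℝ => lintegral_add_left (μ := (volume : Measure ℝ))
    (f := fun c => ENNReal.ofReal (Real.exp (-a * (m₂ + b) ^ 2)) *
      ENNReal.ofReal (Real.exp (-a * (m₃ + c) ^ 2))) (by fun_prop)
    (fun c => ENNReal.ofReal (|b| ^ (-(1 / 2) : ℝ) * Real.exp (-a * (m₂ + b) ^ 2)) *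
        ENNReal.ofReal (|c| ^ (-(1 / 2) : ℝ) * Real.exp (-a * (m₃ + c) ^ 2)))]
  simp_rw [fun b : ℝ => lintegral_const_mul (μ := (volume : Measure ℝ))
    (f := fun c => ENNReal.ofReal (Real.exp (-a * (m₃ + c) ^ 2)))
    (ENNReal.ofReal (Real.exp (-a * (m₂ + b) ^ 2))) (by fun_prop),
    fun b : ℝ => lintegral_const_mul (μ := (volume : Measure ℝ))
    (f := fun c => ENNReal.ofReal (|c| ^ (-(1 / 2) : ℝ) * Real.exp (-a * (m₃ + c) ^ 2)))
    (ENNReal.ofReal (|b| ^ (-(1 / 2) : ℝ) * Real.exp (-a * (m₂ + b) ^ 2))) (by fun_prop)]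
  rw [lintegral_add_left (by fun_prop), lintegral_mul_const _ (by fun_prop),
    lintegral_mul_const _ (by fun_prop), two_mul, sq]
  gcongr
  exacts [lintegral_gaussian_shift_le _ _, lintegral_gaussian_shift_le _ _,
    lintegral_singular_gaussian_le ha _, lintegral_singular_gaussian_le ha _]

/-- The upper bound in Grad's cutoff assumption. -/
def CutoffBound (β : ℝ → ℝ → ℝ) (C γ : ℝ) : Prop :=
  ∀ V : ℝ, 0 ≤ V → ∀ θ ∈ Icc (0 : ℝ) (Real.pi / 2),
    0 ≤ β V θ ∧ β V θ ≤ C * V ^ γ * Real.cos θ * Real.sin θ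

/-- Write V = u + b e₂ + c e₃ with u = w - v and ρ = |u|. Since cos θ = ρ/|V|, the cutoff bounds
β/sin θ by Cρ|V|^(γ-1). Around the midpoint of v and w, with coordinates m, the two half Maxwellians
have total exponent -(m₁² + ρ²/4 + (m₂+b)² + (m₃+c)²). The integral over (b, c) is therefore bounded
uniformly in v, and the prefactors ρ⁻² and ρ combine to ρ⁻¹. -/
lemma gainKer_le {β : ℝ → ℝ → ℝ} {C γ : ℝ} (hC : 0 ≤ C) (hγ : γ ∈ Icc (0 : ℝ) 1)
    (hβ : CutoffBound β C γ) : ∃ A : ℝ, 0 ≤ A ∧ ∀ v w : E3, v ≠ w →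
      gainKer β v w ≤ ENNReal.ofReal (A * (‖v - w‖⁻¹ * Real.exp (-‖v - w‖ ^ 2 / 8))) := by
  have hfin : 2 * singularGaussianBound 1 ^ 2 < ∞ :=
    ENNReal.mul_lt_top (by simp) (ENNReal.pow_lt_top (singularGaussianBound_lt_top one_pos))
  refine ⟨C * (2 * singularGaussianBound 1 ^ 2).toReal, by positivity, fun v w hvw => ?_⟩
  have hu : w - v ≠ 0 := sub_ne_zero.2 hvw.symm
  rw [gainKer, norm_sub_rev v w]
  set u := w - v with hu_def
  have hα := norm_normalize hu
  have hρ : 0 < ‖u‖ := norm_pos_iff.2 hu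
  set α := ‖u‖⁻¹ • u with hα_def
  have huα : u = ‖u‖ • α := by
    rw [hα_def, smul_smul, mul_inv_cancel₀ hρ.ne', one_smul]
  obtain ⟨m₁, m₂, m₃, hm⟩ := exists_frame_coordinates hα (v + (1 / 2 : ℝ) • u)
  set ρ := ‖u‖
  have key : ∀ b c : ℝ, b ≠ 0 → c ≠ 0 →
      gainIntegrand β v (u + b • frameTwo α + c • frameThree α) α ≤
      ENNReal.ofReal (C * ρ * Real.exp (-ρ ^ 2 / 4)) *
      ENNReal.ofReal ((1 + |b| ^ (-(1 / 2) : ℝ) * |c| ^ (-(1 / 2) : ℝ)) *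
      (Real.exp (-1 * (m₂ + b) ^ 2) * Real.exp (-1 * (m₃ + c) ^ 2))) := by
    intro b c hb hc
    have hin : ⟪u + b • frameTwo α + c • frameThree α, α⟫ = ρ := by
      have := inner_frame hα ρ b c
      rwa [← huα] at this
    have hV : ‖u + b • frameTwo α + c • frameThree α‖ ^ 2 = ρ ^ 2 + b ^ 2 + c ^ 2 := by
      have := norm_sq_frame hα ρ b c
      rwa [← huα] at this
    rw [gainIntegrand, hin, if_pos hρ, ← ENNReal.ofReal_mul (by positivity)]
    have e1 : v + (u + b • frameTwo α + c • frameThree α) - ρ • α =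
        (m₁ - ρ / 2) • α + (m₂ + b) • frameTwo α + (m₃ + c) • frameThree α := by
      have : v = m₁ • α + m₂ • frameTwo α + m₃ • frameThree α - (1 / 2 : ℝ) • ρ • α := by
        rw [← hm, ← huα]; abel
      rw [this, huα]; module
    have e2 : v + (u + b • frameTwo α + c • frameThree α) =
        (m₁ + ρ / 2) • α + (m₂ + b) • frameTwo α + (m₃ + c) • frameThree α := by
      have : v = m₁ • α + m₂ • frameTwo α + m₃ • frameThree α - (1 / 2 : ℝ) • ρ • α := by
        rw [← hm, ← huα]; abel
      rw [this, huα]; module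
    have hM : √(maxwellian (v + (u + b • frameTwo α + c • frameThree α) - ρ • α)) *
        √(maxwellian (v + (u + b • frameTwo α + c • frameThree α))) ≤ Real.exp (-ρ ^ 2 / 4) *
          (Real.exp (-1 * (m₂ + b) ^ 2) * Real.exp (-1 * (m₃ + c) ^ 2)) := by
      refine (mul_le_mul (sqrt_maxwellian_le _) (sqrt_maxwellian_le _) (Real.sqrt_nonneg _)
        (Real.exp_pos _).le).trans ?_
      rw [← Real.exp_add, ← Real.exp_add, ← Real.exp_add, Real.exp_le_exp, e1, e2,
        norm_sq_frame hα, norm_sq_frame hα]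
      nlinarith [sq_nonneg m₁]
    set r := ‖u + b • frameTwo α + c • frameThree α‖
    have hr : 0 < r := by
      have : 0 < r ^ 2 := by rw [hV]; positivity
      refine (norm_nonneg _).lt_of_ne' fun h0 => ?_
      exact this.ne' (by change r = 0 at h0; rw [h0]; simp)
    have hb' : |b| ≤ r := abs_le_of_sq_le_sq (by nlinarith [sq_nonneg c]) hr.le
    have hc' : |c| ≤ r := abs_le_of_sq_le_sq (by nlinarith [sq_nonneg b]) hr.le
    have hρr : ρ ≤ r := (abs_le_of_sq_le_sq' (by nlinarith [sq_nonneg b, sq_nonneg c]) hr.le).2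
    have hx1 : ρ / r ≤ 1 := (div_le_one hr).2 hρr
    have hx0 : 0 ≤ ρ / r := by positivity
    have hβr : β r (Real.arccos (ρ / r)) / Real.sin (Real.arccos (ρ / r)) ≤
        C * ρ * (1 + |b| ^ (-(1 / 2) : ℝ) * |c| ^ (-(1 / 2) : ℝ)) := by
      have h1 := (hβ r hr.le (Real.arccos (ρ / r))
        ⟨Real.arccos_nonneg _, Real.arccos_le_pi_div_two.2 hx0⟩).2
      rw [Real.cos_arccos (by linarith) hx1] at h1
      have hs : 0 ≤ Real.sin (Real.arccos (ρ / r)) :=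
        Real.sin_nonneg_of_nonneg_of_le_pi (Real.arccos_nonneg _) (Real.arccos_le_pi _)
      -- For r ≥ 1 the bound γ ≤ 1 gives r^(γ-1) ≤ 1. For r ≤ 1 the bound γ ≥ 0 gives r^(γ-1) ≤ 1/r,
      -- which is split between b and c.
      have h2 : r ^ γ / r ≤ 1 + |b| ^ (-(1 / 2) : ℝ) * |c| ^ (-(1 / 2) : ℝ) := by
        rcases le_total 1 r with h | h
        · have : r ^ γ / r ≤ 1 := by
            rw [div_le_one hr]
            simpa using Real.rpow_le_rpow_of_exponent_le h hγ.2
          exact this.trans (le_add_of_nonneg_right (by positivity))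
        · have : r ^ γ / r ≤ r⁻¹ := by
            rw [div_eq_mul_inv]
            exact mul_le_of_le_one_left (by positivity) (Real.rpow_le_one hr.le h hγ.1)
          linarith [inv_le_abs_rpow_mul hb hc hr hb' hc']
      refine (div_le_of_le_mul₀ hs (by positivity) (h1.trans ?_))
      refine mul_le_mul_of_nonneg_right ?_ hs
      calc C * r ^ γ * (ρ / r) = C * ρ * (r ^ γ / r) := by ring
        _ ≤ _ := mul_le_mul_of_nonneg_left h2 (by positivity)
    refine ENNReal.ofReal_le_ofReal ?_
    calc _ ≤ C * ρ * (1 + |b| ^ (-(1 / 2) : ℝ) * |c| ^ (-(1 / 2) : ℝ)) * (Real.exp (-ρ ^ 2 / 4) *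
          (Real.exp (-1 * (m₂ + b) ^ 2) * Real.exp (-1 * (m₃ + c) ^ 2))) :=
          mul_le_mul hβr hM (by positivity) (by positivity)
      _ = _ := by ring
  have hfinite : ∫⁻ b : ℝ, ∫⁻ c : ℝ, gainIntegrand β v (u + b • frameTwo α + c • frameThree α) α ≤
      ENNReal.ofReal (C * ρ * Real.exp (-ρ ^ 2 / 4)) * (2 * singularGaussianBound 1 ^ 2) := by
    refine le_trans ?_ (mul_le_mul_right (lintegral_gaussian_product_le one_pos m₂ m₃) _)
    have hm : Measurable fun c : ℝ => |c| ^ (-(1 / 2) : ℝ) := by fun_prop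
    rw [← lintegral_const_mul' _ _ ENNReal.ofReal_ne_top]
    refine lintegral_mono_ae (ae_real_ne_zero.mono fun b hb => ?_)
    rw [← lintegral_const_mul' _ _ ENNReal.ofReal_ne_top]
    exact lintegral_mono_ae (ae_real_ne_zero.mono fun c hc => key b c hb hc)
  refine (mul_le_mul_right hfinite _).trans ?_
  rw [← ENNReal.ofReal_toReal hfin.ne, ← ENNReal.ofReal_mul (by positivity),
    ← ENNReal.ofReal_mul (by positivity), ENNReal.toReal_ofReal (by positivity)]
  refine ENNReal.ofReal_le_ofReal ?_
  -- The rate is weakened from 1/4 to 1/8 to match the common majorant shared with the loss term.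
  have : Real.exp (-ρ ^ 2 / 4) ≤ Real.exp (-ρ ^ 2 / 8) := by
    rw [Real.exp_le_exp]; nlinarith [sq_nonneg ρ]
  calc _ = C * (2 * singularGaussianBound 1 ^ 2).toReal * (ρ⁻¹ * Real.exp (-ρ ^ 2 / 4)) := by
        field_simp
    _ ≤ _ := by gcongr

/-! ### Exchanging the two post-collisional velocities -/

lemma postV_add_postVs (v vs : E3) (θ ε : ℝ) : postV v vs θ ε + postVs v vs θ ε = v + vs := by
  rw [postV, postVs]; abel

/-- The unit vector with angles (π/2 - θ, ε + π) lies in the collision plane and is orthogonal to α.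
The part of v_* - v left over after projecting on α is its projection on that vector, so both
post-collisional velocities have the same form. -/
lemma postVs_eq_postV {v vs : E3} (h : vs ≠ v) (θ ε : ℝ) :
    postVs v vs θ ε = postV v vs (Real.pi / 2 - θ) (ε + Real.pi) := by
  have hV : vs - v ≠ 0 := sub_ne_zero.2 h
  have hn : ‖vs - v‖ ≠ 0 := norm_ne_zero_iff.2 hV
  rw [postV, postVs, collisionDir_eq_sphDir, collisionDir_eq_sphDir, inner_smul_normalize hV,
    inner_smul_normalize hV, Real.cos_pi_div_two_sub]
  set n := ‖vs - v‖⁻¹ • (vs - v) with hn_def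
  have e : vs = v + ‖vs - v‖ • n := by
    rw [hn_def, smul_smul, mul_inv_cancel₀ hn, one_smul]; abel
  generalize ‖vs - v‖ = r at e
  rw [e, sphDir, sphDir, Real.cos_pi_div_two_sub, Real.sin_pi_div_two_sub, Real.cos_add_pi,
    Real.sin_add_pi]
  have h1 := Real.sin_sq_add_cos_sq θ
  have h2 : r • n = (r * (Real.sin θ ^ 2 + Real.cos θ ^ 2)) • n := by rw [h1, mul_one]
  rw [h2]
  module

lemma postV_eq_postVs {v vs : E3} (h : vs ≠ v) (θ ε : ℝ) :
    postV v vs θ ε = postVs v vs (Real.pi / 2 - θ) (ε + Real.pi) := by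
  rw [eq_sub_of_add_eq (postV_add_postVs v vs θ ε), postVs_eq_postV h,
    eq_sub_of_add_eq' (postV_add_postVs v vs (Real.pi / 2 - θ) (ε + Real.pi))]

lemma setLIntegral_periodic_shift {G : ℝ → ℝ≥0∞} (hG : Function.Periodic G (2 * Real.pi))
    (a : ℝ) : ∫⁻ ε in Ioc 0 (2 * Real.pi), G (ε + a) = ∫⁻ ε in Ioc 0 (2 * Real.pi), G ε := by
  have hT : (0 : ℝ) < 2 * Real.pi := by positivity
  have e : (fun ε : ℝ => ε + a) ⁻¹' Ioc a (a + 2 * Real.pi) = Ioc 0 (2 * Real.pi) := by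
    ext ε; simp only [mem_preimage, mem_Ioc]
    constructor <;> rintro ⟨h1, h2⟩ <;> constructor <;> linarith
  rw [← e, (measurePreserving_add_right volume a).setLIntegral_comp_preimage_emb
    (measurableEmbedding_addRight a)]
  have := (isAddFundamentalDomain_Ioc hT a volume).setLIntegral_eq
    (isAddFundamentalDomain_Ioc hT 0 volume) G ?_
  · rw [this, e, zero_add]
  · rintro ⟨g, hg⟩ x
    obtain ⟨n, rfl⟩ := AddSubgroup.mem_zmultiples_iff.1 hg
    change G (n • (2 * Real.pi) + x) = G x
    rw [add_comm]
    exact hG.zsmul n x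

lemma sphDir_periodic (n : E3) (θ ε : ℝ) : sphDir n θ (ε + 2 * Real.pi) = sphDir n θ ε := by
  simp [sphDir]

/-- The substitution θ ↦ π/2 - θ, ε ↦ ε + π exchanges v' and v'_*. The gain term at v'_* thus
reduces to the one at v' for a reflected cross-section, which obeys the same cutoff because cos θ
sin θ is symmetric. -/
lemma lintegral_gain_swap {β : ℝ → ℝ → ℝ} (hβ : Measurable (Function.uncurry β)) (v : E3)
    {ψ : E3 → ℝ≥0∞} (hψ : Measurable ψ) :
    ∫⁻ vs : E3, ∫⁻ ε in Ioc 0 (2 * Real.pi), ∫⁻ θ in Ioc 0 (Real.pi / 2),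
      ENNReal.ofReal (β ‖v - vs‖ θ * (√(maxwellian (postV v vs θ ε)) * √(maxwellian vs))) *
        ψ (postVs v vs θ ε) =
      ∫⁻ w, gainKer (fun r θ => β r (Real.pi / 2 - θ)) v w * ψ w := by
  have hβ' : Measurable (Function.uncurry fun r θ => β r (Real.pi / 2 - θ)) :=
    hβ.comp (f := fun q : ℝ × ℝ => (q.1, Real.pi / 2 - q.2)) (by fun_prop)
  rw [← lintegral_gain hβ' v hψ]
  have hne : ∀ᵐ vs : E3, vs ≠ v := by simp [ae_iff]
  refine lintegral_congr_ae (hne.mono fun vs hvs => ?_)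
  simp only
  set H : ℝ → ℝ → ℝ≥0∞ := fun ε θ => ENNReal.ofReal (β ‖v - vs‖ (Real.pi / 2 - θ) *
    (√(maxwellian (postVs v vs θ ε)) * √(maxwellian vs))) * ψ (postV v vs θ ε) with hH
  have e1 : ∀ ε θ, ENNReal.ofReal (β ‖v - vs‖ θ * (√(maxwellian (postV v vs θ ε)) *
      √(maxwellian vs))) * ψ (postVs v vs θ ε) = H (ε + Real.pi) (Real.pi / 2 - θ) := by
    intro ε θ
    simp only [hH]
    rw [postV_eq_postVs hvs θ ε, postVs_eq_postV hvs θ ε, sub_sub_cancel]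
  have e2 : ∀ ε, ∫⁻ θ in Ioc 0 (Real.pi / 2), H ε (Real.pi / 2 - θ) =
      ∫⁻ θ in Ioc 0 (Real.pi / 2), H ε θ := by
    intro ε
    rw [← restrict_Ioo_eq_restrict_Ioc]
    have e : (fun θ : ℝ => Real.pi / 2 - θ) ⁻¹' Ioo 0 (Real.pi / 2) = Ioo 0 (Real.pi / 2) := by
      ext θ; simp only [mem_preimage, mem_Ioo]
      constructor <;> rintro ⟨h1, h2⟩ <;> constructor <;> linarith
    conv_lhs => rw [← e]
    exact (Measure.measurePreserving_sub_left volume (Real.pi / 2)).setLIntegral_comp_preimage_emb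
      (MeasurableEquiv.subLeft (Real.pi / 2)).measurableEmbedding _ _
  simp_rw [e1, e2]
  refine setLIntegral_periodic_shift (G := fun ε => ∫⁻ θ in Ioc 0 (Real.pi / 2), H ε θ) ?_ _
  intro ε
  simp only [hH, postV, postVs, collisionDir_eq_sphDir, sphDir_periodic]

/-! ### Pushing forward to an integral kernel -/

/-- If the measure `g • m`, pushed forward by `T`, has density `kE`, then integrals against it of
almost everywhere defined functions are integrals against `kE`. -/
lemma integrable_and_integral_of_pushforward {Z : Type*} [MeasurableSpace Z] {m : Measure Z}
    {g : Z → ℝ} (hg : Measurable g) (hg0 : ∀ᵐ z ∂m, 0 ≤ g z) {T : Z → E3} (hT : Measurable T)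
    {kE : E3 → ℝ≥0∞} (hk : Measurable kE) (hkfin : ∀ᵐ w, kE w < ∞)
    (hpush : ∀ ψ : E3 → ℝ≥0∞, Measurable ψ →
      ∫⁻ z, ENNReal.ofReal (g z) * ψ (T z) ∂m = ∫⁻ w, kE w * ψ w)
    {φ : E3 → ℝ} (hφ : AEStronglyMeasurable φ volume) (hfinite : ∫⁻ w, kE w * ‖φ w‖ₑ < ∞) :
    Integrable (fun z => g z * φ (T z)) m ∧ Integrable (fun w => (kE w).toReal * φ w) ∧
      ∫ z, g z * φ (T z) ∂m = ∫ w, (kE w).toReal * φ w := by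
  have hgE : Measurable fun z => ENNReal.ofReal (g z) := by fun_prop
  -- Testing `hpush` on indicators identifies the two measures. As the image is absolutely
  -- continuous, φ needs to be only almost everywhere strongly measurable.
  have hmap : (m.withDensity fun z => ENNReal.ofReal (g z)).map T = volume.withDensity kE := by
    ext s hs
    rw [Measure.map_apply hT hs, withDensity_apply _ (hT hs), withDensity_apply _ hs,
      ← lintegral_indicator (hT hs), ← lintegral_indicator hs]
    have := hpush (s.indicator 1) (measurable_one.indicator hs)
    refine (lintegral_congr fun z => ?_).trans (this.trans (lintegral_congr fun w => ?_))
    · by_cases hz : T z ∈ s <;> simp [indicator, hz]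
    · by_cases hw : w ∈ s <;> simp [indicator, hw]
  have hφ' : AEStronglyMeasurable φ ((m.withDensity fun z => ENNReal.ofReal (g z)).map T) := by
    rw [hmap]
    exact hφ.mono_ac (withDensity_absolutelyContinuous _ _)
  have hgr : ∀ᵐ z ∂m, (ENNReal.ofReal (g z)).toReal • φ (T z) = g z * φ (T z) :=
    hg0.mono fun z hz => by rw [ENNReal.toReal_ofReal hz, smul_eq_mul]
  have h1 : Integrable φ (volume.withDensity kE) := by
    refine ⟨hmap ▸ hφ', ?_⟩
    rw [HasFiniteIntegral,
      lintegral_withDensity_eq_lintegral_mul_non_measurable₀ _ hk.aemeasurable hkfin]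
    exact hfinite
  refine ⟨?_, (integrable_withDensity_iff_integrable_smul' hk hkfin).1 h1, ?_⟩
  · rw [← hmap, integrable_map_measure hφ' hT.aemeasurable,
      integrable_withDensity_iff_integrable_smul' hgE (by simp)] at h1
    exact h1.congr hgr
  · rw [← integral_congr_ae hgr,
      ← integral_withDensity_eq_integral_toReal_smul hgE (by simp) (fun z => φ (T z)),
      ← integral_map hT.aemeasurable hφ', hmap,
      integral_withDensity_eq_integral_toReal_smul hk hkfin]
    rfl

/-! ### The dominating kernel -/

/-- The function dominating the kernel of `K`. -/
def gradBound (z : E3) : ℝ := ‖z‖⁻¹ * Real.exp (-‖z‖ ^ 2 / 8)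

lemma gradBound_nonneg (z : E3) : 0 ≤ gradBound z := by unfold gradBound; positivity

lemma gradBound_sub_comm (v w : E3) : gradBound (v - w) = gradBound (w - v) := by
  unfold gradBound; rw [norm_sub_rev]

lemma measurable_gradBound : Measurable gradBound := by unfold gradBound; fun_prop

lemma one_add_pow_le_exp (n : ℕ) {c : ℝ} (hc : 0 < c) :
    ∃ A : ℝ, 0 ≤ A ∧ ∀ y : ℝ, 0 ≤ y → (1 + y) ^ n ≤ A * Real.exp (c * y ^ 2) := by
  -- The exponential series gives (1+y)^n ≤ n! exp(1+y), and completing the square gives y ≤ c y² +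
  -- 1/(4c).
  refine ⟨n.factorial * Real.exp (1 + 1 / (4 * c)), by positivity, fun y hy => ?_⟩
  have h1 := Real.pow_div_factorial_le_exp (1 + y) (by linarith) n
  rw [div_le_iff₀ (by positivity)] at h1
  refine h1.trans ?_
  rw [mul_comm, mul_assoc, ← Real.exp_add]
  refine mul_le_mul_of_nonneg_left (Real.exp_le_exp.2 ?_) (by positivity)
  have : 0 ≤ c * (y - 1 / (2 * c)) ^ 2 := by positivity
  have e : c * (y - 1 / (2 * c)) ^ 2 = c * y ^ 2 - y + 1 / (4 * c) := by field_simp; ring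
  linarith

/-- Half of the Gaussian absorbs the polynomial weight, and the radial Jacobian r² absorbs r^(-j).
The cases j = 1 and j = 2 serve `gradBound` and its square. -/
lemma integrable_singular_gaussian {j : ℕ} (hj : j ≤ 2) (n : ℕ) {c : ℝ} (hc : 0 < c) :
    Integrable fun z : E3 => (1 + ‖z‖) ^ n * ((‖z‖⁻¹) ^ j * Real.exp (-c * ‖z‖ ^ 2)) := by
  obtain ⟨A, hA, h⟩ := one_add_pow_le_exp n (half_pos hc)
  have h0 : Integrable fun z : E3 => A * ((‖z‖⁻¹) ^ j * Real.exp (-(c / 2) * ‖z‖ ^ 2)) := by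
    refine Integrable.const_mul ?_ A
    rw [integrable_fun_norm_addHaar volume (f := fun r => (r⁻¹) ^ j * Real.exp (-(c / 2) * r ^ 2))]
    have hs := (integrable_rpow_mul_exp_neg_mul_sq (half_pos hc) (s := (2 - j : ℕ))
      (by have : (0 : ℝ) ≤ (2 - j : ℕ) := Nat.cast_nonneg _
          linarith)).integrableOn (s := Ioi (0 : ℝ))
    refine hs.congr_fun (fun r hr => ?_) measurableSet_Ioi
    have hr' : (r : ℝ) ≠ 0 := (mem_Ioi.1 hr).ne'
    simp only [finrank_euclideanSpace, Fintype.card_fin, smul_eq_mul]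
    rw [Real.rpow_natCast, ← mul_assoc]
    congr 1
    rw [inv_pow, eq_mul_inv_iff_mul_eq₀ (pow_ne_zero _ hr'), ← pow_add]
    congr 1
    omega
  refine h0.mono' (by fun_prop) (ae_of_all _ fun z => ?_)
  rw [Real.norm_of_nonneg (by positivity)]
  calc _ ≤ (A * Real.exp (c / 2 * ‖z‖ ^ 2)) * ((‖z‖⁻¹) ^ j * Real.exp (-c * ‖z‖ ^ 2)) := by
        gcongr; exact h _ (norm_nonneg _)
    _ = A * ((‖z‖⁻¹) ^ j * (Real.exp (c / 2 * ‖z‖ ^ 2) * Real.exp (-c * ‖z‖ ^ 2))) := by ring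
    _ = _ := by rw [← Real.exp_add]; ring_nf

lemma lintegral_gradBound_lt_top (n : ℕ) :
    ∫⁻ z, ENNReal.ofReal ((1 + ‖z‖) ^ n * gradBound z) < ∞ := by
  have := (integrable_singular_gaussian one_le_two n (c := 1 / 8) (by norm_num)).lintegral_lt_top
  refine lt_of_eq_of_lt (lintegral_congr fun z => ?_) this
  rw [gradBound]
  congr 3
  · simp
  · ring_nf

lemma lintegral_gradBound_sq_lt_top (n : ℕ) :
    ∫⁻ z, ENNReal.ofReal ((1 + ‖z‖) ^ n * gradBound z ^ 2) < ∞ := by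
  have := (integrable_singular_gaussian le_rfl n (c := 1 / 4) (by norm_num)).lintegral_lt_top
  refine lt_of_eq_of_lt (lintegral_congr fun z => ?_) this
  rw [gradBound, mul_pow, ← Real.exp_nat_mul]
  congr 4
  push_cast
  ring

/-! ### The integral kernel of `K` -/

/-- The integral kernel of the loss term. -/
@[irreducible]
def lossKer (B : ℝ → ℝ → ℝ) (v w : E3) : ℝ≥0∞ :=
  ∫⁻ _ε in Ioc 0 (2 * Real.pi), ∫⁻ θ in Ioc 0 (Real.pi / 2),
    ENNReal.ofReal (B ‖v - w‖ θ * (√(maxwellian v) * √(maxwellian w)))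

/-- The integral kernel of `K`. -/
def gradKer (B : ℝ → ℝ → ℝ) (v w : E3) : ℝ :=
  -- The majorant `gradBound` vanishes at 0, because the inverse of 0 is 0. The value 0 on the
  -- diagonal keeps the pointwise bound true for every pair (v, w).
  if v = w then 0
  else (gainKer (fun r θ => B r (Real.pi / 2 - θ)) v w).toReal + (gainKer B v w).toReal -
    (lossKer B v w).toReal

lemma measurable_lossKer {B : ℝ → ℝ → ℝ} (hB : Measurable (Function.uncurry B)) :
    Measurable fun q : E3 × E3 => lossKer B q.1 q.2 := by
  unfold lossKer
  have hM := measurable_maxwellian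
  have hb : Measurable fun q : ((E3 × E3) × ℝ) × ℝ => B ‖q.1.1.1 - q.1.1.2‖ q.2 :=
    hB.comp (f := fun q : ((E3 × E3) × ℝ) × ℝ => (‖q.1.1.1 - q.1.1.2‖, q.2)) (by fun_prop)
  refine Measurable.lintegral_prod_right' (f := fun q : (E3 × E3) × ℝ =>
    ∫⁻ θ in Ioc 0 (Real.pi / 2), ENNReal.ofReal (B ‖q.1.1 - q.1.2‖ θ *
      (√(maxwellian q.1.1) * √(maxwellian q.1.2)))) ?_
  refine Measurable.lintegral_prod_right' (f := fun q : ((E3 × E3) × ℝ) × ℝ =>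
    ENNReal.ofReal (B ‖q.1.1.1 - q.1.1.2‖ q.2 *
      (√(maxwellian q.1.1.1) * √(maxwellian q.1.1.2)))) ?_
  fun_prop

lemma measurable_gradKer {B : ℝ → ℝ → ℝ} (hB : Measurable (Function.uncurry B)) :
    Measurable (Function.uncurry (gradKer B)) := by
  have hB' : Measurable (Function.uncurry fun r θ => B r (Real.pi / 2 - θ)) :=
    hB.comp (f := fun q : ℝ × ℝ => (q.1, Real.pi / 2 - q.2)) (by fun_prop)
  have h1 := (measurable_gainKer hB').ennreal_toReal
  have h2 := (measurable_gainKer hB).ennreal_toReal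
  have h3 := (measurable_lossKer hB).ennreal_toReal
  exact Measurable.ite (measurableSet_eq_fun measurable_fst measurable_snd) measurable_const
    ((h1.add h2).sub h3)

lemma CutoffBound.swap {B : ℝ → ℝ → ℝ} {C γ : ℝ} (h : CutoffBound B C γ) :
    CutoffBound (fun r θ => B r (Real.pi / 2 - θ)) C γ := by
  intro V hV θ hθ
  have := h V hV (Real.pi / 2 - θ) ⟨by linarith [hθ.2], by linarith [hθ.1]⟩
  rw [Real.cos_pi_div_two_sub, Real.sin_pi_div_two_sub] at this
  exact ⟨this.1, this.2.trans (le_of_eq (by ring))⟩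

/-- The parallelogram law bounds √M(v)√M(w) by exp(-|v-w|²/4). Half of this decay pays for replacing
|v-w|^γ by 8|v-w|⁻¹ exp(|v-w|²/8), whence the rate 1/8 in `gradBound`. -/
lemma lossKer_le {B : ℝ → ℝ → ℝ} {C γ : ℝ} (hC : 0 ≤ C) (hγ : γ ∈ Icc (0 : ℝ) 1)
    (hB : CutoffBound B C γ) : ∃ A : ℝ, 0 ≤ A ∧ ∀ v w : E3, v ≠ w →
      lossKer B v w ≤ ENNReal.ofReal (A * gradBound (v - w)) := by
  refine ⟨C * 8 * (Real.pi / 2) * (2 * Real.pi), by positivity, fun v w hvw => ?_⟩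
  have hr : 0 < ‖v - w‖ := norm_pos_iff.2 (sub_ne_zero.2 hvw)
  have key : ∀ θ ∈ Ioc 0 (Real.pi / 2),
      ENNReal.ofReal (B ‖v - w‖ θ * (√(maxwellian v) * √(maxwellian w))) ≤
        ENNReal.ofReal (C * 8 * gradBound (v - w)) := by
    intro θ hθ
    refine ENNReal.ofReal_le_ofReal ?_
    have h1 : B ‖v - w‖ θ ≤ C * ‖v - w‖ ^ γ := by
      refine (hB _ hr.le θ ⟨hθ.1.le, hθ.2⟩).2.trans ?_
      have hs := Real.sin_le_one θ
      have hs0 := Real.sin_nonneg_of_nonneg_of_le_pi hθ.1.le (by linarith [hθ.2, Real.pi_pos])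
      have hc := Real.cos_le_one θ
      refine (mul_le_of_le_one_right ?_ hs).trans (mul_le_of_le_one_right (by positivity) hc)
      have hc0 := Real.cos_nonneg_of_neg_pi_div_two_le_of_le
        (by linarith [hθ.1, Real.pi_pos]) hθ.2
      positivity
    have h2 : √(maxwellian v) * √(maxwellian w) ≤ Real.exp (-‖v - w‖ ^ 2 / 4) := by
      refine (mul_le_mul (sqrt_maxwellian_le _) (sqrt_maxwellian_le _) (Real.sqrt_nonneg _)
        (Real.exp_pos _).le).trans ?_
      rw [← Real.exp_add, Real.exp_le_exp]
      have := parallelogram_law_with_norm ℝ v w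
      nlinarith [sq_nonneg ‖v + w‖]
    have h3 : ‖v - w‖ ^ γ ≤ 8 * (‖v - w‖⁻¹ * Real.exp (‖v - w‖ ^ 2 / 8)) := by
      set r := ‖v - w‖
      have e1 := Real.add_one_le_exp (r ^ 2 / 8)
      have : r ^ γ * r ≤ 1 + r ^ 2 := by
        rcases le_total 1 r with h | h
        · have : r ^ γ ≤ r := by simpa using Real.rpow_le_rpow_of_exponent_le h hγ.2
          nlinarith
        · have := Real.rpow_le_one hr.le h hγ.1
          nlinarith
      rw [← mul_le_mul_iff_left₀ hr]
      calc r ^ γ * r ≤ 8 * Real.exp (r ^ 2 / 8) := by linarith [sq_nonneg r]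
        _ = _ := by field_simp
    have hB0 := (hB _ hr.le θ ⟨hθ.1.le, hθ.2⟩).1
    calc _ ≤ (C * (8 * (‖v - w‖⁻¹ * Real.exp (‖v - w‖ ^ 2 / 8)))) *
          Real.exp (-‖v - w‖ ^ 2 / 4) :=
          mul_le_mul (h1.trans (mul_le_mul_of_nonneg_left h3 hC)) h2 (by positivity)
            (by positivity)
      _ = C * 8 * (‖v - w‖⁻¹ * (Real.exp (‖v - w‖ ^ 2 / 8) * Real.exp (-‖v - w‖ ^ 2 / 4))) := by
          ring
      _ = _ := by rw [← Real.exp_add, gradBound]; ring_nf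
  rw [lossKer]
  calc _ ≤ ∫⁻ _ε in Ioc 0 (2 * Real.pi), ∫⁻ _θ in Ioc 0 (Real.pi / 2),
        ENNReal.ofReal (C * 8 * gradBound (v - w)) :=
        lintegral_mono fun _ => setLIntegral_mono measurable_const key
    _ = _ := by
      have := gradBound_nonneg (v - w)
      simp only [setLIntegral_const, Real.volume_Ioc, sub_zero]
      rw [← ENNReal.ofReal_mul (by positivity), ← ENNReal.ofReal_mul (by positivity)]
      congr 1
      ring

lemma abs_gradKer_le {B : ℝ → ℝ → ℝ} {C γ : ℝ} (hC : 0 ≤ C) (hγ : γ ∈ Icc (0 : ℝ) 1)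
    (hB : CutoffBound B C γ) : ∃ A : ℝ, 0 ≤ A ∧ (∀ v w : E3, v ≠ w →
      gainKer (fun r θ => B r (Real.pi / 2 - θ)) v w ≤ ENNReal.ofReal (A * gradBound (v - w)) ∧
      gainKer B v w ≤ ENNReal.ofReal (A * gradBound (v - w)) ∧
      lossKer B v w ≤ ENNReal.ofReal (A * gradBound (v - w))) ∧
      ∀ v w : E3, |gradKer B v w| ≤ 3 * A * gradBound (v - w) := by
  obtain ⟨A₁, hA₁, h₁⟩ := gainKer_le hC hγ hB.swap
  obtain ⟨A₂, hA₂, h₂⟩ := gainKer_le hC hγ hB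
  obtain ⟨A₃, hA₃, h₃⟩ := lossKer_le hC hγ hB
  have hk : ∀ v w : E3, v ≠ w →
      gainKer (fun r θ => B r (Real.pi / 2 - θ)) v w ≤
        ENNReal.ofReal ((A₁ + A₂ + A₃) * gradBound (v - w)) ∧
      gainKer B v w ≤ ENNReal.ofReal ((A₁ + A₂ + A₃) * gradBound (v - w)) ∧
      lossKer B v w ≤ ENNReal.ofReal ((A₁ + A₂ + A₃) * gradBound (v - w)) := by
    intro v w h
    have h0 := gradBound_nonneg (v - w)
    refine ⟨(h₁ v w h).trans (ENNReal.ofReal_le_ofReal ?_),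
      (h₂ v w h).trans (ENNReal.ofReal_le_ofReal ?_),
      (h₃ v w h).trans (ENNReal.ofReal_le_ofReal ?_)⟩
    · exact mul_le_mul_of_nonneg_right (by linarith) h0
    · exact mul_le_mul_of_nonneg_right (by linarith) h0
    · exact mul_le_mul_of_nonneg_right (by linarith) h0
  refine ⟨A₁ + A₂ + A₃, by positivity, hk, fun v w => ?_⟩
  have h0 := gradBound_nonneg (v - w)
  have hA : 0 ≤ (A₁ + A₂ + A₃) * gradBound (v - w) := by positivity
  rw [gradKer]
  split_ifs with h
  · rw [abs_zero]; linarith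
  · obtain ⟨l₁, l₂, l₃⟩ := hk v w h
    have t₁ := ENNReal.toReal_le_of_le_ofReal hA l₁
    have t₂ := ENNReal.toReal_le_of_le_ofReal hA l₂
    have t₃ := ENNReal.toReal_le_of_le_ofReal hA l₃
    rw [abs_le]
    constructor <;> linarith [ENNReal.toReal_nonneg (a := lossKer B v w),
      ENNReal.toReal_nonneg (a := gainKer B v w),
      ENNReal.toReal_nonneg (a := gainKer (fun r θ => B r (Real.pi / 2 - θ)) v w)]

/-! ### `K` as an integral operator -/

/-- Lebesgue measure in the collision parameters `(v_*, ε, θ)`. -/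
abbrev collisionMeasure : Measure (E3 × ℝ × ℝ) :=
  (volume : Measure E3).prod ((volume.restrict (Ioc 0 (2 * Real.pi))).prod
    (volume.restrict (Ioc 0 (Real.pi / 2))))

lemma iterated_integral_eq {f : E3 → ℝ → ℝ → ℝ}
    (hf : Integrable (fun z : E3 × ℝ × ℝ => f z.1 z.2.1 z.2.2) collisionMeasure) :
    ∫ vs : E3, ∫ ε in (0 : ℝ)..(2 * Real.pi), ∫ θ in (0 : ℝ)..(Real.pi / 2), f vs ε θ =
      ∫ z, f z.1 z.2.1 z.2.2 ∂collisionMeasure := by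
  rw [integral_prod _ hf]
  refine integral_congr_ae (hf.prod_right_ae.mono fun vs hvs => ?_)
  simp only at hvs ⊢
  rw [integral_prod _ hvs, intervalIntegral.integral_of_le (by positivity)]
  refine integral_congr_ae (ae_of_all _ fun ε => ?_)
  exact intervalIntegral.integral_of_le (by positivity)

lemma lintegral_collisionMeasure {f : E3 → ℝ → ℝ → ℝ≥0∞}
    (hf : Measurable fun z : E3 × ℝ × ℝ => f z.1 z.2.1 z.2.2) :
    ∫⁻ z, f z.1 z.2.1 z.2.2 ∂collisionMeasure =
      ∫⁻ vs : E3, ∫⁻ ε in Ioc 0 (2 * Real.pi), ∫⁻ θ in Ioc 0 (Real.pi / 2), f vs ε θ := by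
  rw [lintegral_prod _ hf.aemeasurable]
  refine lintegral_congr fun vs => ?_
  exact lintegral_prod (fun q : ℝ × ℝ => f vs q.1 q.2)
    (hf.comp (by fun_prop : Measurable fun q : ℝ × ℝ => (vs, q))).aemeasurable

lemma ae_collisionMeasure_mem : ∀ᵐ z ∂collisionMeasure, z.2.2 ∈ Ioc 0 (Real.pi / 2) := by
  have h1 : ∀ᵐ θ ∂volume.restrict (Ioc 0 (Real.pi / 2)), θ ∈ Ioc 0 (Real.pi / 2) :=
    ae_restrict_mem measurableSet_Ioc
  have h2 := (Measure.quasiMeasurePreserving_snd (μ := volume.restrict (Ioc 0 (2 * Real.pi)))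
    (ν := volume.restrict (Ioc 0 (Real.pi / 2)))).ae h1
  exact (Measure.quasiMeasurePreserving_snd (μ := (volume : Measure E3))).ae h2

lemma norm_postV_sq_add (v vs : E3) (hvs : vs ≠ v) (θ ε : ℝ) :
    ‖postV v vs θ ε‖ ^ 2 + ‖postVs v vs θ ε‖ ^ 2 = ‖v‖ ^ 2 + ‖vs‖ ^ 2 := by
  have hα : ‖collisionDir v vs θ ε‖ = 1 := by
    rw [collisionDir_eq_sphDir, norm_sphDir (norm_normalize (sub_ne_zero.2 hvs))]
  rw [postV, postVs, norm_add_sq_real, norm_sub_sq_real, norm_smul, hα, mul_one,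
    inner_smul_right, inner_smul_right, inner_sub_left, Real.norm_eq_abs, sq_abs]
  ring

lemma sqrt_maxwellian_post (v vs : E3) (hvs : vs ≠ v) (θ ε : ℝ) :
    √(maxwellian (postV v vs θ ε)) * √(maxwellian (postVs v vs θ ε)) =
      √(maxwellian v) * √(maxwellian vs) := by
  have h := norm_postV_sq_add v vs hvs θ ε
  simp only [sqrt_maxwellian]
  have e : Real.exp (-‖postV v vs θ ε‖ ^ 2 / 2) * Real.exp (-‖postVs v vs θ ε‖ ^ 2 / 2) =
      Real.exp (-‖v‖ ^ 2 / 2) * Real.exp (-‖vs‖ ^ 2 / 2) := by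
    rw [← Real.exp_add, ← Real.exp_add]; congr 1; linarith
  linear_combination √(Real.pi ^ (-(3 / 2) : ℝ)) ^ 2 * e

lemma lintegral_ker_mul_lt_top {kE : E3 → ℝ≥0∞} {A : ℝ} (hA : 0 ≤ A) {v : E3}
    (hk : ∀ w, v ≠ w → kE w ≤ ENNReal.ofReal (A * gradBound (v - w))) {φ : E3 → ℝ}
    (hφ : ∫⁻ w, ENNReal.ofReal (gradBound (v - w)) * ‖φ w‖ₑ < ∞) :
    ∫⁻ w, kE w * ‖φ w‖ₑ < ∞ := by
  have hne : ∀ᵐ w : E3, w ≠ v := by simp [ae_iff]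
  have h1 : ∫⁻ w, kE w * ‖φ w‖ₑ ≤
      ∫⁻ w, ENNReal.ofReal A * (ENNReal.ofReal (gradBound (v - w)) * ‖φ w‖ₑ) := by
    refine lintegral_mono_ae (hne.mono fun w hw => ?_)
    rw [← mul_assoc, ← ENNReal.ofReal_mul hA]
    exact mul_le_mul_left (hk w hw.symm) _
  refine h1.trans_lt ?_
  rw [lintegral_const_mul' _ _ ENNReal.ofReal_ne_top]
  exact ENNReal.mul_lt_top ENNReal.ofReal_lt_top hφ

lemma lintegral_gradBound_sub_lt_top (v : E3) :
    ∫⁻ w, ENNReal.ofReal (gradBound (v - w)) < ∞ := by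
  rw [lintegral_sub_left_eq_self (fun z => ENNReal.ofReal (gradBound z)) v]
  simpa using lintegral_gradBound_lt_top 0

-- Energy conservation gives √M(v')√M(v'_*) = √M(v)√M(v_*), so every term of L f carries a factor
-- √M(v) that cancels. Of the four terms, the one containing f(v) is -νf and is removed by adding
-- νf. The other three contain f at v'_*, v' and v_*, and each is pushed forward to an integral
-- against its own kernel. The finiteness assumption makes all of them absolutely convergent, which
-- justifies splitting the integral.
set_option maxHeartbeats 400000 in
theorem linearizedL_add_collisionFreq {B : ℝ → ℝ → ℝ} (hBm : Measurable (Function.uncurry B))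
    {C γ : ℝ} (hC : 0 ≤ C) (hγ : γ ∈ Icc (0 : ℝ) 1) (hB : CutoffBound B C γ) (v : E3)
    {φ : E3 → ℝ} (hφm : AEStronglyMeasurable φ volume)
    (hφ : ∫⁻ w, ENNReal.ofReal (gradBound (v - w)) * ‖φ w‖ₑ < ∞) :
    linearizedL B φ v + collisionFreq B v * φ v = ∫ w, gradKer B v w * φ w := by
  obtain ⟨A, hA, hk, -⟩ := abs_gradKer_le hC hγ hB
  have hM := measurable_maxwellian
  have hne : ∀ᵐ w : E3, w ≠ v := by simp [ae_iff]
  have hneZ : ∀ᵐ z ∂collisionMeasure, z.1 ≠ v :=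
    (Measure.quasiMeasurePreserving_fst (μ := (volume : Measure E3))).ae hne
  have hb : Measurable fun z : E3 × ℝ × ℝ => B ‖v - z.1‖ z.2.2 :=
    hBm.comp (f := fun z : E3 × ℝ × ℝ => (‖v - z.1‖, z.2.2)) (by fun_prop)
  have hb0 : ∀ᵐ z ∂collisionMeasure, 0 ≤ B ‖v - z.1‖ z.2.2 :=
    ae_collisionMeasure_mem.mono fun z hz => (hB _ (norm_nonneg _) _ ⟨hz.1.le, hz.2⟩).1
  have hpV := measurable_postV v
  have hpVs := measurable_postVs v
  have hBm' : Measurable (Function.uncurry fun r θ => B r (Real.pi / 2 - θ)) :=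
    hBm.comp (f := fun q : ℝ × ℝ => (q.1, Real.pi / 2 - q.2)) (by fun_prop)
  have hfin : ∀ {kE : E3 → ℝ≥0∞}, (∀ w, v ≠ w → kE w ≤ ENNReal.ofReal (A * gradBound (v - w))) →
      ∀ᵐ w, kE w < ∞ := fun h => hne.mono fun w hw => (h w hw.symm).trans_lt ENNReal.ofReal_lt_top
  set g₁ : E3 × ℝ × ℝ → ℝ := fun z => B ‖v - z.1‖ z.2.2 *
    (√(maxwellian (postV v z.1 z.2.2 z.2.1)) * √(maxwellian z.1)) with hg₁
  set g₂ : E3 × ℝ × ℝ → ℝ := fun z => B ‖v - z.1‖ z.2.2 *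
    (√(maxwellian (postVs v z.1 z.2.2 z.2.1)) * √(maxwellian z.1)) with hg₂
  set g₃ : E3 × ℝ × ℝ → ℝ := fun z => B ‖v - z.1‖ z.2.2 *
    (√(maxwellian v) * √(maxwellian z.1)) with hg₃
  have hg₁m : Measurable g₁ := by fun_prop
  have hg₂m : Measurable g₂ := by fun_prop
  have hg₃m : Measurable g₃ := by fun_prop
  obtain ⟨i₁, j₁, e₁⟩ := integrable_and_integral_of_pushforward (m := collisionMeasure) hg₁m
    (hb0.mono fun z hz => by positivity) hpVs
    (measurable_gainKer hBm').of_uncurry_left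
    (hfin fun w hw => (hk v w hw).1)
    (fun ψ hψ => by
      rw [lintegral_collisionMeasure (f := fun vs ε θ => ENNReal.ofReal (g₁ (vs, ε, θ)) *
        ψ (postVs v vs θ ε)) (by fun_prop)]
      exact lintegral_gain_swap hBm v hψ) hφm
    (lintegral_ker_mul_lt_top hA (fun w hw => (hk v w hw).1) hφ)
  obtain ⟨i₂, j₂, e₂⟩ := integrable_and_integral_of_pushforward (m := collisionMeasure) hg₂m
    (hb0.mono fun z hz => by positivity) hpV
    (measurable_gainKer hBm).of_uncurry_left
    (hfin fun w hw => (hk v w hw).2.1)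
    (fun ψ hψ => by
      rw [lintegral_collisionMeasure (f := fun vs ε θ => ENNReal.ofReal (g₂ (vs, ε, θ)) *
        ψ (postV v vs θ ε)) (by fun_prop)]
      exact lintegral_gain hBm v hψ) hφm
    (lintegral_ker_mul_lt_top hA (fun w hw => (hk v w hw).2.1) hφ)
  have push₃ : ∀ ψ : E3 → ℝ≥0∞, Measurable ψ →
      ∫⁻ z, ENNReal.ofReal (g₃ z) * ψ z.1 ∂collisionMeasure = ∫⁻ w, lossKer B v w * ψ w := by
    intro ψ hψ
    rw [lintegral_collisionMeasure (f := fun vs ε θ => ENNReal.ofReal (g₃ (vs, ε, θ)) *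
        ψ vs) (by fun_prop)]
    refine lintegral_congr fun vs => ?_
    have hθ : Measurable fun θ : ℝ => g₃ (vs, 0, θ) := by fun_prop
    have : ∀ ε : ℝ, ∫⁻ θ in Ioc 0 (Real.pi / 2), ENNReal.ofReal (g₃ (vs, ε, θ)) * ψ vs =
        (∫⁻ θ in Ioc 0 (Real.pi / 2), ENNReal.ofReal (g₃ (vs, 0, θ))) * ψ vs := fun ε =>
      lintegral_mul_const _ (by fun_prop)
    simp_rw [this]
    rw [lintegral_mul_const _ measurable_const, lossKer]
  have hl : Measurable (lossKer B v) := (measurable_lossKer hBm).of_uncurry_left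
  have hg₃0 : ∀ᵐ z ∂collisionMeasure, 0 ≤ g₃ z := hb0.mono fun z hz => by positivity
  have hlfin : ∀ᵐ w, lossKer B v w < ∞ := hfin fun w hw => (hk v w hw).2.2
  have loss : ∀ {φ : E3 → ℝ}, AEStronglyMeasurable φ volume →
      ∫⁻ w, ENNReal.ofReal (gradBound (v - w)) * ‖φ w‖ₑ < ∞ → _ := fun {φ} h1 h2 =>
    integrable_and_integral_of_pushforward (T := Prod.fst) (kE := lossKer B v) hg₃m hg₃0
      measurable_fst hl hlfin push₃ (φ := φ) h1
      (lintegral_ker_mul_lt_top hA (fun w hw => (hk v w hw).2.2) h2)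
  obtain ⟨i₃, j₃, e₃⟩ := loss hφm hφ
  have hMv : 0 < √(maxwellian v) := Real.sqrt_pos.2 (maxwellian_pos v)
  have hMM : ∀ w : E3, maxwellian w = √(maxwellian w) * √(maxwellian w) := fun w =>
    (Real.mul_self_sqrt (maxwellian_pos w).le).symm
  have hφ₀ : ∫⁻ w, ENNReal.ofReal (gradBound (v - w)) * ‖√(maxwellian w) / √(maxwellian v)‖ₑ < ∞ := by
    have h1 : ∀ w, ‖√(maxwellian w) / √(maxwellian v)‖ₑ ≤ ENNReal.ofReal (1 / √(maxwellian v)) := by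
      intro w
      rw [Real.enorm_of_nonneg (by positivity)]
      refine ENNReal.ofReal_le_ofReal (div_le_div_of_nonneg_right ?_ hMv.le)
      exact (sqrt_maxwellian_le w).trans (Real.exp_le_one_iff.2 (by nlinarith [sq_nonneg ‖w‖]))
    refine (lintegral_mono fun w => mul_le_mul_right (h1 w) _).trans_lt ?_
    rw [lintegral_mul_const' _ _ ENNReal.ofReal_ne_top]
    exact ENNReal.mul_lt_top (lintegral_gradBound_sub_lt_top v) ENNReal.ofReal_lt_top
  -- With φ = √M/√M(v) the loss integrand is exactly the integrand of ν, so its integrability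
  -- follows from the same pushforward.
  obtain ⟨i₄, -, -⟩ := loss (φ := fun w => √(maxwellian w) / √(maxwellian v)) (by fun_prop) hφ₀
  have i₄' : Integrable (fun z : E3 × ℝ × ℝ => maxwellian z.1 * B ‖v - z.1‖ z.2.2)
      collisionMeasure := by
    refine i₄.congr (ae_of_all _ fun z => ?_)
    simp only [hg₃]
    rw [show B ‖v - z.1‖ z.2.2 * (√(maxwellian v) * √(maxwellian z.1)) *
      (√(maxwellian z.1) / √(maxwellian v)) = B ‖v - z.1‖ z.2.2 *
        (√(maxwellian z.1) * √(maxwellian z.1)) by field_simp, ← hMM, mul_comm]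
  have hν : collisionFreq B v = ∫ z, maxwellian z.1 * B ‖v - z.1‖ z.2.2 ∂collisionMeasure :=
    iterated_integral_eq (f := fun vs _ θ => maxwellian vs * B ‖v - vs‖ θ) i₄'
  have hQ₁ : collisionQ B maxwellian (fun w => √(maxwellian w) * φ w) v =
      √(maxwellian v) * (∫ z, g₁ z * φ (postVs v z.1 z.2.2 z.2.1) ∂collisionMeasure) -
      √(maxwellian v) * ∫ z, g₃ z * φ z.1 ∂collisionMeasure := by
    rw [← integral_const_mul, ← integral_const_mul,
      ← integral_sub (i₁.const_mul _) (i₃.const_mul _)]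
    have hae : ∀ᵐ z ∂collisionMeasure, √(maxwellian v) *
        (g₁ z * φ (postVs v z.1 z.2.2 z.2.1)) - √(maxwellian v) * (g₃ z * φ z.1) =
        (maxwellian (postV v z.1 z.2.2 z.2.1) * (√(maxwellian (postVs v z.1 z.2.2 z.2.1)) *
          φ (postVs v z.1 z.2.2 z.2.1)) - maxwellian v * (√(maxwellian z.1) * φ z.1)) *
          B ‖v - z.1‖ z.2.2 := by
      refine hneZ.mono fun z hz => ?_
      have := sqrt_maxwellian_post v z.1 hz z.2.2 z.2.1
      simp only [hg₁, hg₃]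
      linear_combination (- √(maxwellian (postV v z.1 z.2.2 z.2.1)) *
        φ (postVs v z.1 z.2.2 z.2.1) * B ‖v - z.1‖ z.2.2) * this -
        (√(maxwellian (postVs v z.1 z.2.2 z.2.1)) * φ (postVs v z.1 z.2.2 z.2.1) *
          B ‖v - z.1‖ z.2.2) * hMM (postV v z.1 z.2.2 z.2.1) +
        (√(maxwellian z.1) * φ z.1 * B ‖v - z.1‖ z.2.2) * hMM v
    rw [integral_congr_ae hae]
    exact iterated_integral_eq (f := fun vs ε θ =>
      (maxwellian (postV v vs θ ε) * (√(maxwellian (postVs v vs θ ε)) * φ (postVs v vs θ ε)) -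
        maxwellian v * (√(maxwellian vs) * φ vs)) * B ‖v - vs‖ θ)
      (((i₁.const_mul _).sub (i₃.const_mul _)).congr hae)
  have hQ₂ : collisionQ B (fun w => √(maxwellian w) * φ w) maxwellian v =
      √(maxwellian v) * (∫ z, g₂ z * φ (postV v z.1 z.2.2 z.2.1) ∂collisionMeasure) -
      √(maxwellian v) * φ v * collisionFreq B v := by
    rw [hν, ← integral_const_mul, ← integral_const_mul,
      ← integral_sub (i₂.const_mul _) (i₄'.const_mul _)]
    have hae : ∀ᵐ z ∂collisionMeasure, √(maxwellian v) *
        (g₂ z * φ (postV v z.1 z.2.2 z.2.1)) - √(maxwellian v) * φ v *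
          (maxwellian z.1 * B ‖v - z.1‖ z.2.2) =
        (√(maxwellian (postV v z.1 z.2.2 z.2.1)) * φ (postV v z.1 z.2.2 z.2.1) *
          maxwellian (postVs v z.1 z.2.2 z.2.1) - √(maxwellian v) * φ v * maxwellian z.1) *
          B ‖v - z.1‖ z.2.2 := by
      refine hneZ.mono fun z hz => ?_
      have := sqrt_maxwellian_post v z.1 hz z.2.2 z.2.1
      simp only [hg₂]
      linear_combination (- √(maxwellian (postVs v z.1 z.2.2 z.2.1)) *
        φ (postV v z.1 z.2.2 z.2.1) * B ‖v - z.1‖ z.2.2) * this -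
        (√(maxwellian (postV v z.1 z.2.2 z.2.1)) * φ (postV v z.1 z.2.2 z.2.1) *
          B ‖v - z.1‖ z.2.2) * hMM (postVs v z.1 z.2.2 z.2.1)
    rw [integral_congr_ae hae]
    exact iterated_integral_eq (f := fun vs ε θ =>
      (√(maxwellian (postV v vs θ ε)) * φ (postV v vs θ ε) * maxwellian (postVs v vs θ ε) -
        √(maxwellian v) * φ v * maxwellian vs) * B ‖v - vs‖ θ)
      (((i₂.const_mul _).sub (i₄'.const_mul _)).congr hae)
  have hker : ∀ᵐ w, gradKer B v w * φ w =
      (gainKer (fun r θ => B r (Real.pi / 2 - θ)) v w).toReal * φ w +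
        (gainKer B v w).toReal * φ w - (lossKer B v w).toReal * φ w :=
    hne.mono fun w hw => by rw [gradKer, if_neg hw.symm]; ring
  have hj : ∫ w, gradKer B v w * φ w = (∫ w, (gainKer (fun r θ => B r (Real.pi / 2 - θ)) v w).toReal * φ w) +
      (∫ w, (gainKer B v w).toReal * φ w) - ∫ w, (lossKer B v w).toReal * φ w := by
    rw [integral_congr_ae hker, ← integral_add j₁ j₂]
    exact integral_sub (j₁.add j₂) j₃
  rw [hj, ← e₁, ← e₂, ← e₃, linearizedL, hQ₁, hQ₂]
  field_simp
  ring

/-! ### Cauchy–Schwarz inequalities for lower integrals -/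

lemma lintegral_mul_sq_le {α : Type*} [MeasurableSpace α] {μ : Measure α} {f g : α → ℝ≥0∞}
    (hf : AEMeasurable f μ) (hg : AEMeasurable g μ) :
    (∫⁻ a, f a * g a ∂μ) ^ 2 ≤ (∫⁻ a, f a ^ 2 ∂μ) * ∫⁻ a, g a ^ 2 ∂μ := by
  have h := ENNReal.lintegral_mul_le_Lp_mul_Lq μ Real.HolderConjugate.two_two hf hg
  calc (∫⁻ a, f a * g a ∂μ) ^ 2
      ≤ ((∫⁻ a, f a ^ (2 : ℝ) ∂μ) ^ (1 / 2 : ℝ) * (∫⁻ a, g a ^ (2 : ℝ) ∂μ) ^ (1 / 2 : ℝ)) ^ 2 :=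
        pow_le_pow_left' h 2
    _ = _ := by
      rw [mul_pow, ← ENNReal.rpow_natCast, ← ENNReal.rpow_natCast, ← ENNReal.rpow_mul,
        ← ENNReal.rpow_mul]
      norm_num

lemma lintegral_mul_sq_le_weighted {α : Type*} [MeasurableSpace α] {μ : Measure α}
    {f g : α → ℝ≥0∞} (hf : AEMeasurable f μ) (hg : AEMeasurable g μ) :
    (∫⁻ a, f a * g a ∂μ) ^ 2 ≤ (∫⁻ a, f a ∂μ) * ∫⁻ a, f a * g a ^ 2 ∂μ := by
  have hs : ∀ x : ℝ≥0∞, (x ^ (1 / 2 : ℝ)) ^ 2 = x := fun x => by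
    rw [← ENNReal.rpow_natCast, ← ENNReal.rpow_mul]; norm_num
  have h := lintegral_mul_sq_le (μ := μ) (hf.pow_const (1 / 2 : ℝ))
    ((hf.pow_const (1 / 2 : ℝ)).mul hg)
  simp only [Pi.mul_apply, mul_pow, hs, ← mul_assoc, ← sq] at h
  exact h

/-! ### The operators on the whole space -/

/-- The integral operator with kernel `k` acting in the velocity variable. -/
def kerOp (k : E3 → E3 → ℝ) (g : E3 × E3 → ℝ) (p : E3 × E3) : ℝ := ∫ w, k p.2 w * g (p.1, w)

/-- The solution operator of the damped transport equation on the whole space. -/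
def transOp (ν : E3 → ℝ) (h : E3 × E3 → ℝ) (p : E3 × E3) : ℝ :=
  ∫ s in Ioi (0 : ℝ), Real.exp (-(ν p.2 * s)) * h (p.1 - s • p.2, p.2)

/-- Restriction in the space variable to `Ω`, extended by zero. -/
def cut (Ω : Set E3) (g : E3 × E3 → ℝ) : E3 × E3 → ℝ := (Ω ×ˢ univ).indicator g

lemma cut_of_mem {Ω : Set E3} {x : E3} (hx : x ∈ Ω) (g : E3 × E3 → ℝ) (v : E3) :
    cut Ω g (x, v) = g (x, v) := indicator_of_mem (by simp [hx]) _

lemma cut_of_notMem {Ω : Set E3} {x : E3} (hx : x ∉ Ω) (g : E3 × E3 → ℝ) (v : E3) :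
    cut Ω g (x, v) = 0 := indicator_of_notMem (by simp [hx]) _

lemma enorm_cut_le (Ω : Set E3) (g : E3 × E3 → ℝ) (p : E3 × E3) : ‖cut Ω g p‖ₑ ≤ ‖g p‖ₑ := by
  unfold cut indicator; split_ifs <;> simp

/-- One step of the iteration, acting on functions on the whole space. -/
def stepOp (Ω : Set E3) (ν : E3 → ℝ) (k : E3 → E3 → ℝ) (g : E3 × E3 → ℝ) : E3 × E3 → ℝ :=
  cut Ω (transOp ν (cut Ω (kerOp k g)))

/-- `k` is a measurable kernel dominated by `A * gradBound`. -/
structure IsGradKernel (k : E3 → E3 → ℝ) (A : ℝ) : Prop where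
  measurable : Measurable (Function.uncurry k)
  nonneg : 0 ≤ A
  bound : ∀ v w, |k v w| ≤ A * gradBound (v - w)

/-- `ν` is a measurable collision frequency bounded below by `ν₀ > 0`. -/
structure IsFrequency (ν : E3 → ℝ) (ν₀ : ℝ) : Prop where
  measurable : Measurable ν
  pos : 0 < ν₀
  bound : ∀ v, ν₀ ≤ ν v

lemma measurable_cut {Ω : Set E3} (hΩ : MeasurableSet Ω) {g : E3 × E3 → ℝ} (hg : Measurable g) :
    Measurable (cut Ω g) := hg.indicator (hΩ.prod MeasurableSet.univ)

lemma measurable_kerOp {k : E3 → E3 → ℝ} (hk : Measurable (Function.uncurry k))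
    {g : E3 × E3 → ℝ} (hg : Measurable g) : Measurable (kerOp k g) := by
  have : Measurable fun q : (E3 × E3) × E3 => k q.1.2 q.2 * g (q.1.1, q.2) :=
    (hk.comp (f := fun q : (E3 × E3) × E3 => (q.1.2, q.2)) (by fun_prop)).mul
      (hg.comp (f := fun q : (E3 × E3) × E3 => (q.1.1, q.2)) (by fun_prop))
  exact (this.stronglyMeasurable.integral_prod_right').measurable

lemma measurable_transOp {ν : E3 → ℝ} (hν : Measurable ν) {h : E3 × E3 → ℝ} (hh : Measurable h) :
    Measurable (transOp ν h) := by
  have : Measurable fun q : (E3 × E3) × ℝ =>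
      Real.exp (-(ν q.1.2 * q.2)) * h (q.1.1 - q.2 • q.1.2, q.1.2) :=
    Measurable.mul (by fun_prop)
      (hh.comp (f := fun q : (E3 × E3) × ℝ => (q.1.1 - q.2 • q.1.2, q.1.2)) (by fun_prop))
  exact (this.stronglyMeasurable.integral_prod_right').measurable

lemma measurable_stepOp {Ω : Set E3} (hΩ : MeasurableSet Ω) {ν : E3 → ℝ} (hν : Measurable ν)
    {k : E3 → E3 → ℝ} (hk : Measurable (Function.uncurry k)) {g : E3 × E3 → ℝ}
    (hg : Measurable g) : Measurable (stepOp Ω ν k g) :=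
  measurable_cut hΩ (measurable_transOp hν (measurable_cut hΩ (measurable_kerOp hk hg)))

/-! ### Velocity weights and the operator `K` -/

/-- The velocity weight `1 + |v|`. -/
def vw (v : E3) : ℝ≥0∞ := ENNReal.ofReal (1 + ‖v‖)

lemma measurable_vw : Measurable vw := by unfold vw; fun_prop

lemma one_le_vw (v : E3) : 1 ≤ vw v := by
  rw [vw, ENNReal.one_le_ofReal]; linarith [norm_nonneg v]

lemma vw_ne_zero (v : E3) : vw v ≠ 0 := (zero_lt_one.trans_le (one_le_vw v)).ne'

lemma vw_ne_top (v : E3) : vw v ≠ ∞ := ENNReal.ofReal_ne_top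

/-- A Peetre-type inequality: it moves the velocity weight through a kernel depending on v - w, at
the cost of a weight on the kernel that the Gaussian absorbs. -/
lemma vw_le_mul (v w : E3) : vw v ≤ vw (v - w) * vw w := by
  rw [vw, vw, vw, ← ENNReal.ofReal_mul (by positivity)]
  refine ENNReal.ofReal_le_ofReal ?_
  have : ‖v‖ ≤ ‖v - w‖ + ‖w‖ := by simpa using norm_add_le (v - w) w
  nlinarith [norm_nonneg (v - w), norm_nonneg w]

/-- The dominating kernel with values in `[0, ∞]`. -/
def gradBoundE (z : E3) : ℝ≥0∞ := ENNReal.ofReal (gradBound z)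

lemma measurable_gradBoundE : Measurable gradBoundE := measurable_gradBound.ennreal_ofReal

lemma lintegral_vw_gradBoundE_lt_top (n : ℕ) : ∫⁻ z, vw z ^ n * gradBoundE z < ∞ := by
  refine lt_of_eq_of_lt (lintegral_congr fun z => ?_) (lintegral_gradBound_lt_top n)
  rw [vw, gradBoundE, ← ENNReal.ofReal_pow (by positivity), ← ENNReal.ofReal_mul (by positivity)]

lemma lintegral_vw_gradBoundE_sq_lt_top (n : ℕ) :
    ∫⁻ z, (vw z ^ n * gradBoundE z) ^ 2 < ∞ := by
  refine lt_of_eq_of_lt (lintegral_congr fun z => ?_) (lintegral_gradBound_sq_lt_top (2 * n))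
  rw [vw, gradBoundE, ← ENNReal.ofReal_pow (by positivity), ← ENNReal.ofReal_mul (by positivity),
    ← ENNReal.ofReal_pow (mul_nonneg (by positivity) (gradBound_nonneg z)), mul_pow, ← pow_mul,
    mul_comm n 2]

lemma enorm_kerOp_le {k : E3 → E3 → ℝ} {A : ℝ} (hk : IsGradKernel k A) (g : E3 × E3 → ℝ)
    (x v : E3) :
    ‖kerOp k g (x, v)‖ₑ ≤ ENNReal.ofReal A * ∫⁻ w, gradBoundE (v - w) * ‖g (x, w)‖ₑ := by
  rw [← lintegral_const_mul' _ _ ENNReal.ofReal_ne_top]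
  refine (enorm_integral_le_lintegral_enorm _).trans (lintegral_mono fun w => ?_)
  rw [enorm_mul, ← mul_assoc]
  gcongr
  rw [gradBoundE, ← ENNReal.ofReal_mul hk.nonneg, Real.enorm_eq_ofReal_abs]
  exact ENNReal.ofReal_le_ofReal (hk.bound v w)

lemma vw_pow_mul_lintegral_le (n : ℕ) (f : E3 → ℝ≥0∞) (v : E3) :
    vw v ^ n * ∫⁻ w, gradBoundE (v - w) * f w ≤
      ∫⁻ w, (vw (v - w) ^ n * gradBoundE (v - w)) * (vw w ^ n * f w) := by
  rw [← lintegral_const_mul' _ _ (ENNReal.pow_ne_top (vw_ne_top v))]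
  refine lintegral_mono fun w => ?_
  calc vw v ^ n * (gradBoundE (v - w) * f w)
      ≤ (vw (v - w) * vw w) ^ n * (gradBoundE (v - w) * f w) := by
        gcongr; exact vw_le_mul v w
    _ = _ := by rw [mul_pow]; ring

/-- Pointwise bound of `K g` by a weighted `L²` norm in velocity. -/
lemma kerOp_pointwise (n : ℕ) {k : E3 → E3 → ℝ} {A : ℝ} (hk : IsGradKernel k A) :
    ∃ C : ℝ≥0, ∀ g : E3 × E3 → ℝ, Measurable g → ∀ x v,
      vw v ^ (2 * n) * ‖kerOp k g (x, v)‖ₑ ^ 2 ≤ C * ∫⁻ w, vw w ^ (2 * n) * ‖g (x, w)‖ₑ ^ 2 := by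
  have hc := ENNReal.mul_lt_top (ENNReal.ofReal_lt_top (r := A ^ 2))
    (lintegral_vw_gradBoundE_sq_lt_top n)
  refine ⟨(ENNReal.ofReal (A ^ 2) * ∫⁻ z, (vw z ^ n * gradBoundE z) ^ 2).toNNReal,
    fun g hg x v => ?_⟩
  rw [ENNReal.coe_toNNReal hc.ne]
  have hv := measurable_vw
  have hb := measurable_gradBoundE
  calc vw v ^ (2 * n) * ‖kerOp k g (x, v)‖ₑ ^ 2
      = (vw v ^ n * ‖kerOp k g (x, v)‖ₑ) ^ 2 := by rw [mul_pow, ← pow_mul, mul_comm n 2]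
    _ ≤ (ENNReal.ofReal A * ∫⁻ w, (vw (v - w) ^ n * gradBoundE (v - w)) *
          (vw w ^ n * ‖g (x, w)‖ₑ)) ^ 2 := by
        refine pow_le_pow_left' ?_ 2
        calc _ ≤ vw v ^ n * (ENNReal.ofReal A * ∫⁻ w, gradBoundE (v - w) * ‖g (x, w)‖ₑ) :=
              mul_le_mul_right (enorm_kerOp_le hk g x v) _
          _ = ENNReal.ofReal A * (vw v ^ n * ∫⁻ w, gradBoundE (v - w) * ‖g (x, w)‖ₑ) := by ring
          _ ≤ _ := mul_le_mul_right (vw_pow_mul_lintegral_le n _ v) _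
    _ ≤ ENNReal.ofReal (A ^ 2) * ((∫⁻ w, (vw (v - w) ^ n * gradBoundE (v - w)) ^ 2) *
          ∫⁻ w, (vw w ^ n * ‖g (x, w)‖ₑ) ^ 2) := by
        rw [mul_pow, ENNReal.ofReal_pow hk.nonneg]
        exact mul_le_mul_right (lintegral_mul_sq_le (by fun_prop) (by fun_prop)) _
    _ = _ := by
        rw [lintegral_sub_left_eq_self (fun z => (vw z ^ n * gradBoundE z) ^ 2) v, mul_assoc]
        simp only [mul_pow, ← pow_mul, mul_comm n 2]

/-- `K` is bounded on weighted `L²` spaces in velocity. -/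
lemma kerOp_weighted_L2 (n : ℕ) {k : E3 → E3 → ℝ} {A : ℝ} (hk : IsGradKernel k A) :
    ∃ C : ℝ≥0, ∀ g : E3 × E3 → ℝ, Measurable g → ∀ x,
      ∫⁻ v, vw v ^ (2 * n) * ‖kerOp k g (x, v)‖ₑ ^ 2 ≤
        C * ∫⁻ w, vw w ^ (2 * n) * ‖g (x, w)‖ₑ ^ 2 := by
  have hL := lintegral_vw_gradBoundE_lt_top n
  set L := ∫⁻ z, vw z ^ n * gradBoundE z
  have hc : ENNReal.ofReal (A ^ 2) * (L * L) < ∞ :=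
    ENNReal.mul_lt_top ENNReal.ofReal_lt_top (ENNReal.mul_lt_top hL hL)
  refine ⟨(ENNReal.ofReal (A ^ 2) * (L * L)).toNNReal, fun g hg x => ?_⟩
  rw [ENNReal.coe_toNNReal hc.ne]
  have hv := measurable_vw
  have hb := measurable_gradBoundE
  -- Schur's test: Cauchy–Schwarz against the weighted kernel as a measure in w, followed by Tonelli
  -- in v.
  have key : ∀ v, vw v ^ (2 * n) * ‖kerOp k g (x, v)‖ₑ ^ 2 ≤ ENNReal.ofReal (A ^ 2) * L *
      ∫⁻ w, (vw (v - w) ^ n * gradBoundE (v - w)) * (vw w ^ (2 * n) * ‖g (x, w)‖ₑ ^ 2) := by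
    intro v
    calc vw v ^ (2 * n) * ‖kerOp k g (x, v)‖ₑ ^ 2
      = (vw v ^ n * ‖kerOp k g (x, v)‖ₑ) ^ 2 := by rw [mul_pow, ← pow_mul, mul_comm n 2]
    _ ≤ (ENNReal.ofReal A * ∫⁻ w, (vw (v - w) ^ n * gradBoundE (v - w)) *
          (vw w ^ n * ‖g (x, w)‖ₑ)) ^ 2 := by
        refine pow_le_pow_left' ?_ 2
        calc _ ≤ vw v ^ n * (ENNReal.ofReal A * ∫⁻ w, gradBoundE (v - w) * ‖g (x, w)‖ₑ) :=
              mul_le_mul_right (enorm_kerOp_le hk g x v) _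
          _ = ENNReal.ofReal A * (vw v ^ n * ∫⁻ w, gradBoundE (v - w) * ‖g (x, w)‖ₑ) := by ring
          _ ≤ _ := mul_le_mul_right (vw_pow_mul_lintegral_le n _ v) _
    _ ≤ ENNReal.ofReal (A ^ 2) * ((∫⁻ w, vw (v - w) ^ n * gradBoundE (v - w)) *
          ∫⁻ w, (vw (v - w) ^ n * gradBoundE (v - w)) * (vw w ^ n * ‖g (x, w)‖ₑ) ^ 2) := by
        rw [mul_pow, ENNReal.ofReal_pow hk.nonneg]
        exact mul_le_mul_right (lintegral_mul_sq_le_weighted (by fun_prop) (by fun_prop)) _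
    _ = _ := by
        rw [lintegral_sub_left_eq_self (fun z => vw z ^ n * gradBoundE z) v, mul_assoc]
        simp only [mul_pow, ← pow_mul, mul_comm n 2]
        rfl
  calc _ ≤ ∫⁻ v, ENNReal.ofReal (A ^ 2) * L * ∫⁻ w, (vw (v - w) ^ n * gradBoundE (v - w)) *
        (vw w ^ (2 * n) * ‖g (x, w)‖ₑ ^ 2) := lintegral_mono key
    _ = ENNReal.ofReal (A ^ 2) * L * ∫⁻ w, ∫⁻ v, (vw (v - w) ^ n * gradBoundE (v - w)) *
        (vw w ^ (2 * n) * ‖g (x, w)‖ₑ ^ 2) := by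
        rw [lintegral_const_mul' _ _ (ENNReal.mul_lt_top ENNReal.ofReal_lt_top hL).ne,
          lintegral_lintegral_swap]
        exact Measurable.aemeasurable (by fun_prop)
    _ = ENNReal.ofReal (A ^ 2) * L * ∫⁻ w, L * (vw w ^ (2 * n) * ‖g (x, w)‖ₑ ^ 2) := by
        congr 1
        refine lintegral_congr fun w => ?_
        rw [lintegral_mul_const _ (by fun_prop),
          lintegral_sub_right_eq_self (fun z => vw z ^ n * gradBoundE z) w]
    _ = _ := by rw [lintegral_const_mul' _ _ hL.ne]; ring

/-! ### The transport operator -/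

lemma lintegral_exp_neg {a : ℝ} (ha : 0 < a) :
    ∫⁻ s in Ioi (0 : ℝ), ENNReal.ofReal (Real.exp (-(a * s))) = ENNReal.ofReal (1 / a) := by
  have h1 : IntegrableOn (fun s : ℝ => Real.exp (-a * s)) (Ioi 0) :=
    integrableOn_exp_mul_Ioi (by linarith) 0
  have h2 := integral_exp_mul_Ioi (a := -a) (by linarith) 0
  simp only [neg_mul] at h1 h2
  rw [← ofReal_integral_eq_lintegral_ofReal h1 (ae_of_all _ fun s => (Real.exp_pos _).le), h2]
  simp [neg_div]

/-- The time spent in a bounded set, damped, is at most of order `1 / (1 + |v|)`. -/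
lemma vw_mul_chord_time_le {Ω : Set E3} {D ν₀ : ℝ} (hν₀ : 0 < ν₀)
    (hD : ∀ x ∈ Ω, ∀ y ∈ Ω, ‖x - y‖ ≤ D) {z : E3} (hz : z ∈ Ω) (v : E3) :
    vw v * ∫⁻ s in Ioi (0 : ℝ), ENNReal.ofReal (Real.exp (-(ν₀ * s))) *
      Ω.indicator 1 (z + s • v) ≤ ENNReal.ofReal (2 / ν₀ + 2 * D) := by
  have hD0 : 0 ≤ D := by simpa using hD z hz z hz
  -- Slow particles are controlled by the damping, which gives 2/ν₀. Fast ones leave Ω after a time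
  -- at most D/|v|, which gives 2D.
  rcases le_or_gt ‖v‖ 1 with hv | hv
  · calc _ ≤ ENNReal.ofReal 2 * ∫⁻ s in Ioi (0 : ℝ), ENNReal.ofReal (Real.exp (-(ν₀ * s))) := by
          refine mul_le_mul' (ENNReal.ofReal_le_ofReal (by linarith)) (lintegral_mono fun s => ?_)
          exact mul_le_of_le_one_right (zero_le) (indicator_le_self' (fun _ _ => zero_le) _)
      _ = ENNReal.ofReal (2 / ν₀) := by
          rw [lintegral_exp_neg hν₀, ← ENNReal.ofReal_mul (by norm_num)]; ring_nf
      _ ≤ _ := ENNReal.ofReal_le_ofReal (by linarith)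
  · have hv0 : 0 < ‖v‖ := by linarith
    calc _ ≤ ENNReal.ofReal (2 * ‖v‖) * ∫⁻ _s in Ioc (0 : ℝ) (D / ‖v‖), 1 := by
          refine mul_le_mul' (ENNReal.ofReal_le_ofReal (by linarith)) ?_
          rw [← lintegral_indicator measurableSet_Ioi, ← lintegral_indicator measurableSet_Ioc]
          refine lintegral_mono fun s => ?_
          by_cases hs : s ∈ Ioi (0 : ℝ)
          · rw [indicator_of_mem hs]
            by_cases hzs : z + s • v ∈ Ω
            · have : s ∈ Ioc (0 : ℝ) (D / ‖v‖) := by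
                refine ⟨hs, ?_⟩
                have h1 := hD _ hzs _ hz
                rw [add_sub_cancel_left, norm_smul, Real.norm_of_nonneg (le_of_lt hs)] at h1
                rwa [le_div_iff₀ hv0]
              rw [indicator_of_mem this, indicator_of_mem hzs]
              simp only [Pi.one_apply, mul_one, ENNReal.ofReal_le_one]
              exact Real.exp_le_one_iff.2 (by nlinarith [mem_Ioi.1 hs])
            · rw [indicator_of_notMem hzs, mul_zero]; exact zero_le
          · rw [indicator_of_notMem hs]; exact zero_le
      _ = ENNReal.ofReal (2 * D) := by
          rw [setLIntegral_const, one_mul, Real.volume_Ioc, sub_zero,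
            ← ENNReal.ofReal_mul (by positivity)]
          congr 1
          field_simp
      _ ≤ _ := ENNReal.ofReal_le_ofReal (by have : 0 < 2 / ν₀ := by positivity
                                            linarith)

lemma enorm_transOp_le {ν : E3 → ℝ} {ν₀ : ℝ} (hν : IsFrequency ν ν₀) (h : E3 × E3 → ℝ) (x v : E3) :
    ‖transOp ν h (x, v)‖ₑ ≤ ∫⁻ s in Ioi (0 : ℝ), ENNReal.ofReal (Real.exp (-(ν₀ * s))) *
      ‖h (x - s • v, v)‖ₑ := by
  refine (enorm_integral_le_lintegral_enorm _).trans
    (setLIntegral_mono' measurableSet_Ioi fun s hs => ?_)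
  rw [enorm_mul, Real.enorm_of_nonneg (Real.exp_pos _).le]
  gcongr
  · exact (mem_Ioi.1 hs).le
  · exact hν.bound v

/-- Pointwise bound of the transport operator on functions supported in `Ω`. -/
lemma transOp_pointwise {Ω : Set E3} (hΩ : MeasurableSet Ω) {D ν₀ : ℝ} {ν : E3 → ℝ}
    (hν : IsFrequency ν ν₀) (hD : ∀ x ∈ Ω, ∀ y ∈ Ω, ‖x - y‖ ≤ D) {h : E3 × E3 → ℝ}
    (hh : Measurable h) {x : E3} (hx : x ∈ Ω) (v : E3) :
    vw v * ‖transOp ν (cut Ω h) (x, v)‖ₑ ^ 2 ≤ ENNReal.ofReal (2 / ν₀ + 2 * D) *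
      ∫⁻ s in Ioi (0 : ℝ), ENNReal.ofReal (Real.exp (-(ν₀ * s))) *
        ‖cut Ω h (x - s • v, v)‖ₑ ^ 2 := by
  have hc := measurable_cut hΩ hh
  have hcs : Measurable fun s : ℝ => ‖cut Ω h (x - s • v, v)‖ₑ :=
    (hc.comp (f := fun s : ℝ => (x - s • v, v)) (by fun_prop)).enorm
  have hi : Measurable fun s : ℝ => Ω.indicator (1 : E3 → ℝ≥0∞) (x - s • v) :=
    (measurable_one.indicator hΩ).comp (by fun_prop : Measurable fun s : ℝ => x - s • v)
  -- The indicator of Ω enters before Cauchy–Schwarz, so that the mass of the measure is the damped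
  -- time spent in Ω; this pays for one factor 1 + |v|.
  have e : ∀ s : ℝ, ENNReal.ofReal (Real.exp (-(ν₀ * s))) * ‖cut Ω h (x - s • v, v)‖ₑ =
      (ENNReal.ofReal (Real.exp (-(ν₀ * s))) * Ω.indicator 1 (x - s • v)) *
        ‖cut Ω h (x - s • v, v)‖ₑ := by
    intro s
    by_cases hs : x - s • v ∈ Ω
    · simp [hs]
    · simp [hs, cut_of_notMem hs]
  calc _ ≤ vw v * (∫⁻ s in Ioi (0 : ℝ), (ENNReal.ofReal (Real.exp (-(ν₀ * s))) *
        Ω.indicator 1 (x - s • v)) * ‖cut Ω h (x - s • v, v)‖ₑ) ^ 2 := by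
        refine mul_le_mul_right (pow_le_pow_left' ((enorm_transOp_le hν _ x v).trans ?_) 2) _
        exact (lintegral_congr e).le
    _ ≤ vw v * ((∫⁻ s in Ioi (0 : ℝ), ENNReal.ofReal (Real.exp (-(ν₀ * s))) *
        Ω.indicator 1 (x - s • v)) * ∫⁻ s in Ioi (0 : ℝ), (ENNReal.ofReal (Real.exp (-(ν₀ * s))) *
        Ω.indicator 1 (x - s • v)) * ‖cut Ω h (x - s • v, v)‖ₑ ^ 2) :=
        mul_le_mul_right (lintegral_mul_sq_le_weighted (by fun_prop) (by fun_prop)) _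
    _ ≤ _ := by
        rw [← mul_assoc]
        refine mul_le_mul' ?_ (lintegral_mono fun s => ?_)
        · have := vw_mul_chord_time_le hν.pos hD hx (-v)
          simp only [smul_neg, ← sub_eq_add_neg, vw, norm_neg] at this
          exact this
        · refine mul_le_mul_left ?_ _
          exact mul_le_of_le_one_right (zero_le) (indicator_le_self' (fun _ _ => zero_le) _)

/-- The transport operator gains a factor `(1 + |v|)⁻¹` in `L²`. -/
lemma transOp_L2 {Ω : Set E3} (hΩ : MeasurableSet Ω) {D ν₀ : ℝ} {ν : E3 → ℝ}
    (hν : IsFrequency ν ν₀) (hD : ∀ x ∈ Ω, ∀ y ∈ Ω, ‖x - y‖ ≤ D) {h : E3 × E3 → ℝ}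
    (hh : Measurable h) (v : E3) :
    vw v ^ 2 * ∫⁻ x, ‖cut Ω (transOp ν (cut Ω h)) (x, v)‖ₑ ^ 2 ≤
      ENNReal.ofReal (2 / ν₀ + 2 * D) ^ 2 * ∫⁻ x, ‖cut Ω h (x, v)‖ₑ ^ 2 := by
  have hc := measurable_cut hΩ hh
  have hi : Measurable (Ω.indicator (1 : E3 → ℝ≥0∞)) := measurable_one.indicator hΩ
  set c := ENNReal.ofReal (2 / ν₀ + 2 * D)
  have hcf : Measurable fun x : E3 => ‖cut Ω h (x, v)‖ₑ ^ 2 :=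
    (hc.comp (f := fun x : E3 => (x, v)) (by fun_prop)).enorm.pow_const 2
  have h1 : ∀ x, vw v * ‖cut Ω (transOp ν (cut Ω h)) (x, v)‖ₑ ^ 2 ≤ c *
      ∫⁻ s in Ioi (0 : ℝ), Ω.indicator 1 x * (ENNReal.ofReal (Real.exp (-(ν₀ * s))) *
        ‖cut Ω h (x - s • v, v)‖ₑ ^ 2) := by
    intro x
    by_cases hx : x ∈ Ω
    · rw [cut_of_mem hx]
      simpa [hx] using transOp_pointwise hΩ hν hD hh hx v
    · simp [cut_of_notMem hx]
  -- Of the two factors 1 + |v|, one is spent in the pointwise Cauchy–Schwarz bound along the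
  -- backward ray, the other on the forward ray through z after Tonelli.
  calc vw v ^ 2 * ∫⁻ x, ‖cut Ω (transOp ν (cut Ω h)) (x, v)‖ₑ ^ 2
      = vw v * ∫⁻ x, vw v * ‖cut Ω (transOp ν (cut Ω h)) (x, v)‖ₑ ^ 2 := by
        rw [lintegral_const_mul' _ _ (vw_ne_top v), ← mul_assoc, sq]
    _ ≤ vw v * ∫⁻ x, c * ∫⁻ s in Ioi (0 : ℝ), Ω.indicator 1 x *
        (ENNReal.ofReal (Real.exp (-(ν₀ * s))) * ‖cut Ω h (x - s • v, v)‖ₑ ^ 2) :=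
        mul_le_mul_right (lintegral_mono h1) _
    _ = c * (vw v * ∫⁻ s in Ioi (0 : ℝ), ∫⁻ x, Ω.indicator 1 x *
        (ENNReal.ofReal (Real.exp (-(ν₀ * s))) * ‖cut Ω h (x - s • v, v)‖ₑ ^ 2)) := by
        rw [lintegral_const_mul' _ _ ENNReal.ofReal_ne_top, lintegral_lintegral_swap]
        · ring
        · refine Measurable.aemeasurable ?_
          refine (hi.comp measurable_fst).mul (Measurable.mul
            (f := fun q : E3 × ℝ => ENNReal.ofReal (Real.exp (-(ν₀ * q.2)))) (by fun_prop) ?_)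
          exact hcf.comp (by fun_prop : Measurable fun q : E3 × ℝ => q.1 - q.2 • v)
    _ = c * (vw v * ∫⁻ s in Ioi (0 : ℝ), ∫⁻ z, Ω.indicator 1 (z + s • v) *
        (ENNReal.ofReal (Real.exp (-(ν₀ * s))) * ‖cut Ω h (z, v)‖ₑ ^ 2)) := by
        congr 2
        refine lintegral_congr fun s => ?_
        rw [← lintegral_add_right_eq_self (fun x => Ω.indicator 1 x *
          (ENNReal.ofReal (Real.exp (-(ν₀ * s))) * ‖cut Ω h (x - s • v, v)‖ₑ ^ 2)) (s • v)]
        simp only [add_sub_cancel_right]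
    _ = c * ∫⁻ z, (vw v * ∫⁻ s in Ioi (0 : ℝ), ENNReal.ofReal (Real.exp (-(ν₀ * s))) *
        Ω.indicator 1 (z + s • v)) * ‖cut Ω h (z, v)‖ₑ ^ 2 := by
        have hj : Measurable fun q : ℝ × E3 => Ω.indicator (1 : E3 → ℝ≥0∞) (q.2 + q.1 • v) :=
          hi.comp (by fun_prop : Measurable fun q : ℝ × E3 => q.2 + q.1 • v)
        rw [lintegral_lintegral_swap, ← lintegral_const_mul' _ _ (vw_ne_top v)]
        · congr 1
          refine lintegral_congr fun z => ?_
          rw [mul_assoc, ← lintegral_mul_const]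
          · congr 1
            refine lintegral_congr fun s => ?_
            ring
          · exact Measurable.mul (by fun_prop)
              (hj.comp (by fun_prop : Measurable fun s : ℝ => (s, z)))
        · refine Measurable.aemeasurable ?_
          exact hj.mul (Measurable.mul (f := fun q : ℝ × E3 => ENNReal.ofReal (Real.exp (-(ν₀ * q.1))))
            (by fun_prop) (hcf.comp measurable_snd))
    _ ≤ c * ∫⁻ z, c * ‖cut Ω h (z, v)‖ₑ ^ 2 := by
        refine mul_le_mul_right (lintegral_mono fun z => ?_) _
        by_cases hz : z ∈ Ω
        · exact mul_le_mul_left (vw_mul_chord_time_le hν.pos hD hz v) _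
        · simp [cut_of_notMem hz]
    _ = _ := by
        rw [lintegral_const_mul' _ _ ENNReal.ofReal_ne_top, sq, mul_assoc]

/-- The squared weighted `L²` norm on phase space. -/
def wNorm (n : ℕ) (g : E3 × E3 → ℝ) : ℝ≥0∞ := ∫⁻ x, ∫⁻ v, vw v ^ (2 * n) * ‖g (x, v)‖ₑ ^ 2

lemma wNorm_swap (n : ℕ) {g : E3 × E3 → ℝ} (hg : Measurable g) :
    wNorm n g = ∫⁻ v, vw v ^ (2 * n) * ∫⁻ x, ‖g (x, v)‖ₑ ^ 2 := by
  have hv := measurable_vw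
  rw [wNorm, lintegral_lintegral_swap]
  · exact lintegral_congr fun v => lintegral_const_mul' _ _ (ENNReal.pow_ne_top (vw_ne_top v))
  · exact Measurable.aemeasurable (by fun_prop)

lemma wNorm_cut_le (n : ℕ) (Ω : Set E3) (g : E3 × E3 → ℝ) : wNorm n (cut Ω g) ≤ wNorm n g :=
  lintegral_mono fun _ => lintegral_mono fun _ => mul_le_mul_right
    (pow_le_pow_left' (enorm_cut_le _ _ _) 2) _

lemma wNorm_kerOp_le (n : ℕ) {k : E3 → E3 → ℝ} {A : ℝ} (hk : IsGradKernel k A) :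
    ∃ C : ℝ≥0, ∀ g : E3 × E3 → ℝ, Measurable g → wNorm n (kerOp k g) ≤ C * wNorm n g := by
  obtain ⟨C, hC⟩ := kerOp_weighted_L2 n hk
  refine ⟨C, fun g hg => ?_⟩
  rw [wNorm, wNorm, ← lintegral_const_mul' _ _ ENNReal.coe_ne_top]
  exact lintegral_mono fun x => hC g hg x

lemma wNorm_transOp_le (n : ℕ) {Ω : Set E3} (hΩ : MeasurableSet Ω) {D ν₀ : ℝ} {ν : E3 → ℝ}
    (hν : IsFrequency ν ν₀) (hD : ∀ x ∈ Ω, ∀ y ∈ Ω, ‖x - y‖ ≤ D) {h : E3 × E3 → ℝ}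
    (hh : Measurable h) :
    wNorm (n + 1) (cut Ω (transOp ν (cut Ω h))) ≤
      ENNReal.ofReal (2 / ν₀ + 2 * D) ^ 2 * wNorm n (cut Ω h) := by
  rw [wNorm_swap _ (measurable_cut hΩ (measurable_transOp hν.measurable (measurable_cut hΩ hh))),
    wNorm_swap _ (measurable_cut hΩ hh),
    ← lintegral_const_mul' _ _ (ENNReal.pow_ne_top ENNReal.ofReal_ne_top)]
  refine lintegral_mono fun v => ?_
  calc _ = vw v ^ (2 * n) * (vw v ^ 2 *
        ∫⁻ x, ‖cut Ω (transOp ν (cut Ω h)) (x, v)‖ₑ ^ 2) := by ring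
    _ ≤ vw v ^ (2 * n) * (ENNReal.ofReal (2 / ν₀ + 2 * D) ^ 2 * ∫⁻ x, ‖cut Ω h (x, v)‖ₑ ^ 2) :=
        mul_le_mul_right (transOp_L2 hΩ hν hD hh v) _
    _ = _ := by ring

/-- One step of the iteration gains one power of the velocity weight. -/
lemma wNorm_stepOp_le (n : ℕ) {Ω : Set E3} (hΩ : MeasurableSet Ω) {D ν₀ A : ℝ} {ν : E3 → ℝ}
    (hν : IsFrequency ν ν₀) (hD : ∀ x ∈ Ω, ∀ y ∈ Ω, ‖x - y‖ ≤ D) {k : E3 → E3 → ℝ}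
    (hk : IsGradKernel k A) :
    ∃ C : ℝ≥0, ∀ g : E3 × E3 → ℝ, Measurable g →
      wNorm (n + 1) (stepOp Ω ν k g) ≤ C * wNorm n g := by
  obtain ⟨C, hC⟩ := wNorm_kerOp_le n hk
  refine ⟨(ENNReal.ofReal (2 / ν₀ + 2 * D) ^ 2).toNNReal * C, fun g hg => ?_⟩
  refine (wNorm_transOp_le n hΩ hν hD (measurable_kerOp hk.measurable hg)).trans ?_
  rw [ENNReal.coe_mul, ENNReal.coe_toNNReal (ENNReal.pow_ne_top ENNReal.ofReal_ne_top), mul_assoc]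
  exact mul_le_mul_right ((wNorm_cut_le _ _ _).trans (hC g hg)) _

/-! ### Singular integrals near the boundary of a convex set -/

lemma lintegral_comp_smul {r : ℝ} (hr : 0 < r) {f : E3 → ℝ≥0∞} (hf : Measurable f) :
    ∫⁻ x, f (r • x) = ENNReal.ofReal (r ^ (-3 : ℝ)) * ∫⁻ x, f x := by
  have h := Measure.map_addHaar_smul (volume : Measure E3) hr.ne'
  rw [← lintegral_map (μ := (volume : Measure E3)) (g := fun x => r • x) hf (by fun_prop),
    h, lintegral_smul_measure, smul_eq_mul]
  congr 2
  rw [finrank_euclideanSpace_fin, abs_of_nonneg (by positivity), Real.rpow_neg hr.le]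
  norm_cast

/-- The power weight `|h|^{-p}`. -/
def powWeight (p : ℝ) (h : E3) : ℝ≥0∞ := ENNReal.ofReal (‖h‖ ^ (-p))

lemma measurable_powWeight (p : ℝ) : Measurable (powWeight p) := by unfold powWeight; fun_prop

lemma powWeight_sub_comm (p : ℝ) (x y : E3) : powWeight p (x - y) = powWeight p (y - x) := by
  rw [powWeight, norm_sub_rev, powWeight]

lemma lintegral_Ioi_add_rpow_le {r : ℝ} (hr : 0 < r) :
    ∫⁻ s in Ioi (0 : ℝ), ENNReal.ofReal ((s + r) ^ (-3 : ℝ)) ≤ ENNReal.ofReal (r ^ (-2 : ℝ)) := by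
  have h1 : ∫⁻ s in Ioi (0 : ℝ), ENNReal.ofReal ((s + r) ^ (-3 : ℝ)) =
      ∫⁻ s in Ioi r, ENNReal.ofReal (s ^ (-3 : ℝ)) := by
    rw [← lintegral_indicator measurableSet_Ioi, ← lintegral_indicator measurableSet_Ioi,
      ← lintegral_add_right_eq_self (fun s => (Ioi r).indicator
        (fun s : ℝ => ENNReal.ofReal (s ^ (-3 : ℝ))) s) r]
    refine lintegral_congr fun s => ?_
    simp [indicator]
  have h2 : IntegrableOn (fun s : ℝ => s ^ (-3 : ℝ)) (Ioi r) :=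
    integrableOn_Ioi_rpow_of_lt (by norm_num) hr
  rw [h1, ← ofReal_integral_eq_lintegral_ofReal h2
    ((ae_restrict_iff' measurableSet_Ioi).2 (ae_of_all _ fun s hs =>
      Real.rpow_nonneg (hr.le.trans (le_of_lt hs)) _)), integral_Ioi_rpow_of_lt (by norm_num) hr]
  refine ENNReal.ofReal_le_ofReal ?_
  have : 0 < r ^ (-2 : ℝ) := by positivity
  norm_num at this ⊢
  linarith

lemma vw_inv_pow_smul {s : ℝ} (hs : 0 < s) (y : E3) :
    ENNReal.ofReal (s ^ (-3 : ℝ)) * (vw (s⁻¹ • y))⁻¹ ^ 3 =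
      ENNReal.ofReal ((s + ‖y‖) ^ (-3 : ℝ)) := by
  rw [vw, ← ENNReal.ofReal_inv_of_pos (by positivity), ← ENNReal.ofReal_pow (by positivity),
    ← ENNReal.ofReal_mul (by positivity), norm_smul, Real.norm_of_nonneg (by positivity)]
  congr 1
  rw [Real.rpow_neg hs.le, Real.rpow_neg (by positivity)]
  norm_cast
  rw [inv_pow, ← mul_inv, ← mul_pow]
  congr 2
  field_simp

/-- Integration over rays through `x`, weighted in the direction. -/
lemma lintegral_ray_le {G : E3 → ℝ≥0∞} (hG : Measurable G) (x : E3) :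
    ∫⁻ v, (vw v)⁻¹ ^ 3 * ∫⁻ s in Ioi (0 : ℝ), G (x + s • v) ≤
      ∫⁻ y, powWeight 2 (x - y) * G y := by
  have hv := measurable_vw
  have hGm : Measurable fun q : E3 × ℝ => G (x + q.2 • q.1) :=
    hG.comp (by fun_prop : Measurable fun q : E3 × ℝ => x + q.2 • q.1)
  -- Substituting y = x + sv costs s⁻³, and the weight with exponent 3 turns this into (s +
  -- |y-x|)⁻³. There is no singularity at s = 0, and the integral in s is at most |y-x|⁻².
  have step : ∀ s ∈ Ioi (0 : ℝ), ∫⁻ v, (vw v)⁻¹ ^ 3 * G (x + s • v) =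
      ∫⁻ y, ENNReal.ofReal ((s + ‖y - x‖) ^ (-3 : ℝ)) * G y := by
    intro s hs
    have hs : 0 < s := hs
    have hF : Measurable fun z : E3 => (vw (s⁻¹ • z))⁻¹ ^ 3 * G (x + z) := by fun_prop
    have h1 := lintegral_comp_smul hs hF
    simp only [smul_smul, inv_mul_cancel₀ hs.ne', one_smul] at h1
    rw [h1, ← lintegral_const_mul' _ _ ENNReal.ofReal_ne_top]
    rw [← lintegral_sub_right_eq_self _ x]
    refine lintegral_congr fun y => ?_
    rw [← mul_assoc, vw_inv_pow_smul hs, add_sub_cancel]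
  calc _ = ∫⁻ v, ∫⁻ s in Ioi (0 : ℝ), (vw v)⁻¹ ^ 3 * G (x + s • v) := by
        refine lintegral_congr fun v => ?_
        rw [lintegral_const_mul' _ _ (by simp [vw_ne_zero])]
    _ = ∫⁻ s in Ioi (0 : ℝ), ∫⁻ v, (vw v)⁻¹ ^ 3 * G (x + s • v) := by
        rw [lintegral_lintegral_swap]
        exact Measurable.aemeasurable (by fun_prop)
    _ = ∫⁻ s in Ioi (0 : ℝ), ∫⁻ y, ENNReal.ofReal ((s + ‖y - x‖) ^ (-3 : ℝ)) * G y :=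
        setLIntegral_congr_fun measurableSet_Ioi step
    _ = ∫⁻ y, ∫⁻ s in Ioi (0 : ℝ), ENNReal.ofReal ((s + ‖y - x‖) ^ (-3 : ℝ)) * G y := by
        rw [lintegral_lintegral_swap]
        exact Measurable.aemeasurable (by fun_prop)
    _ ≤ _ := by
        refine lintegral_mono_ae ?_
        filter_upwards [(measurePreserving_sub_right (volume : Measure E3) x).quasiMeasurePreserving.ae ae_ne_zero] with y hy
        rw [lintegral_mul_const _ (by fun_prop), powWeight, norm_sub_rev x y]
        exact mul_le_mul_left (lintegral_Ioi_add_rpow_le (norm_pos_iff.2 hy)) _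

/-! ### Layers of a convex set that exit under a translation -/

/-- The points of `Ω` that leave `Ω` under translation by `h`. -/
def exitSet (Ω : Set E3) (h : E3) : Set E3 := {y | y ∈ Ω ∧ y + h ∉ Ω}

lemma measurableSet_exitSet {Ω : Set E3} (hΩ : MeasurableSet Ω) (h : E3) :
    MeasurableSet (exitSet Ω h) :=
  hΩ.inter (hΩ.compl.preimage (by fun_prop : Measurable fun y : E3 => y + h))

/-- A line in the direction of the translation meets a convex set in an interval, and the exiting
points form its final piece. If a < b were both in the slice with b - a > r, then a + r would lie
between them, hence in Ω. -/
lemma exitSet_slice_volume_le {Ω : Set E3} (hc : Convex ℝ Ω) {n : E3} {r : ℝ} (hr : 0 < r)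
    (z : E3) : volume {a : ℝ | z + a • n ∈ exitSet Ω (r • n)} ≤ ENNReal.ofReal r := by
  refine (Real.volume_le_diam _).trans (Metric.ediam_le fun a ha b hb => ?_)
  have key : ∀ a b : ℝ, z + a • n ∈ exitSet Ω (r • n) → z + b • n ∈ exitSet Ω (r • n) →
      b - a ≤ r := by
    intro a b ha hb
    by_contra! h
    refine ha.2 ?_
    have hba : 0 < b - a := hr.trans h
    have := hc ha.1 hb.1 (a := 1 - r / (b - a)) (b := r / (b - a))
      (by rw [sub_nonneg, div_le_one hba]; exact h.le) (by positivity) (by ring)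
    convert this using 1
    have e : r = r / (b - a) * (b - a) := by field_simp
    have e2 : a + r = (1 - r / (b - a)) * a + r / (b - a) * b := by
      nth_rewrite 1 [e]; ring
    calc z + a • n + r • n = z + (a + r) • n := by rw [add_smul, add_assoc]
      _ = _ := by rw [e2]; module
  rw [edist_dist, Real.dist_eq]
  exact ENNReal.ofReal_le_ofReal (abs_le.2 ⟨by linarith [key a b ha hb], key b a hb ha⟩)

lemma lintegral_abs_rpow_scaled {η : ℝ} (hη : η < 1) : ∃ C : ℝ≥0, ∀ r : ℝ, 0 < r →
    ∫⁻ a in Metric.ball (0 : ℝ) r, ENNReal.ofReal (|a| ^ (-η)) ≤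
      C * ENNReal.ofReal (r ^ (1 - η)) := by
  have hfin := lintegral_abs_rpow_lt_top hη 1
  refine ⟨(∫⁻ a in Metric.ball (0 : ℝ) 1, ENNReal.ofReal (|a| ^ (-η))).toNNReal, fun r hr => ?_⟩
  rw [ENNReal.coe_toNNReal hfin.ne, ← lintegral_indicator measurableSet_ball,
    ← lintegral_indicator measurableSet_ball]
  set F := (Metric.ball (0 : ℝ) r).indicator fun a => ENNReal.ofReal (|a| ^ (-η))
  have hF : Measurable F := Measurable.indicator (by fun_prop) measurableSet_ball
  have h := Measure.map_addHaar_smul (volume : Measure ℝ) hr.ne'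
  have h1 : ∫⁻ a, F (r • a) = ENNReal.ofReal r⁻¹ * ∫⁻ a, F a := by
    rw [← lintegral_map (μ := (volume : Measure ℝ)) (g := fun x => r • x) hF (by fun_prop),
      h, lintegral_smul_measure, smul_eq_mul]
    simp [abs_of_pos hr]
  have h2 : ∫⁻ a, F (r • a) = ENNReal.ofReal (r ^ (-η)) *
      ∫⁻ a, (Metric.ball (0 : ℝ) 1).indicator (fun a => ENNReal.ofReal (|a| ^ (-η))) a := by
    rw [← lintegral_const_mul' _ _ ENNReal.ofReal_ne_top]
    refine lintegral_congr fun a => ?_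
    have : r • a ∈ Metric.ball (0 : ℝ) r ↔ a ∈ Metric.ball (0 : ℝ) 1 := by
      simp only [Metric.mem_ball, dist_zero_right, norm_smul, Real.norm_of_nonneg hr.le]
      exact mul_lt_iff_lt_one_right hr
    by_cases ha : a ∈ Metric.ball (0 : ℝ) 1
    · rw [indicator_of_mem ha, ← ENNReal.ofReal_mul (by positivity)]
      simp only [F]
      rw [indicator_of_mem (this.2 ha), smul_eq_mul, abs_mul, abs_of_pos hr,
        Real.mul_rpow hr.le (abs_nonneg a)]
    · rw [indicator_of_notMem ha, mul_zero]
      exact indicator_of_notMem (mt this.1 ha) _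
  have h3 : ∫⁻ a, F a = ENNReal.ofReal r * ∫⁻ a, F (r • a) := by
    rw [h1, ← mul_assoc, ← ENNReal.ofReal_mul hr.le, mul_inv_cancel₀ hr.ne', ENNReal.ofReal_one,
      one_mul]
  rw [h3, h2, ← mul_assoc, ← ENNReal.ofReal_mul hr.le, mul_comm]
  refine (congrArg _ (congrArg _ ?_)).le
  rw [sub_eq_add_neg, Real.rpow_add hr, Real.rpow_one]

/-- Integrating a power weight over a subset of the line of small measure. -/
lemma setLIntegral_abs_rpow_le {η : ℝ} (hη0 : 0 ≤ η) (hη : η < 1) : ∃ C : ℝ≥0, ∀ r : ℝ, 0 < r →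
    ∀ A : Set ℝ, MeasurableSet A → volume A ≤ ENNReal.ofReal r →
    ∫⁻ a in A, ENNReal.ofReal (|a| ^ (-η)) ≤ C * ENNReal.ofReal (r ^ (1 - η)) := by
  obtain ⟨C, hC⟩ := lintegral_abs_rpow_scaled hη
  refine ⟨C + 1, fun r hr A hA hAr => ?_⟩
  -- Inside the ball of radius r the scaled bound applies. Outside it the weight is at most r^(-η)
  -- and A has measure at most r. Both parts are of order r^(1-η).
  calc ∫⁻ a in A, ENNReal.ofReal (|a| ^ (-η))
      ≤ ∫⁻ a in A, ((Metric.ball 0 r).indicator (fun a => ENNReal.ofReal (|a| ^ (-η))) a +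
          ENNReal.ofReal (r ^ (-η))) := by
        refine lintegral_mono fun a => ?_
        by_cases ha : a ∈ Metric.ball (0 : ℝ) r
        · rw [indicator_of_mem ha]; exact le_self_add
        · rw [indicator_of_notMem ha, zero_add]
          refine ENNReal.ofReal_le_ofReal (Real.rpow_le_rpow_of_nonpos hr ?_ (by linarith))
          simpa using ha
    _ = (∫⁻ a in A, (Metric.ball 0 r).indicator (fun a => ENNReal.ofReal (|a| ^ (-η))) a) +
          ENNReal.ofReal (r ^ (-η)) * volume A := by
        rw [lintegral_add_right _ measurable_const, setLIntegral_const]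
    _ ≤ C * ENNReal.ofReal (r ^ (1 - η)) + ENNReal.ofReal (r ^ (-η)) * ENNReal.ofReal r := by
        gcongr
        refine (setLIntegral_le_lintegral _ _).trans ?_
        rw [lintegral_indicator measurableSet_ball]
        exact hC r hr
    _ = _ := by
        rw [ENNReal.coe_add, add_mul, ENNReal.coe_one, one_mul, ← ENNReal.ofReal_mul (by positivity)]
        congr 3
        rw [sub_eq_neg_add, Real.rpow_add hr, Real.rpow_one]

/-- The exponent is distributed as 2 = η + 2(1 - η/2), all three below 1 and hence integrable. The
direction n gets only η, so that a slice of length r still yields r^(1-η). -/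
lemma powWeight_two_le_frame {n : E3} (hn : ‖n‖ = 1) {η a b c : ℝ} (hη0 : 0 < η) (hη : η < 1)
    (ha : a ≠ 0) (hb : b ≠ 0) (hc : c ≠ 0) :
    powWeight 2 (a • n + b • frameTwo n + c • frameThree n) ≤
      ENNReal.ofReal (|a| ^ (-η)) * (ENNReal.ofReal (|b| ^ (-(1 - η / 2))) *
        ENNReal.ofReal (|c| ^ (-(1 - η / 2)))) := by
  have hs := norm_sq_frame hn a b c
  set u := a • n + b • frameTwo n + c • frameThree n
  have ha' := abs_pos.2 ha
  have hb' := abs_pos.2 hb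
  have hc' := abs_pos.2 hc
  have h1 : |a| ≤ ‖u‖ := abs_le_of_sq_le_sq' (by nlinarith [sq_nonneg b, sq_nonneg c]) (norm_nonneg _) |> abs_le.2
  have h2 : |b| ≤ ‖u‖ := abs_le_of_sq_le_sq' (by nlinarith [sq_nonneg a, sq_nonneg c]) (norm_nonneg _) |> abs_le.2
  have h3 : |c| ≤ ‖u‖ := abs_le_of_sq_le_sq' (by nlinarith [sq_nonneg b, sq_nonneg a]) (norm_nonneg _) |> abs_le.2
  have hu : 0 < ‖u‖ := ha'.trans_le h1
  rw [powWeight, ← ENNReal.ofReal_mul (by positivity), ← ENNReal.ofReal_mul (by positivity)]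
  refine ENNReal.ofReal_le_ofReal ?_
  calc ‖u‖ ^ (-2 : ℝ) = ‖u‖ ^ (-η) * (‖u‖ ^ (-(1 - η / 2)) * ‖u‖ ^ (-(1 - η / 2))) := by
        rw [← Real.rpow_add hu, ← Real.rpow_add hu]; congr 1; ring
    _ ≤ _ := by
        gcongr ?_ * (?_ * ?_)
        · exact Real.rpow_le_rpow_of_nonpos ha' h1 (by linarith)
        · exact Real.rpow_le_rpow_of_nonpos hb' h2 (by linarith)
        · exact Real.rpow_le_rpow_of_nonpos hc' h3 (by linarith)

lemma lintegral_three_swap {F : ℝ → ℝ → ℝ → ℝ≥0∞}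
    (hF : Measurable fun q : ℝ × ℝ × ℝ => F q.1 q.2.1 q.2.2) :
    ∫⁻ a, ∫⁻ b, ∫⁻ c, F a b c = ∫⁻ b, ∫⁻ c, ∫⁻ a, F a b c := by
  rw [lintegral_lintegral_swap]
  · refine lintegral_congr fun b => ?_
    rw [lintegral_lintegral_swap]
    exact (hF.comp (f := fun q : ℝ × ℝ => (q.1, b, q.2)) (by fun_prop)).aemeasurable
  · have : Measurable fun q : (ℝ × ℝ) × ℝ => F q.1.1 q.1.2 q.2 :=
      hF.comp (f := fun q : (ℝ × ℝ) × ℝ => (q.1.1, q.1.2, q.2)) (by fun_prop)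
    exact this.lintegral_prod_right'.aemeasurable

/-- The singular integral of `|y - z|⁻²` over the set of points leaving a bounded convex set under
a translation is small with the translation. -/
lemma exitSet_singular_integral_le {Ω : Set E3} (hΩ : MeasurableSet Ω) (hc : Convex ℝ Ω) {D : ℝ}
    (hD : ∀ x ∈ Ω, ∀ y ∈ Ω, ‖x - y‖ ≤ D) {η : ℝ} (hη0 : 0 < η) (hη : η < 1) :
    ∃ C : ℝ≥0, ∀ z ∈ Ω, ∀ h : E3, h ≠ 0 →
      ∫⁻ y in exitSet Ω h, powWeight 2 (y - z) ≤ C * ENNReal.ofReal (‖h‖ ^ (1 - η)) := by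
  obtain ⟨C, hC⟩ := setLIntegral_abs_rpow_le hη0.le hη
  set J := ∫⁻ b in Metric.ball (0 : ℝ) (D + 1), ENNReal.ofReal (|b| ^ (-(1 - η / 2)))
  have hJ : J < ∞ := lintegral_abs_rpow_lt_top (by linarith) _
  refine ⟨(J * J).toNNReal * C, fun z hz h hh => ?_⟩
  have hr : 0 < ‖h‖ := norm_pos_iff.2 hh
  have hn := norm_normalize hh
  set n := ‖h‖⁻¹ • h
  set r := ‖h‖
  have hhn : h = r • n := by simp only [n, r]; rw [smul_smul, mul_inv_cancel₀ hr.ne', one_smul]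
  rw [hhn]
  have hN := measurableSet_exitSet hΩ (r • n)
  set N := exitSet Ω (r • n)
  have hpw := measurable_powWeight 2
  have hind : Measurable (N.indicator (1 : E3 → ℝ≥0∞)) := measurable_one.indicator hN
  set P : ℝ → ℝ → ℝ → E3 := fun a b c => a • n + b • frameTwo n + c • frameThree n
  have hPm : Measurable fun q : ℝ × ℝ × ℝ => P q.1 q.2.1 q.2.2 := by
    simp only [P]; fun_prop
  set φ : ℝ → ℝ≥0∞ := (Metric.ball (0 : ℝ) (D + 1)).indicator
    fun b => ENNReal.ofReal (|b| ^ (-(1 - η / 2)))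
  have hφ : ∀ b : ℝ, |b| ≤ D → φ b = ENNReal.ofReal (|b| ^ (-(1 - η / 2))) := fun b hb =>
    indicator_of_mem (by simp; linarith) _
  have hφm : Measurable φ := Measurable.indicator (by fun_prop) measurableSet_ball
  have hφJ : ∫⁻ b, φ b = J := lintegral_indicator measurableSet_ball _
  -- For fixed transverse coordinates the slice along h has length at most r. The transverse
  -- coordinates are at most D because y and z both lie in Ω, so the truncation at D + 1 in φ loses
  -- nothing.
  have slice : ∀ b c : ℝ, b ≠ 0 → c ≠ 0 →
      ∫⁻ a, N.indicator 1 (z + P a b c) * powWeight 2 (P a b c) ≤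
        φ b * (φ c * (C * ENNReal.ofReal (r ^ (1 - η)))) := by
    intro b c hb0 hc0
    set A := {a : ℝ | z + b • frameTwo n + c • frameThree n + a • n ∈ N}
    have hA : MeasurableSet A := hN.preimage (by fun_prop :
      Measurable fun a : ℝ => z + b • frameTwo n + c • frameThree n + a • n)
    have hAv : volume A ≤ ENNReal.ofReal r := exitSet_slice_volume_le hc hr _
    calc _ ≤ ∫⁻ a, A.indicator (fun a => φ b * (φ c * ENNReal.ofReal (|a| ^ (-η)))) a := by
          refine lintegral_mono_ae (ae_real_ne_zero.mono fun a ha => ?_)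
          have e : z + P a b c = z + b • frameTwo n + c • frameThree n + a • n := by
            simp only [P]; module
          by_cases haA : a ∈ A
          · have haN : z + P a b c ∈ N := by rw [e]; exact haA
            rw [indicator_of_mem haA, indicator_of_mem haN, Pi.one_apply, one_mul]
            have hP := hD _ haN.1 _ hz
            rw [add_sub_cancel_left] at hP
            have hs := norm_sq_frame hn a b c
            have hsb : |b| ≤ D := (abs_le.2 (abs_le_of_sq_le_sq' (by
              nlinarith [sq_nonneg a, sq_nonneg c]) (norm_nonneg _))).trans hP
            have hsc : |c| ≤ D := (abs_le.2 (abs_le_of_sq_le_sq' (by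
              nlinarith [sq_nonneg a, sq_nonneg b]) (norm_nonneg _))).trans hP
            rw [hφ b hsb, hφ c hsc]
            refine (powWeight_two_le_frame hn hη0 hη ha hb0 hc0).trans (le_of_eq (by ring))
          · have haN : z + P a b c ∉ N := by rw [e]; exact haA
            rw [indicator_of_notMem haN, zero_mul]; exact zero_le
      _ = φ b * (φ c * ∫⁻ a in A, ENNReal.ofReal (|a| ^ (-η))) := by
          rw [lintegral_indicator hA, lintegral_const_mul _ (by fun_prop),
            lintegral_const_mul _ (by fun_prop)]
      _ ≤ _ := by gcongr; exact hC r hr A hA hAv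
  have e0 : ∫⁻ y in N, powWeight 2 (y - z) = ∫⁻ u, N.indicator 1 (z + u) * powWeight 2 u := by
    rw [← lintegral_indicator hN, ← lintegral_add_left_eq_self _ z]
    refine lintegral_congr fun u => ?_
    by_cases hu : z + u ∈ N <;> simp [hu]
  have hG : Measurable fun u : E3 => N.indicator 1 (z + u) * powWeight 2 u := by fun_prop
  rw [e0, lintegral_frame hn hG, lintegral_three_swap (hG.comp hPm)]
  calc _ ≤ ∫⁻ b, ∫⁻ c, φ b * (φ c * (C * ENNReal.ofReal (r ^ (1 - η)))) :=
        lintegral_mono_ae (ae_real_ne_zero.mono fun b hb =>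
          lintegral_mono_ae (ae_real_ne_zero.mono fun c hc => slice b c hb hc))
    _ = J * (J * (C * ENNReal.ofReal (r ^ (1 - η)))) := by
        simp_rw [fun b => lintegral_const_mul (μ := (volume : Measure ℝ)) (φ b)
          (hφm.mul_const (C * ENNReal.ofReal (r ^ (1 - η)))), lintegral_mul_const _ hφm, hφJ]
    _ = _ := by
        rw [ENNReal.coe_mul, ENNReal.coe_toNNReal (ENNReal.mul_lt_top hJ hJ).ne]
        ring

lemma lintegral_powWeight_ball_lt_top {q : ℝ} (hq : q < 3) :
    ∫⁻ h in Metric.ball (0 : E3) 1, powWeight q h < ∞ := by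
  have h : IntegrableOn (fun h : E3 => ‖h‖ ^ (-q)) (Metric.ball 0 1) := by
    rw [integrableOn_fun_norm_addHaar volume (f := fun r : ℝ => r ^ (-q))]
    have h1 : IntegrableOn (fun r : ℝ => r ^ (2 - q)) (Ioo 0 1) :=
      (intervalIntegral.intervalIntegrable_rpow' (a := 0) (b := 1) (r := 2 - q)
        (by linarith)).1.mono_set Ioo_subset_Ioc_self
    refine h1.congr_fun (fun r hr => ?_) measurableSet_Ioo
    simp only [finrank_euclideanSpace_fin, smul_eq_mul]
    rw [sub_eq_add_neg, Real.rpow_add hr.1]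
    norm_num
  exact h.lintegral_lt_top

lemma lintegral_powWeight_compl_ball_lt_top {p : ℝ} (hp : 3 < p) :
    ∫⁻ h in (Metric.ball (0 : E3) 1)ᶜ, powWeight p h < ∞ := by
  have h : Integrable fun h : E3 => 2 ^ p * (1 + ‖h‖) ^ (-p) :=
    (integrable_one_add_norm (by rw [finrank_euclideanSpace_fin]; exact_mod_cast hp)).const_mul _
  refine lt_of_le_of_lt ((setLIntegral_mono' measurableSet_ball.compl fun h hh => ?_).trans
    (setLIntegral_le_lintegral _ _)) h.lintegral_lt_top
  have h1 : 1 ≤ ‖h‖ := by simpa using hh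
  refine ENNReal.ofReal_le_ofReal ?_
  rw [Real.rpow_neg (by positivity), Real.rpow_neg (by positivity), ← div_eq_mul_inv,
    ← Real.div_rpow (by norm_num) (by positivity), ← Real.inv_rpow (by positivity)]
  refine Real.rpow_le_rpow (by positivity) ?_ (by linarith)
  rw [inv_le_iff_one_le_mul₀ (by linarith), div_mul_eq_mul_div, le_div_iff₀ (by linarith)]
  linarith

lemma powWeight_mul {h : E3} (hh : h ≠ 0) (p q : ℝ) :
    powWeight p h * ENNReal.ofReal (‖h‖ ^ q) = powWeight (p - q) h := by
  rw [powWeight, powWeight, ← ENNReal.ofReal_mul (by positivity),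
    ← Real.rpow_add (norm_pos_iff.2 hh)]
  congr 2; ring

/-- The boundary weight `∫_{y + h ∉ Ω} |h|^{-p} dh`. -/
def bdryWeight (Ω : Set E3) (p : ℝ) (y : E3) : ℝ≥0∞ :=
  ∫⁻ h, Ωᶜ.indicator 1 (y + h) * powWeight p h

lemma measurable_bdryWeight {Ω : Set E3} (hΩ : MeasurableSet Ω) (p : ℝ) :
    Measurable (bdryWeight Ω p) := by
  have h1 : Measurable (Ωᶜ.indicator (1 : E3 → ℝ≥0∞)) := measurable_one.indicator hΩ.compl
  have h2 := measurable_powWeight p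
  have : Measurable fun q : E3 × E3 => Ωᶜ.indicator 1 (q.1 + q.2) * powWeight p q.2 := by fun_prop
  exact this.lintegral_prod_right'

/-- Integration over `Ω` against the boundary weight. -/
lemma lintegral_bdryWeight_mul {Ω : Set E3} (hΩ : MeasurableSet Ω) (p : ℝ) {G : E3 → ℝ≥0∞}
    (hG : Measurable G) : ∫⁻ y in Ω, bdryWeight Ω p y * G y =
      ∫⁻ h, powWeight p h * ∫⁻ y in exitSet Ω h, G y := by
  have h1 : Measurable (Ωᶜ.indicator (1 : E3 → ℝ≥0∞)) := measurable_one.indicator hΩ.compl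
  have h2 := measurable_powWeight p
  calc _ = ∫⁻ y in Ω, ∫⁻ h, Ωᶜ.indicator 1 (y + h) * powWeight p h * G y := by
        refine lintegral_congr fun y => ?_
        rw [bdryWeight, lintegral_mul_const _ (by fun_prop)]
    _ = ∫⁻ h, ∫⁻ y in Ω, Ωᶜ.indicator 1 (y + h) * powWeight p h * G y := by
        rw [lintegral_lintegral_swap]
        exact Measurable.aemeasurable (by fun_prop)
    _ = _ := by
        refine lintegral_congr fun h => ?_
        rw [← lintegral_const_mul _ hG, ← lintegral_indicator hΩ,
          ← lintegral_indicator (measurableSet_exitSet hΩ h)]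
        refine lintegral_congr fun y => ?_
        by_cases hy : y ∈ Ω <;> by_cases hyh : y + h ∈ Ω <;> simp [exitSet, hy, hyh]

/-- By Tonelli this is the integral of |h|^(-p) against the |y-z|⁻² mass of the exit layer of h.
With η = (4-p)/2 the integrand near 0 is of order |h|^(-(1+p/2)), integrable because p < 4. For |h|
≥ 1 the layer mass is bounded and p > 3 suffices. -/
lemma bdryWeight_singular_integral_le {Ω : Set E3} (hΩ : MeasurableSet Ω) (hc : Convex ℝ Ω) {D : ℝ}
    (hD : ∀ x ∈ Ω, ∀ y ∈ Ω, ‖x - y‖ ≤ D) {p : ℝ} (hp : 3 < p) (hp4 : p < 4) :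
    ∃ C : ℝ≥0, ∀ z ∈ Ω, ∫⁻ y in Ω, bdryWeight Ω p y * powWeight 2 (y - z) ≤ C := by
  obtain ⟨C, hC⟩ := exitSet_singular_integral_le hΩ hc hD (η := (4 - p) / 2) (by linarith)
    (by linarith)
  set q := p - (1 - (4 - p) / 2)
  have hq : q < 3 := by simp only [q]; linarith
  have hpw := measurable_powWeight
  set J := (∫⁻ h in Metric.ball (0 : E3) 1, C * powWeight q h) +
    ∫⁻ h in (Metric.ball (0 : E3) 1)ᶜ,
      (C * ENNReal.ofReal ((D + 1) ^ (1 - (4 - p) / 2))) * powWeight p h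
  have hJ : J < ∞ := by
    refine ENNReal.add_lt_top.2 ⟨?_, ?_⟩
    · rw [lintegral_const_mul _ (hpw q)]
      exact ENNReal.mul_lt_top ENNReal.coe_lt_top (lintegral_powWeight_ball_lt_top hq)
    · rw [lintegral_const_mul _ (hpw p)]
      exact ENNReal.mul_lt_top (ENNReal.mul_lt_top ENNReal.coe_lt_top ENNReal.ofReal_lt_top)
        (lintegral_powWeight_compl_ball_lt_top hp)
  refine ⟨J.toNNReal, fun z hz => ?_⟩
  rw [ENNReal.coe_toNNReal hJ.ne, lintegral_bdryWeight_mul hΩ p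
    (G := fun y => powWeight 2 (y - z)) ((hpw 2).comp (by fun_prop : Measurable fun y : E3 => y - z)),
    ← lintegral_add_compl _ (measurableSet_ball (x := (0 : E3)) (ε := 1))]
  have hD0 : 0 ≤ D := by simpa using hD z hz z hz
  refine add_le_add ?_ (lintegral_mono fun h => ?_)
  · refine lintegral_mono_ae (ae_restrict_of_ae (ae_ne_zero.mono fun h hh => ?_))
    refine (mul_le_mul_right (hC z hz h hh) _).trans (le_of_eq ?_)
    rw [← powWeight_mul hh]; ring
  · rw [mul_comm]
    refine mul_le_mul_left ?_ _
    -- Translation by a vector longer than D moves every point of Ω out of Ω, so the exit set of e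
    -- contains every other exit set.
    set e : E3 := EuclideanSpace.single 0 (D + 1)
    have he : ‖e‖ = D + 1 := by simp [e, abs_of_nonneg (by linarith : 0 ≤ D + 1)]
    have he0 : e ≠ 0 := by rw [← norm_pos_iff, he]; linarith
    rw [← he]
    have hsub : exitSet Ω h ⊆ exitSet Ω e := fun y hy => ⟨hy.1, fun hye => ?_⟩
    · exact (lintegral_mono_set hsub).trans (hC z hz e he0)
    have := hD _ hye _ hy.1
    rw [add_sub_cancel_left, he] at this
    linarith

lemma lintegral_ray_sub_le {G : E3 → ℝ≥0∞} (hG : Measurable G) (x : E3) :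
    ∫⁻ v, (vw v)⁻¹ ^ 3 * ∫⁻ s in Ioi (0 : ℝ), G (x - s • v) ≤
      ∫⁻ y, powWeight 2 (x - y) * G y := by
  refine le_trans (le_of_eq ?_) (lintegral_ray_le hG x)
  rw [← lintegral_neg_eq_self]
  refine lintegral_congr fun v => ?_
  simp only [smul_neg, sub_neg_eq_add, vw, norm_neg]

/-- The weighted square velocity average of a function. -/
def velNorm (n : ℕ) (g : E3 × E3 → ℝ) (x : E3) : ℝ≥0∞ := ∫⁻ v, vw v ^ (2 * n) * ‖g (x, v)‖ₑ ^ 2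

lemma measurable_velNorm (n : ℕ) {g : E3 × E3 → ℝ} (hg : Measurable g) :
    Measurable (velNorm n g) := by
  have hv := measurable_vw
  have : Measurable fun q : E3 × E3 => vw q.2 ^ (2 * n) * ‖g q‖ₑ ^ 2 := by fun_prop
  exact this.lintegral_prod_right'

lemma enorm_kerOp_sq_le (n : ℕ) {k : E3 → E3 → ℝ} {A : ℝ} (hk : IsGradKernel k A) :
    ∃ C : ℝ≥0, ∀ g : E3 × E3 → ℝ, Measurable g → ∀ x v,
      ‖kerOp k g (x, v)‖ₑ ^ 2 ≤ C * ((vw v)⁻¹ ^ (2 * n) * velNorm n g x) := by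
  obtain ⟨C, hC⟩ := kerOp_pointwise n hk
  refine ⟨C, fun g hg x v => ?_⟩
  have h := mul_le_mul_right (hC g hg x v) ((vw v)⁻¹ ^ (2 * n))
  rw [← mul_assoc, ← mul_pow, ENNReal.inv_mul_cancel (vw_ne_zero v) (vw_ne_top v), one_pow,
    one_mul] at h
  exact h.trans (le_of_eq (by rw [velNorm]; ring))

/-- A Hardy-type inequality: one step of the iteration is square integrable against the boundary
weight. -/
lemma hardy_stepOp (n : ℕ) {Ω : Set E3} (hΩ : MeasurableSet Ω) (hc : Convex ℝ Ω) {D ν₀ A : ℝ}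
    {ν : E3 → ℝ} (hν : IsFrequency ν ν₀) (hD : ∀ x ∈ Ω, ∀ y ∈ Ω, ‖x - y‖ ≤ D)
    {k : E3 → E3 → ℝ} (hk : IsGradKernel k A) {p : ℝ} (hp : 3 < p) (hp4 : p < 4) :
    ∃ C : ℝ≥0, ∀ g : E3 × E3 → ℝ, Measurable g →
      ∫⁻ x in Ω, bdryWeight Ω p x * velNorm n (stepOp Ω ν k g) x ≤ C * wNorm (n + 1) g := by
  obtain ⟨C₁, hC₁⟩ := enorm_kerOp_sq_le (n + 1) hk
  obtain ⟨C₂, hC₂⟩ := bdryWeight_singular_integral_le hΩ hc hD hp hp4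
  set c := ENNReal.ofReal (2 / ν₀ + 2 * D)
  refine ⟨c.toNNReal * C₁ * C₂, fun g hg => ?_⟩
  have hv := measurable_vw
  have hpw := measurable_powWeight
  have hW := measurable_bdryWeight hΩ p
  have hkg := measurable_kerOp hk.measurable hg
  have hm := measurable_velNorm (n + 1) hg
  set m := velNorm (n + 1) g
  set G := Ω.indicator m
  have hG : Measurable G := hm.indicator hΩ
  -- Bookkeeping of weights: transport contributes (1+|v|)⁻¹ and the pointwise bound on K g
  -- contributes (1+|v|)^(-2(n+1)). Against (1+|v|)^(2n) this leaves (1+|v|)⁻³, the weight required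
  -- for integration over rays.
  have h1 : ∀ x ∈ Ω, velNorm n (stepOp Ω ν k g) x ≤ c * C₁ * ∫⁻ y, powWeight 2 (x - y) * G y := by
    intro x hx
    refine le_trans ?_ (mul_le_mul_right (lintegral_ray_sub_le hG x) _)
    rw [← lintegral_const_mul' _ _ (ENNReal.mul_ne_top ENNReal.ofReal_ne_top ENNReal.coe_ne_top)]
    refine lintegral_mono fun v => ?_
    have hvi : vw v * (vw v)⁻¹ = 1 := ENNReal.mul_inv_cancel (vw_ne_zero v) (vw_ne_top v)
    have hGs : Measurable fun s : ℝ => G (x - s • v) :=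
      hG.comp (by fun_prop : Measurable fun s : ℝ => x - s • v)
    calc vw v ^ (2 * n) * ‖stepOp Ω ν k g (x, v)‖ₑ ^ 2
        = vw v ^ (2 * n) * (vw v)⁻¹ * (vw v * ‖transOp ν (cut Ω (kerOp k g)) (x, v)‖ₑ ^ 2) := by
          rw [stepOp, cut_of_mem hx, mul_assoc, ← mul_assoc (vw v)⁻¹, mul_comm (vw v)⁻¹, hvi,
            one_mul]
      _ ≤ vw v ^ (2 * n) * (vw v)⁻¹ * (c * ∫⁻ s in Ioi (0 : ℝ),
            ENNReal.ofReal (Real.exp (-(ν₀ * s))) * ‖cut Ω (kerOp k g) (x - s • v, v)‖ₑ ^ 2) :=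
          mul_le_mul_right (transOp_pointwise hΩ hν hD hkg hx v) _
      _ ≤ vw v ^ (2 * n) * (vw v)⁻¹ * (c * ∫⁻ s in Ioi (0 : ℝ),
            C₁ * (vw v)⁻¹ ^ (2 * (n + 1)) * G (x - s • v)) := by
          refine mul_le_mul_right (mul_le_mul_right (setLIntegral_mono' measurableSet_Ioi
            fun s hs => ?_) _) _
          have he : ENNReal.ofReal (Real.exp (-(ν₀ * s))) ≤ 1 := by
            rw [ENNReal.ofReal_le_one, Real.exp_le_one_iff]
            nlinarith [hν.pos, mem_Ioi.1 hs]
          by_cases hxs : x - s • v ∈ Ω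
          · rw [cut_of_mem hxs]
            simp only [G]
            rw [indicator_of_mem hxs]
            refine (mul_le_of_le_one_left zero_le he).trans ((hC₁ g hg _ v).trans (le_of_eq ?_))
            rw [mul_assoc]
          · simp [cut_of_notMem hxs]
      _ = c * C₁ * ((vw v * (vw v)⁻¹) ^ (2 * n) * (vw v)⁻¹ ^ 3 *
            ∫⁻ s in Ioi (0 : ℝ), G (x - s • v)) := by
          rw [lintegral_const_mul _ hGs]; ring
      _ = _ := by rw [hvi, one_pow, one_mul]
  calc _ ≤ ∫⁻ x in Ω, bdryWeight Ω p x * (c * C₁ * ∫⁻ y, powWeight 2 (x - y) * G y) :=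
        setLIntegral_mono' hΩ fun x hx => mul_le_mul_right (h1 x hx) _
    _ = c * C₁ * ∫⁻ x in Ω, ∫⁻ y, bdryWeight Ω p x * (powWeight 2 (x - y) * G y) := by
        rw [← lintegral_const_mul' _ _ (ENNReal.mul_ne_top ENNReal.ofReal_ne_top
          ENNReal.coe_ne_top)]
        refine lintegral_congr fun x => ?_
        rw [lintegral_const_mul _ (by fun_prop)]; ring
    _ = c * C₁ * ∫⁻ y, ∫⁻ x in Ω, bdryWeight Ω p x * (powWeight 2 (x - y) * G y) := by
        rw [lintegral_lintegral_swap]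
        exact Measurable.aemeasurable (by fun_prop)
    _ ≤ c * C₁ * ∫⁻ y, C₂ * G y := by
        refine mul_le_mul_right (lintegral_mono fun y => ?_) _
        by_cases hy : y ∈ Ω
        · refine le_trans (le_of_eq ?_) (mul_le_mul_left (hC₂ y hy) (G y))
          rw [← lintegral_mul_const _ (by fun_prop)]
          exact lintegral_congr fun x => by ring
        · simp [G, hy]
    _ ≤ c * C₁ * (C₂ * ∫⁻ y, m y) := by
        rw [lintegral_const_mul _ hG]
        gcongr
        exact indicator_le_self _ _ _
    _ = _ := by
        rw [ENNReal.coe_mul, ENNReal.coe_mul, ENNReal.coe_toNNReal ENNReal.ofReal_ne_top]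
        simp only [m, wNorm, velNorm]
        ring

/-! ### The Fourier transform in the space variable -/

open FourierTransform SchwartzMap in
/-- The Fourier transform on `L²` is given by the Fourier integral for integrable functions. -/
lemma fourier_toLp_ae_eq {f : E3 → ℂ} (h1 : Integrable f) (h2 : MemLp f 2) :
    (𝓕 (h2.toLp f) : Lp ℂ 2 (volume : Measure E3)) =ᵐ[volume] 𝓕 f := by
  have hcont : Continuous (𝓕 f) :=
    VectorFourier.fourierIntegral_continuous Real.continuous_fourierChar
      (by exact continuous_inner) h1
  -- Both transforms are tested against smooth compactly supported functions: the L² transform is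
  -- compatible with duality on tempered distributions, and the Fourier integral satisfies the same
  -- exchange formula.
  refine ae_eq_of_integral_contDiff_smul_eq
    ((Lp.memLp _).locallyIntegrable (by norm_num)) hcont.locallyIntegrable fun g hg hgs => ?_
  have hgs' : HasCompactSupport fun x => (g x : ℂ) := hgs.comp_left (g := ((↑) : ℝ → ℂ)) rfl
  set φ : 𝓢(E3, ℂ) := hgs'.toSchwartzMap (Complex.ofRealCLM.contDiff.comp hg)
  have hφ : ∀ x, φ x = (g x : ℂ) := fun x => rfl
  have e := congrArg (fun T : TemperedDistribution E3 ℂ => T φ)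
    (Lp.fourier_toTemperedDistribution_eq (h2.toLp f))
  simp only [TemperedDistribution.fourier_apply, Lp.toTemperedDistribution_apply] at e
  have e1 : ∫ x, (𝓕 φ) x • (h2.toLp f) x = ∫ x, φ x • 𝓕 f x := by
    have := VectorFourier.integral_fourierIntegral_smul_eq_flip (μ := (volume : Measure E3))
      (ν := (volume : Measure E3)) (L := innerₗ E3) (f := φ) (g := f)
      Real.continuous_fourierChar (by exact continuous_inner) φ.integrable h1
    rw [flip_innerₗ] at this
    refine Eq.trans ?_ this
    refine integral_congr_ae (h2.coeFn_toLp.mono fun x hx => ?_)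
    simp only [hx]
    rfl
  rw [e1] at e
  simpa [hφ, Complex.real_smul] using e.symm

open FourierTransform in
/-- Plancherel's theorem for integrable square integrable functions. -/
lemma lintegral_fourier_sq {f : E3 → ℂ} (h1 : Integrable f) (h2 : MemLp f 2) :
    ∫⁻ ξ, ‖𝓕 f ξ‖ₑ ^ 2 = ∫⁻ x, ‖f x‖ₑ ^ 2 := by
  have key : ∀ u : Lp ℂ 2 (volume : Measure E3), ∫⁻ x, ‖u x‖ₑ ^ 2 = ‖u‖ₑ ^ 2 := by
    intro u
    rw [Lp.enorm_def, eLpNorm_eq_lintegral_rpow_enorm_toReal (by norm_num) (by norm_num),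
      ← ENNReal.rpow_natCast, ← ENNReal.rpow_mul]
    norm_num
  calc ∫⁻ ξ, ‖𝓕 f ξ‖ₑ ^ 2 = ∫⁻ ξ, ‖(𝓕 (h2.toLp f) : Lp ℂ 2 (volume : Measure E3)) ξ‖ₑ ^ 2 :=
        lintegral_congr_ae ((fourier_toLp_ae_eq h1 h2).mono fun x hx => by simp only [hx])
    _ = ‖h2.toLp f‖ₑ ^ 2 := by
        rw [key, ← ofReal_norm, Lp.norm_fourier_eq, ofReal_norm]
    _ = _ := by
        rw [← key]
        exact lintegral_congr_ae (h2.coeFn_toLp.mono fun x hx => by simp only [hx])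

/-- The Fourier transform in the space variable. -/
def ft (g : E3 × E3 → ℝ) (ξ v : E3) : ℂ :=
  ∫ x, Complex.exp (↑(-2 * Real.pi * ⟪x, ξ⟫) * Complex.I) * (g (x, v) : ℂ)

open FourierTransform in
lemma ft_eq_fourier (g : E3 × E3 → ℝ) (ξ v : E3) : ft g ξ v = 𝓕 (fun x => (g (x, v) : ℂ)) ξ := by
  rw [Real.fourier_eq', ft]; rfl

lemma measurable_ft {g : E3 × E3 → ℝ} (hg : Measurable g) :
    Measurable fun q : E3 × E3 => ft g q.1 q.2 := by
  have : Measurable fun q : (E3 × E3) × E3 =>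
      Complex.exp (↑(-2 * Real.pi * ⟪q.2, q.1.1⟫) * Complex.I) * (g (q.2, q.1.2) : ℂ) := by
    have : Measurable fun q : (E3 × E3) × E3 => g (q.2, q.1.2) :=
      hg.comp (f := fun q : (E3 × E3) × E3 => (q.2, q.1.2)) (by fun_prop)
    fun_prop
  exact this.stronglyMeasurable.integral_prod_right'.measurable

/-- The symbol `|e^{2πi h·ξ} - 1|²` of a squared difference. -/
def diffSymbol (h ξ : E3) : ℝ≥0∞ := ‖Complex.exp (Complex.I * ↑(2 * Real.pi * ⟪h, ξ⟫)) - 1‖ₑ ^ 2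

lemma measurable_diffSymbol : Measurable fun q : E3 × E3 => diffSymbol q.1 q.2 := by
  unfold diffSymbol; fun_prop

lemma diffSymbol_le_four (h ξ : E3) : diffSymbol h ξ ≤ 4 := by
  have : ‖Complex.exp (Complex.I * ↑(2 * Real.pi * ⟪h, ξ⟫)) - 1‖ ≤ 2 := by
    refine (norm_sub_le _ _).trans ?_
    rw [mul_comm, Complex.norm_exp_ofReal_mul_I]; norm_num
  calc diffSymbol h ξ ≤ (ENNReal.ofReal 2) ^ 2 := by
        refine pow_le_pow_left' ?_ 2
        rw [← ofReal_norm]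
        exact ENNReal.ofReal_le_ofReal this
    _ = 4 := by norm_num

lemma diffSymbol_le_sq (h ξ : E3) :
    diffSymbol h ξ ≤ ENNReal.ofReal ((2 * Real.pi * (‖h‖ * ‖ξ‖)) ^ 2) := by
  rw [ENNReal.ofReal_pow (by positivity)]
  refine pow_le_pow_left' ?_ 2
  rw [← ofReal_norm]
  refine ENNReal.ofReal_le_ofReal ((Real.norm_exp_I_mul_ofReal_sub_one_le).trans ?_)
  rw [Real.norm_eq_abs, abs_mul, abs_of_pos (by positivity)]
  exact mul_le_mul_of_nonneg_left (abs_real_inner_le_norm h ξ) (by positivity)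

/-- With t = 2π|h||ξ| the symbol is at most min(4, t²), and min(4, t²) ≤ 2t. A factor |ξ|⁻¹ is
thereby traded for one power of |h|. -/
lemma diffSymbol_mul_inv_le (h ξ : E3) (hξ : ξ ≠ 0) :
    diffSymbol h ξ * ENNReal.ofReal ‖ξ‖⁻¹ ≤ ENNReal.ofReal (4 * Real.pi * ‖h‖) := by
  have hx : 0 < ‖ξ‖ := norm_pos_iff.2 hξ
  have hpi := Real.pi_pos
  rcases le_total (2 * Real.pi * (‖h‖ * ‖ξ‖)) 2 with h2 | h2
  · refine (mul_le_mul_left (diffSymbol_le_sq h ξ) _).trans ?_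
    rw [← ENNReal.ofReal_mul (by positivity)]
    refine ENNReal.ofReal_le_ofReal ?_
    rw [mul_inv_le_iff₀ hx]
    have h3 : 0 ≤ 2 * Real.pi * (‖h‖ * ‖ξ‖) := by positivity
    nlinarith [mul_le_mul_of_nonneg_left h2 h3]
  · refine (mul_le_mul_left (diffSymbol_le_four h ξ) _).trans ?_
    rw [show (4 : ℝ≥0∞) = ENNReal.ofReal 4 by norm_num, ← ENNReal.ofReal_mul (by positivity)]
    refine ENNReal.ofReal_le_ofReal ?_
    rw [mul_inv_le_iff₀ hx]
    nlinarith

/-- Plancherel's theorem for differences. -/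
lemma lintegral_diff_sq {g : E3 × E3 → ℝ} {v : E3} (h1 : Integrable fun x => g (x, v))
    (h2 : ∫⁻ x, ‖g (x, v)‖ₑ ^ 2 < ∞) (h : E3) :
    ∫⁻ x, ‖g (x + h, v) - g (x, v)‖ₑ ^ 2 = ∫⁻ ξ, diffSymbol h ξ * ‖ft g ξ v‖ₑ ^ 2 := by
  have h1' : Integrable fun x => (g (x, v) : ℂ) := h1.ofReal
  have m2 : MemLp (fun x => (g (x, v) : ℂ)) 2 := by
    refine ⟨h1'.aestronglyMeasurable, ?_⟩
    rw [eLpNorm_lt_top_iff_lintegral_rpow_enorm_lt_top (by norm_num) (by norm_num)]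
    simpa [← ofReal_norm, Complex.norm_real] using h2
  have m1 : Integrable fun x => (g (x + h, v) : ℂ) := h1'.comp_add_right h
  have m3 : MemLp (fun x => (g (x + h, v) : ℂ)) 2 :=
    m2.comp_measurePreserving (measurePreserving_add_right volume h)
  have key := lintegral_fourier_sq (m1.sub h1') (m3.sub m2)
  have e1 : ∫⁻ x, ‖g (x + h, v) - g (x, v)‖ₑ ^ 2 =
      ∫⁻ x, ‖((fun x => (g (x + h, v) : ℂ)) - fun x => (g (x, v) : ℂ)) x‖ₑ ^ 2 := by
    refine lintegral_congr fun x => ?_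
    rw [Pi.sub_apply, ← Complex.ofReal_sub, ← ofReal_norm, ← ofReal_norm, Complex.norm_real]
  rw [e1, ← key]
  refine lintegral_congr fun ξ => ?_
  rw [diffSymbol, ← mul_pow, ← enorm_mul, sub_mul, one_mul]
  congr 2
  rw [Real.fourier_eq']
  have i1 : ∀ {f : E3 → ℂ}, Integrable f → Integrable fun x =>
      Complex.exp (↑(-2 * Real.pi * ⟪x, ξ⟫) * Complex.I) * f x := by
    intro f hf
    refine hf.bdd_mul (c := 1) (by fun_prop) (ae_of_all _ fun x => ?_)
    rw [Complex.norm_exp_ofReal_mul_I]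
  simp only [Pi.sub_apply, smul_eq_mul, mul_sub]
  rw [integral_sub (i1 m1) (i1 h1'), ← ft]
  congr 1
  rw [ft, ← integral_const_mul, ← integral_add_right_eq_self (fun x => _ * (_ * (g (x, v) : ℂ))) h]
  refine integral_congr_ae (ae_of_all _ fun x => ?_)
  simp only
  rw [← mul_assoc, ← Complex.exp_add, inner_add_left]
  congr 2
  push_cast
  ring

/-! ### The symbol of the transport operator -/

/-- The symbol of the damped transport operator. -/
def transSymbol (ν : E3 → ℝ) (ξ w : E3) : ℂ :=
  ((ν w : ℂ) + ↑(2 * Real.pi * ⟪w, ξ⟫) * Complex.I)⁻¹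

lemma measurable_transSymbol {ν : E3 → ℝ} (hν : Measurable ν) :
    Measurable fun q : E3 × E3 => transSymbol ν q.1 q.2 := by
  unfold transSymbol; fun_prop

lemma enorm_transSymbol_sq_le {ν : E3 → ℝ} {ν₀ : ℝ} (hν : IsFrequency ν ν₀) (ξ w : E3) :
    ‖transSymbol ν ξ w‖ₑ ^ 2 ≤ ENNReal.ofReal (ν₀ ^ 2 + (2 * Real.pi * ⟪w, ξ⟫) ^ 2)⁻¹ := by
  have h0 := hν.pos
  rw [← ofReal_norm, ← ENNReal.ofReal_pow (norm_nonneg _)]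
  refine ENNReal.ofReal_le_ofReal ?_
  rw [transSymbol, norm_inv, inv_pow, Complex.sq_norm, Complex.normSq_add_mul_I]
  refine inv_anti₀ (by positivity) ?_
  gcongr
  exact hν.bound w

/-- The transport operator is a Fourier multiplier. -/
lemma ft_transOp {ν : E3 → ℝ} {ν₀ : ℝ} (hν : IsFrequency ν ν₀) {g : E3 × E3 → ℝ}
    (hg : Measurable g) {w : E3} (h1 : Integrable fun x => g (x, w)) (ξ : E3) :
    ft (transOp ν g) ξ w = transSymbol ν ξ w * ft g ξ w := by
  have hνw : 0 < ν w := hν.pos.trans_le (hν.bound w)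
  have hexp : IntegrableOn (fun s : ℝ => Real.exp (-ν w * s)) (Ioi 0) :=
    integrableOn_exp_mul_Ioi (by linarith) 0
  have hprod : Integrable (fun q : E3 × ℝ => Complex.exp (↑(-2 * Real.pi * ⟪q.1, ξ⟫) * Complex.I) *
      ↑(Real.exp (-(ν w * q.2)) * g (q.1 - q.2 • w, w)))
      ((volume : Measure E3).prod ((volume : Measure ℝ).restrict (Ioi 0))) := by
    have hm : Measurable fun q : E3 × ℝ => g (q.1 - q.2 • w, w) :=
      hg.comp (f := fun q : E3 × ℝ => (q.1 - q.2 • w, w)) (by fun_prop)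
    refine (integrable_prod_iff' (Measurable.aestronglyMeasurable (by fun_prop))).2 ⟨?_, ?_⟩
    · refine ae_of_all _ fun s => ?_
      refine Integrable.bdd_mul (c := 1) (Integrable.ofReal
        (f := fun x => Real.exp (-(ν w * s)) * g (x - s • w, w))
        ((h1.comp_sub_right (s • w)).const_mul _)) (by fun_prop) (ae_of_all _ fun x => ?_)
      rw [Complex.norm_exp_ofReal_mul_I]
    · refine (hexp.mul_const (∫ x, ‖g (x, w)‖)).congr (ae_of_all _ fun s => ?_)
      have e : ∀ x : E3, ‖Complex.exp (↑(-2 * Real.pi * ⟪x, ξ⟫) * Complex.I) *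
          ↑(Real.exp (-(ν w * s)) * g (x - s • w, w))‖ =
          ‖Real.exp (-(ν w * s))‖ * ‖g (x - s • w, w)‖ := fun x => by
        rw [norm_mul, Complex.norm_exp_ofReal_mul_I, one_mul, Complex.norm_real, norm_mul]
      simp only [e]
      rw [integral_const_mul, integral_sub_right_eq_self (fun x => ‖g (x, w)‖) (s • w),
        Real.norm_of_nonneg (Real.exp_pos _).le, neg_mul]
  calc ft (transOp ν g) ξ w
      = ∫ x, ∫ s in Ioi (0 : ℝ), Complex.exp (↑(-2 * Real.pi * ⟪x, ξ⟫) * Complex.I) *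
          ↑(Real.exp (-(ν w * s)) * g (x - s • w, w)) := by
        refine integral_congr_ae (ae_of_all _ fun x => ?_)
        simp only [transOp]
        rw [integral_const_mul, integral_complex_ofReal]
    _ = ∫ s in Ioi (0 : ℝ), ∫ x, Complex.exp (↑(-2 * Real.pi * ⟪x, ξ⟫) * Complex.I) *
          ↑(Real.exp (-(ν w * s)) * g (x - s • w, w)) := integral_integral_swap hprod
    _ = ∫ s in Ioi (0 : ℝ), Complex.exp (-((ν w : ℂ) + ↑(2 * Real.pi * ⟪w, ξ⟫) * Complex.I) * s) *
          ft g ξ w := by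
        refine integral_congr_ae (ae_of_all _ fun s => ?_)
        simp only [ft]
        rw [← integral_const_mul, ← integral_add_right_eq_self _ (s • w)]
        refine integral_congr_ae (ae_of_all _ fun x => ?_)
        simp only [add_sub_cancel_right]
        rw [Complex.ofReal_mul (Real.exp _), ← mul_assoc, ← mul_assoc, Complex.ofReal_exp, ← Complex.exp_add,
          ← Complex.exp_add, inner_add_left, real_inner_smul_left]
        congr 2
        push_cast
        ring
    _ = _ := by
        rw [integral_mul_const, integral_exp_mul_complex_Ioi (by simpa using hνw) 0]
        congr 1
        rw [transSymbol, Complex.ofReal_zero, mul_zero, Complex.exp_zero, neg_div_neg_eq, one_div]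

lemma lintegral_transOp_le {ν : E3 → ℝ} {ν₀ : ℝ} (hν : IsFrequency ν ν₀) {g : E3 × E3 → ℝ}
    (hg : Measurable g) (w : E3) :
    ∫⁻ x, ‖transOp ν g (x, w)‖ₑ ≤ ENNReal.ofReal (1 / ν₀) * ∫⁻ x, ‖g (x, w)‖ₑ := by
  have hm : Measurable fun q : E3 × ℝ => g (q.1 - q.2 • w, w) :=
    hg.comp (f := fun q : E3 × ℝ => (q.1 - q.2 • w, w)) (by fun_prop)
  calc _ ≤ ∫⁻ x, ∫⁻ s in Ioi (0 : ℝ), ENNReal.ofReal (Real.exp (-(ν₀ * s))) *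
        ‖g (x - s • w, w)‖ₑ := lintegral_mono fun x => enorm_transOp_le hν g x w
    _ = ∫⁻ s in Ioi (0 : ℝ), ∫⁻ x, ENNReal.ofReal (Real.exp (-(ν₀ * s))) *
        ‖g (x - s • w, w)‖ₑ := by
        rw [lintegral_lintegral_swap]
        exact Measurable.aemeasurable (by fun_prop)
    _ = ∫⁻ s in Ioi (0 : ℝ), ENNReal.ofReal (Real.exp (-(ν₀ * s))) * ∫⁻ x, ‖g (x, w)‖ₑ := by
        refine lintegral_congr fun s => ?_
        rw [lintegral_const_mul' _ _ ENNReal.ofReal_ne_top,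
          lintegral_sub_right_eq_self (fun x => ‖g (x, w)‖ₑ) (s • w)]
    _ = _ := by rw [lintegral_mul_const _ (by fun_prop), lintegral_exp_neg hν.pos]

/-- A ray integral is an average of translates against a measure of mass 1/ν₀, hence bounded on L²
with that constant. -/
lemma lintegral_damped_ray_sq_le {ν₀ : ℝ} (hν₀ : 0 < ν₀) {F : E3 → ℝ≥0∞} (hF : Measurable F)
    (w : E3) :
    ∫⁻ x, (∫⁻ s in Ioi (0 : ℝ), ENNReal.ofReal (Real.exp (-(ν₀ * s))) * F (x - s • w)) ^ 2 ≤
      ENNReal.ofReal (1 / ν₀) ^ 2 * ∫⁻ x, F x ^ 2 := by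
  have hm : Measurable fun q : E3 × ℝ => F (q.1 - q.2 • w) :=
    hF.comp (f := fun q : E3 × ℝ => q.1 - q.2 • w) (by fun_prop)
  have hms : ∀ x, Measurable fun s : ℝ => F (x - s • w) := fun x =>
    hF.comp (f := fun s : ℝ => x - s • w) (by fun_prop)
  calc _ ≤ ∫⁻ x, ENNReal.ofReal (1 / ν₀) * ∫⁻ s in Ioi (0 : ℝ),
        ENNReal.ofReal (Real.exp (-(ν₀ * s))) * F (x - s • w) ^ 2 := by
        refine lintegral_mono fun x => ?_
        have := hms x
        refine (lintegral_mul_sq_le_weighted (by fun_prop) (by fun_prop)).trans ?_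
        rw [lintegral_exp_neg hν₀]
    _ = ENNReal.ofReal (1 / ν₀) * ∫⁻ s in Ioi (0 : ℝ), ∫⁻ x,
        ENNReal.ofReal (Real.exp (-(ν₀ * s))) * F (x - s • w) ^ 2 := by
        rw [lintegral_const_mul' _ _ ENNReal.ofReal_ne_top, lintegral_lintegral_swap]
        exact Measurable.aemeasurable (by fun_prop)
    _ = ENNReal.ofReal (1 / ν₀) * ∫⁻ s in Ioi (0 : ℝ), ENNReal.ofReal (Real.exp (-(ν₀ * s))) *
        ∫⁻ x, F x ^ 2 := by
        congr 1
        refine lintegral_congr fun s => ?_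
        rw [lintegral_const_mul' _ _ ENNReal.ofReal_ne_top,
          lintegral_sub_right_eq_self (fun x => F x ^ 2) (s • w)]
    _ = _ := by rw [lintegral_mul_const _ (by fun_prop), lintegral_exp_neg hν₀, sq, mul_assoc]

lemma lintegral_transOp_sq_le {ν : E3 → ℝ} {ν₀ : ℝ} (hν : IsFrequency ν ν₀) {g : E3 × E3 → ℝ}
    (hg : Measurable g) (w : E3) :
    ∫⁻ x, ‖transOp ν g (x, w)‖ₑ ^ 2 ≤ ENNReal.ofReal (1 / ν₀) ^ 2 * ∫⁻ x, ‖g (x, w)‖ₑ ^ 2 := by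
  refine le_trans (lintegral_mono fun x => pow_le_pow_left' (enorm_transOp_le hν g x w) 2)
    (lintegral_damped_ray_sq_le hν.pos (F := fun x => ‖g (x, w)‖ₑ) ?_ w)
  exact (hg.comp (f := fun x => (x, w)) (by fun_prop)).enorm

/-- The operator `K` commutes with the Fourier transform in space. -/
lemma ft_kerOp {k : E3 → E3 → ℝ} {A : ℝ} (hk : IsGradKernel k A) {t : E3 × E3 → ℝ}
    (ht : Measurable t) {v : E3} (hfin : ∫⁻ w, gradBoundE (v - w) * ∫⁻ x, ‖t (x, w)‖ₑ < ∞) :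
    Integrable (fun x => kerOp k t (x, v)) ∧
      ∀ ξ, ft (kerOp k t) ξ v = ∫ w, (k v w : ℂ) * ft t ξ w := by
  have hkm : Measurable (k v) := hk.measurable.of_uncurry_left
  have hF : Integrable (fun q : E3 × E3 => k v q.2 * t q)
      ((volume : Measure E3).prod volume) := by
    have hm : Measurable fun q : E3 × E3 => k v q.2 * t q := by fun_prop
    refine ⟨hm.aestronglyMeasurable, ?_⟩
    rw [hasFiniteIntegral_iff_enorm, lintegral_prod_symm _ hm.enorm.aemeasurable]
    have hb := measurable_gradBoundE
    calc _ ≤ ∫⁻ w, ENNReal.ofReal A * (gradBoundE (v - w) * ∫⁻ x, ‖t (x, w)‖ₑ) := by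
          refine lintegral_mono fun w => ?_
          simp only [enorm_mul]
          rw [lintegral_const_mul' _ _ enorm_ne_top, ← mul_assoc]
          gcongr
          rw [gradBoundE, ← ENNReal.ofReal_mul hk.nonneg, Real.enorm_eq_ofReal_abs]
          exact ENNReal.ofReal_le_ofReal (hk.bound v w)
      _ = ENNReal.ofReal A * ∫⁻ w, gradBoundE (v - w) * ∫⁻ x, ‖t (x, w)‖ₑ :=
          lintegral_const_mul' _ _ ENNReal.ofReal_ne_top
      _ < ∞ := ENNReal.mul_lt_top ENNReal.ofReal_lt_top hfin
  refine ⟨hF.integral_prod_left, fun ξ => ?_⟩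
  have hG : Integrable (fun q : E3 × E3 => Complex.exp (↑(-2 * Real.pi * ⟪q.1, ξ⟫) * Complex.I) *
      ((k v q.2 * t q : ℝ) : ℂ)) ((volume : Measure E3).prod volume) := by
    refine Integrable.bdd_mul (c := 1) hF.ofReal
      (Measurable.aestronglyMeasurable (by fun_prop)) (ae_of_all _ fun x => ?_)
    rw [Complex.norm_exp_ofReal_mul_I]
  calc ft (kerOp k t) ξ v = ∫ x, ∫ w, Complex.exp (↑(-2 * Real.pi * ⟪x, ξ⟫) * Complex.I) *
        ((k v w * t (x, w) : ℝ) : ℂ) := by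
        refine integral_congr_ae (ae_of_all _ fun x => ?_)
        simp only [kerOp]
        rw [integral_const_mul, integral_complex_ofReal]
    _ = ∫ w, ∫ x, Complex.exp (↑(-2 * Real.pi * ⟪x, ξ⟫) * Complex.I) *
        ((k v w * t (x, w) : ℝ) : ℂ) := integral_integral_swap hG
    _ = _ := by
        refine integral_congr_ae (ae_of_all _ fun w => ?_)
        simp only [ft]
        rw [← integral_const_mul]
        refine integral_congr_ae (ae_of_all _ fun x => ?_)
        push_cast
        ring

lemma lintegral_triple_mul_sq_le {α : Type*} [MeasurableSpace α] {μ : Measure α}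
    {f g h : α → ℝ≥0∞} (hf : AEMeasurable f μ) (hg : AEMeasurable g μ) (hh : AEMeasurable h μ) :
    (∫⁻ a, f a * (g a * h a) ∂μ) ^ 2 ≤ (∫⁻ a, f a * g a ^ 2 ∂μ) * ∫⁻ a, f a * h a ^ 2 ∂μ := by
  have hs : ∀ x : ℝ≥0∞, x ^ (1 / 2 : ℝ) * x ^ (1 / 2 : ℝ) = x := fun x => by
    rw [← ENNReal.rpow_add_of_nonneg _ _ (by norm_num) (by norm_num)]; norm_num
  have key := lintegral_mul_sq_le (μ := μ) ((hf.pow_const (1 / 2 : ℝ)).mul hg)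
    ((hf.pow_const (1 / 2 : ℝ)).mul hh)
  have e : ∀ a, f a ^ (1 / 2 : ℝ) * g a * (f a ^ (1 / 2 : ℝ) * h a) = f a * (g a * h a) := fun a => by
    nth_rewrite 3 [← hs (f a)]; ring
  simp only [Pi.mul_apply, mul_pow, e, sq (f _ ^ (1 / 2 : ℝ)), hs] at key
  exact key

/-- A weighted Schur estimate for the operator with kernel `k`. -/
lemma lintegral_kernel_mul_sq_le {k : E3 → E3 → ℝ} {A : ℝ} (hk : IsGradKernel k A) {M : ℝ≥0∞}
    {m φ : E3 → ℂ} (hm : Measurable m) (hφ : Measurable φ)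
    (hM : ∀ v, ∫⁻ w, gradBoundE (v - w) * ‖m w‖ₑ ^ 2 ≤ M) :
    ∫⁻ v, ‖∫ w, (k v w : ℂ) * (m w * φ w)‖ₑ ^ 2 ≤
      ENNReal.ofReal A ^ 2 * (∫⁻ z, gradBoundE z) * M * ∫⁻ w, ‖φ w‖ₑ ^ 2 := by
  have hb := measurable_gradBoundE
  -- Cauchy–Schwarz against the kernel separates the multiplier m, bounded uniformly in v by M, from
  -- φ, which is summed by Tonelli.
  have key : ∀ v, ‖∫ w, (k v w : ℂ) * (m w * φ w)‖ₑ ^ 2 ≤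
      ENNReal.ofReal A ^ 2 * (M * ∫⁻ w, gradBoundE (v - w) * ‖φ w‖ₑ ^ 2) := by
    intro v
    calc _ ≤ (ENNReal.ofReal A * ∫⁻ w, gradBoundE (v - w) * (‖m w‖ₑ * ‖φ w‖ₑ)) ^ 2 := by
          refine pow_le_pow_left' ?_ 2
          rw [← lintegral_const_mul' _ _ ENNReal.ofReal_ne_top]
          refine (enorm_integral_le_lintegral_enorm _).trans (lintegral_mono fun w => ?_)
          rw [enorm_mul, enorm_mul, ← mul_assoc (ENNReal.ofReal A)]
          gcongr
          rw [gradBoundE, ← ENNReal.ofReal_mul hk.nonneg, ← ofReal_norm, Complex.norm_real]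
          exact ENNReal.ofReal_le_ofReal (hk.bound v w)
      _ ≤ _ := by
          rw [mul_pow]
          refine mul_le_mul_right ((lintegral_triple_mul_sq_le (by fun_prop) (by fun_prop)
            (by fun_prop)).trans ?_) _
          exact mul_le_mul_left (hM v) _
  calc _ ≤ ∫⁻ v, ENNReal.ofReal A ^ 2 * (M * ∫⁻ w, gradBoundE (v - w) * ‖φ w‖ₑ ^ 2) :=
        lintegral_mono key
    _ = ENNReal.ofReal A ^ 2 * (M * ∫⁻ v, ∫⁻ w, gradBoundE (v - w) * ‖φ w‖ₑ ^ 2) := by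
        have : Measurable fun v => ∫⁻ w, gradBoundE (v - w) * ‖φ w‖ₑ ^ 2 := by
          have : Measurable fun q : E3 × E3 => gradBoundE (q.1 - q.2) * ‖φ q.2‖ₑ ^ 2 := by fun_prop
          exact this.lintegral_prod_right'
        rw [lintegral_const_mul _ (this.const_mul _), lintegral_const_mul _ this]
    _ = ENNReal.ofReal A ^ 2 * (M * ∫⁻ w, (∫⁻ z, gradBoundE z) * ‖φ w‖ₑ ^ 2) := by
        rw [lintegral_lintegral_swap (Measurable.aemeasurable (by fun_prop))]
        congr 2
        refine lintegral_congr fun w => ?_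
        rw [lintegral_mul_const _ (by fun_prop), lintegral_sub_right_eq_self gradBoundE w]
    _ = _ := by rw [lintegral_const_mul _ (by fun_prop)]; ring

/-- Discarding the component along n leaves a majorant that is independent of a and a product of
integrable functions of b and c. -/
lemma gradBoundE_frame_le {n : E3} (hn : ‖n‖ = 1) (a : ℝ) {b c : ℝ} (hb : b ≠ 0) (hc : c ≠ 0) :
    gradBoundE (a • n + b • frameTwo n + c • frameThree n) ≤
      ENNReal.ofReal (|b| ^ (-(1 / 2) : ℝ) * Real.exp (-(1 / 8) * (0 + b) ^ 2)) *
        ENNReal.ofReal (|c| ^ (-(1 / 2) : ℝ) * Real.exp (-(1 / 8) * (0 + c) ^ 2)) := by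
  have hs := norm_sq_frame hn a b c
  set u := a • n + b • frameTwo n + c • frameThree n
  have h2 : |b| ≤ ‖u‖ :=
    abs_le.2 (abs_le_of_sq_le_sq' (by nlinarith [sq_nonneg a, sq_nonneg c]) (norm_nonneg _))
  have h3 : |c| ≤ ‖u‖ :=
    abs_le.2 (abs_le_of_sq_le_sq' (by nlinarith [sq_nonneg a, sq_nonneg b]) (norm_nonneg _))
  have hu : 0 < ‖u‖ := (abs_pos.2 hb).trans_le h2
  rw [gradBoundE, gradBound, ← ENNReal.ofReal_mul (by positivity)]
  refine ENNReal.ofReal_le_ofReal ?_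
  calc ‖u‖⁻¹ * Real.exp (-‖u‖ ^ 2 / 8)
      ≤ (|b| ^ (-(1 / 2) : ℝ) * |c| ^ (-(1 / 2) : ℝ)) *
        (Real.exp (-(1 / 8) * (0 + b) ^ 2) * Real.exp (-(1 / 8) * (0 + c) ^ 2)) := by
        gcongr
        · exact inv_le_abs_rpow_mul hb hc hu h2 h3
        · rw [← Real.exp_add, Real.exp_le_exp]
          nlinarith [sq_nonneg a]
    _ = _ := by ring

lemma lintegral_lorentzian_lt_top : ∫⁻ a : ℝ, ENNReal.ofReal (1 + a ^ 2)⁻¹ < ∞ :=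
  integrable_inv_one_add_sq.lintegral_lt_top

lemma lintegral_comp_mul_left {r : ℝ} (hr : 0 < r) {F : ℝ → ℝ≥0∞} (hF : Measurable F) :
    ∫⁻ a, F (r * a) = ENNReal.ofReal r⁻¹ * ∫⁻ a, F a := by
  rw [← lintegral_map (μ := (volume : Measure ℝ)) (g := fun x => r * x) hF (by fun_prop),
    Real.map_volume_mul_left hr.ne', lintegral_smul_measure, smul_eq_mul,
    abs_of_pos (inv_pos.2 hr)]

/-- This is the source of the half derivative. With ν replaced by ν₀ the symbol depends on w only
through its component along ξ. The kernel integrates over the orthogonal plane to a constant uniform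
in the remaining variable, and the Lorentzian 1/(ν₀² + (2π|ξ|a)²) integrates to a constant times
1/(ν₀|ξ|). Large symbols occur only in a slab of velocities of width of order 1/|ξ|. -/
lemma lintegral_gradBound_transSymbol_le {ν : E3 → ℝ} {ν₀ : ℝ} (hν : IsFrequency ν ν₀) :
    ∃ C : ℝ≥0, ∀ ξ : E3, ξ ≠ 0 → ∀ v, ∫⁻ w, gradBoundE (v - w) * ‖transSymbol ν ξ w‖ₑ ^ 2 ≤
      C * ENNReal.ofReal ‖ξ‖⁻¹ := by
  have h0 := hν.pos
  set S := singularGaussianBound (1 / 8)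
  have hS : S < ∞ := singularGaussianBound_lt_top (by norm_num)
  set J := ∫⁻ a : ℝ, ENNReal.ofReal (1 + a ^ 2)⁻¹
  have hJ : J < ∞ := lintegral_lorentzian_lt_top
  have hfin : ENNReal.ofReal (2 * Real.pi * ν₀)⁻¹ * J * (S * S) < ∞ :=
    ENNReal.mul_lt_top (ENNReal.mul_lt_top ENNReal.ofReal_lt_top hJ) (ENNReal.mul_lt_top hS hS)
  refine ⟨(ENNReal.ofReal (2 * Real.pi * ν₀)⁻¹ * J * (S * S)).toNNReal, fun ξ hξ v => ?_⟩
  rw [ENNReal.coe_toNNReal hfin.ne]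
  have hb := measurable_gradBoundE
  have hn := norm_normalize hξ
  have hx : 0 < ‖ξ‖ := norm_pos_iff.2 hξ
  set n := ‖ξ‖⁻¹ • ξ
  have hξn : ξ = ‖ξ‖ • n := by simp only [n]; rw [smul_smul, mul_inv_cancel₀ hx.ne', one_smul]
  set L : ℝ → ℝ≥0∞ := fun a => ENNReal.ofReal (ν₀ ^ 2 + (2 * Real.pi * (‖ξ‖ * a)) ^ 2)⁻¹
  have hL : Measurable L := by simp only [L]; fun_prop
  set f : ℝ → ℝ≥0∞ := fun b =>
    ENNReal.ofReal (|b| ^ (-(1 / 2) : ℝ) * Real.exp (-(1 / 8) * (0 + b) ^ 2))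
  have hf : Measurable f := by simp only [f]; fun_prop
  have hfS : ∫⁻ b, f b ≤ S := lintegral_singular_gaussian_le (by norm_num) 0
  calc _ ≤ ∫⁻ w, gradBoundE (v - w) * L ⟪w, n⟫ := by
        refine lintegral_mono fun w => mul_le_mul_right
          ((enorm_transSymbol_sq_le hν ξ w).trans (le_of_eq ?_)) _
        have hw : ‖ξ‖ * ⟪w, n⟫ = ⟪w, ξ⟫ := by rw [← real_inner_smul_right, ← hξn]
        simp only [L]
        rw [hw]
    _ = ∫⁻ u, gradBoundE u * L (⟪v, n⟫ + ⟪u, n⟫) := by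
        rw [← lintegral_add_left_eq_self _ v]
        refine lintegral_congr fun u => ?_
        rw [gradBoundE, gradBound_sub_comm, add_sub_cancel_left, inner_add_left, gradBoundE]
    _ = ∫⁻ a : ℝ, ∫⁻ b : ℝ, ∫⁻ c : ℝ, gradBoundE (a • n + b • frameTwo n + c • frameThree n) *
          L (⟪v, n⟫ + a) := by
        rw [lintegral_frame hn (by fun_prop)]
        simp only [inner_frame hn]
    _ ≤ ∫⁻ a, ∫⁻ b, ∫⁻ c, f b * (f c * L (⟪v, n⟫ + a)) := by
        refine lintegral_mono fun a => lintegral_mono_ae (ae_real_ne_zero.mono fun b hb =>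
          lintegral_mono_ae (ae_real_ne_zero.mono fun c hc => ?_))
        simp only [← mul_assoc]
        exact mul_le_mul_left (gradBoundE_frame_le hn a hb hc) _
    _ = ∫⁻ a, (∫⁻ b, f b) * ((∫⁻ c, f c) * L (⟪v, n⟫ + a)) := by
        simp_rw [fun a b => lintegral_const_mul (μ := (volume : Measure ℝ)) (f b)
          (hf.mul_const (L (⟪v, n⟫ + a))), lintegral_mul_const _ hf]
    _ ≤ ∫⁻ a, S * (S * L (⟪v, n⟫ + a)) := by
        refine lintegral_mono fun a => ?_
        gcongr
    _ = S * (S * ∫⁻ a, L a) := by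
        rw [lintegral_const_mul _ (by fun_prop), lintegral_const_mul _ (by fun_prop),
          lintegral_add_left_eq_self]
    _ = S * (S * (ENNReal.ofReal (ν₀ ^ 2)⁻¹ *
          (ENNReal.ofReal (2 * Real.pi * ‖ξ‖ / ν₀)⁻¹ * J))) := by
        congr 2
        rw [← lintegral_comp_mul_left (by positivity) (by fun_prop),
          ← lintegral_const_mul _ (by fun_prop)]
        refine lintegral_congr fun a => ?_
        simp only [L]
        rw [← ENNReal.ofReal_mul (by positivity), ← mul_inv]
        congr 2
        field_simp
    _ = _ := by
        rw [← mul_assoc (ENNReal.ofReal _), ← ENNReal.ofReal_mul (by positivity),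
          show (ν₀ ^ 2)⁻¹ * (2 * Real.pi * ‖ξ‖ / ν₀)⁻¹ = (2 * Real.pi * ν₀)⁻¹ * ‖ξ‖⁻¹ by
            field_simp, ENNReal.ofReal_mul (by positivity)]
        ring

/-! ### Velocity averaging -/

/-- The squared `L²` norm of the difference of a function and its translate in space. -/
def diffNorm (h : E3) (g : E3 × E3 → ℝ) : ℝ≥0∞ :=
  ∫⁻ v, ∫⁻ x, ‖g (x + h, v) - g (x, v)‖ₑ ^ 2

/-- Measurable functions that are, for almost every velocity, integrable and square integrable
in space. -/
structure IsSpaceRegular (g : E3 × E3 → ℝ) : Prop where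
  measurable : Measurable g
  integrable : ∀ᵐ v, Integrable fun x => g (x, v)
  sq_integrable : ∀ᵐ v, ∫⁻ x, ‖g (x, v)‖ₑ ^ 2 < ∞

/-- The squared `L²` norm in velocity of the Fourier transform. -/
def ftNorm (g : E3 × E3 → ℝ) (ξ : E3) : ℝ≥0∞ := ∫⁻ v, ‖ft g ξ v‖ₑ ^ 2

lemma measurable_ftNorm {g : E3 × E3 → ℝ} (hg : Measurable g) : Measurable (ftNorm g) := by
  have : Measurable fun q : E3 × E3 => ‖ft g q.1 q.2‖ₑ ^ 2 := (measurable_ft hg).enorm.pow_const 2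
  exact this.lintegral_prod_right'

lemma diffNorm_eq {g : E3 × E3 → ℝ} (hg : IsSpaceRegular g) (h : E3) :
    diffNorm h g = ∫⁻ ξ, diffSymbol h ξ * ftNorm g ξ := by
  have hm : Measurable fun q : E3 × E3 => ‖ft g q.1 q.2‖ₑ ^ 2 :=
    (measurable_ft hg.measurable).enorm.pow_const 2
  have hd : Measurable fun ξ => diffSymbol h ξ :=
    measurable_diffSymbol.comp (f := fun ξ => (h, ξ)) (by fun_prop)
  calc diffNorm h g = ∫⁻ v, ∫⁻ ξ, diffSymbol h ξ * ‖ft g ξ v‖ₑ ^ 2 := by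
        refine lintegral_congr_ae ?_
        filter_upwards [hg.integrable, hg.sq_integrable] with v h1 h2
        exact lintegral_diff_sq h1 h2 h
    _ = ∫⁻ ξ, ∫⁻ v, diffSymbol h ξ * ‖ft g ξ v‖ₑ ^ 2 := by
        rw [lintegral_lintegral_swap]
        exact ((hd.comp measurable_snd).mul (hm.comp measurable_swap)).aemeasurable
    _ = _ := by
        refine lintegral_congr fun ξ => ?_
        rw [ftNorm, lintegral_const_mul]
        exact hm.comp (f := fun v => (ξ, v)) (by fun_prop)

lemma lintegral_ftNorm {g : E3 × E3 → ℝ} (hg : IsSpaceRegular g) :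
    ∫⁻ ξ, ftNorm g ξ = wNorm 0 g := by
  have hm : Measurable fun q : E3 × E3 => ‖ft g q.1 q.2‖ₑ ^ 2 :=
    (measurable_ft hg.measurable).enorm.pow_const 2
  calc ∫⁻ ξ, ftNorm g ξ = ∫⁻ v, ∫⁻ ξ, ‖ft g ξ v‖ₑ ^ 2 := by
        simp only [ftNorm]
        rw [lintegral_lintegral_swap hm.aemeasurable]
    _ = ∫⁻ v, ∫⁻ x, ‖g (x, v)‖ₑ ^ 2 := by
        refine lintegral_congr_ae ?_
        filter_upwards [hg.integrable, hg.sq_integrable] with v h1 h2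
        have m2 : MemLp (fun x => (g (x, v) : ℂ)) 2 := by
          refine ⟨h1.ofReal.aestronglyMeasurable, ?_⟩
          rw [eLpNorm_lt_top_iff_lintegral_rpow_enorm_lt_top (by norm_num) (by norm_num)]
          simpa [← ofReal_norm, Complex.norm_real] using h2
        have h1' : Integrable fun x => (g (x, v) : ℂ) := h1.ofReal
        have e := lintegral_fourier_sq h1' m2
        refine (Eq.trans (lintegral_congr fun ξ => ?_) e).trans ?_
        · rw [ft_eq_fourier]
        refine lintegral_congr fun x => ?_
        rw [← ofReal_norm, Complex.norm_real, ofReal_norm]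
    _ = _ := by
        rw [wNorm_swap 0 hg.measurable]
        simp

/-- Functions supported in `Ω` with finite `L²` norm. -/
structure IsSupportedL2 (Ω : Set E3) (g : E3 × E3 → ℝ) : Prop where
  measurable : Measurable g
  support : ∀ x ∉ Ω, ∀ v, g (x, v) = 0
  finite : wNorm 0 g < ∞

lemma ae_lintegral_sq_lt_top {g : E3 × E3 → ℝ} (hg : Measurable g) (h : wNorm 0 g < ∞) :
    ∀ᵐ v, ∫⁻ x, ‖g (x, v)‖ₑ ^ 2 < ∞ := by
  rw [wNorm_swap 0 hg] at h
  simp only [mul_zero, pow_zero, one_mul] at h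
  refine ae_lt_top ?_ h.ne
  have : Measurable fun q : E3 × E3 => ‖g (q.2, q.1)‖ₑ ^ 2 :=
    (hg.comp measurable_swap).enorm.pow_const 2
  exact this.lintegral_prod_right'

lemma IsSupportedL2.lintegral_enorm_sq_le {Ω : Set E3} (hΩ : MeasurableSet Ω) {g : E3 × E3 → ℝ}
    (hg : IsSupportedL2 Ω g) (v : E3) :
    (∫⁻ x, ‖g (x, v)‖ₑ) ^ 2 ≤ volume Ω * ∫⁻ x, ‖g (x, v)‖ₑ ^ 2 := by
  have hgv : Measurable fun x => g (x, v) := hg.measurable.comp (f := fun x => (x, v)) (by fun_prop)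
  have e : ∀ x, ‖g (x, v)‖ₑ = Ω.indicator 1 x * ‖g (x, v)‖ₑ := by
    intro x
    by_cases hx : x ∈ Ω
    · simp [hx]
    · simp [hg.support x hx v]
  have h := lintegral_mul_sq_le (μ := (volume : Measure E3)) (f := Ω.indicator (1 : E3 → ℝ≥0∞))
    (measurable_one.indicator hΩ).aemeasurable hgv.enorm.aemeasurable
  have e2 : ∫⁻ x, (Ω.indicator (1 : E3 → ℝ≥0∞) x) ^ 2 = volume Ω := by
    rw [← lintegral_indicator_one hΩ]
    refine lintegral_congr fun x => ?_
    by_cases hx : x ∈ Ω <;> simp [hx]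
  rw [e2] at h
  rw [lintegral_congr e]
  exact h

lemma IsSupportedL2.isSpaceRegular {Ω : Set E3} (hΩ : MeasurableSet Ω) (hv : volume Ω < ∞)
    {g : E3 × E3 → ℝ} (hg : IsSupportedL2 Ω g) : IsSpaceRegular g := by
  refine ⟨hg.measurable, ?_, ae_lintegral_sq_lt_top hg.measurable hg.finite⟩
  filter_upwards [ae_lintegral_sq_lt_top hg.measurable hg.finite] with v hfin
  have hgv : Measurable fun x => g (x, v) := hg.measurable.comp (f := fun x => (x, v)) (by fun_prop)
  refine ⟨hgv.aestronglyMeasurable, ?_⟩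
  have := (hg.lintegral_enorm_sq_le hΩ v).trans_lt (ENNReal.mul_lt_top hv hfin)
  rw [hasFiniteIntegral_iff_enorm]
  by_contra hc
  rw [not_lt, top_le_iff] at hc
  rw [hc] at this
  simp at this

/-- The Fourier transform of `K S g`. -/
lemma ft_kerOp_transOp {Ω : Set E3} (hΩ : MeasurableSet Ω) (hv : volume Ω < ∞) {ν : E3 → ℝ}
    {ν₀ A : ℝ} (hν : IsFrequency ν ν₀) {k : E3 → E3 → ℝ} (hk : IsGradKernel k A)
    {g : E3 × E3 → ℝ} (hg : IsSupportedL2 Ω g) (v : E3) :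
    Integrable (fun x => kerOp k (transOp ν g) (x, v)) ∧
      ∀ ξ, ft (kerOp k (transOp ν g)) ξ v =
        ∫ w, (k v w : ℂ) * (transSymbol ν ξ w * ft g ξ w) := by
  have hb := measurable_gradBoundE
  have hreg := hg.isSpaceRegular hΩ hv
  have hL1 : Measurable fun w => ∫⁻ x, ‖g (x, w)‖ₑ := by
    have : Measurable fun q : E3 × E3 => ‖g (q.2, q.1)‖ₑ := (hg.measurable.comp measurable_swap).enorm
    exact this.lintegral_prod_right'
  have hL1fin : ∫⁻ w, (∫⁻ x, ‖g (x, w)‖ₑ) ^ 2 < ∞ := by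
    refine (lintegral_mono fun w => hg.lintegral_enorm_sq_le hΩ w).trans_lt ?_
    have hf := hg.finite
    rw [wNorm_swap 0 hg.measurable] at hf
    simp only [mul_zero, pow_zero, one_mul] at hf
    rw [lintegral_const_mul' _ _ hv.ne]
    exact ENNReal.mul_lt_top hv hf
  have hfin : ∫⁻ w, gradBoundE (v - w) * ∫⁻ x, ‖g (x, w)‖ₑ < ∞ := by
    have h1 := lintegral_mul_sq_le (μ := (volume : Measure E3)) (f := fun w => gradBoundE (v - w))
      (g := fun w => ∫⁻ x, ‖g (x, w)‖ₑ) (by fun_prop) hL1.aemeasurable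
    have h2 := lintegral_vw_gradBoundE_sq_lt_top 0
    simp only [pow_zero, one_mul] at h2
    rw [lintegral_sub_left_eq_self (fun z => gradBoundE z ^ 2) v] at h1
    have h3 := h1.trans_lt (ENNReal.mul_lt_top h2 hL1fin)
    by_contra hc
    rw [not_lt, top_le_iff] at hc
    rw [hc] at h3
    simp at h3
  have hfin' : ∫⁻ w, gradBoundE (v - w) * ∫⁻ x, ‖transOp ν g (x, w)‖ₑ < ∞ := by
    refine lt_of_le_of_lt (lintegral_mono fun w =>
      mul_le_mul_right (lintegral_transOp_le hν hg.measurable w) _) ?_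
    simp only [mul_left_comm (gradBoundE _)]
    rw [lintegral_const_mul' _ _ ENNReal.ofReal_ne_top]
    exact ENNReal.mul_lt_top ENNReal.ofReal_lt_top hfin
  obtain ⟨h1, h2⟩ := ft_kerOp hk (measurable_transOp hν.measurable hg.measurable) hfin'
  refine ⟨h1, fun ξ => ?_⟩
  rw [h2]
  refine integral_congr_ae (hreg.integrable.mono fun w hw => ?_)
  simp only
  rw [ft_transOp hν hg.measurable hw]

lemma isSpaceRegular_kerOp_transOp {Ω : Set E3} (hΩ : MeasurableSet Ω) (hv : volume Ω < ∞)
    {ν : E3 → ℝ} {ν₀ A : ℝ} (hν : IsFrequency ν ν₀) {k : E3 → E3 → ℝ} (hk : IsGradKernel k A)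
    {g : E3 × E3 → ℝ} (hg : IsSupportedL2 Ω g) : IsSpaceRegular (kerOp k (transOp ν g)) := by
  have ht := measurable_transOp hν.measurable hg.measurable
  have hm := measurable_kerOp hk.measurable ht
  refine ⟨hm, ae_of_all _ fun v => (ft_kerOp_transOp hΩ hv hν hk hg v).1,
    ae_lintegral_sq_lt_top hm ?_⟩
  obtain ⟨C, hC⟩ := wNorm_kerOp_le 0 hk
  refine (hC _ ht).trans_lt (ENNReal.mul_lt_top ENNReal.coe_lt_top ?_)
  have hf := hg.finite
  rw [wNorm_swap 0 hg.measurable] at hf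
  rw [wNorm_swap 0 ht]
  simp only [mul_zero, pow_zero, one_mul] at hf ⊢
  refine (lintegral_mono fun w => lintegral_transOp_sq_le hν hg.measurable w).trans_lt ?_
  rw [lintegral_const_mul' _ _ (ENNReal.pow_ne_top ENNReal.ofReal_ne_top)]
  exact ENNReal.mul_lt_top (ENNReal.pow_lt_top ENNReal.ofReal_lt_top) hf

/-- The averaging estimate on the Fourier side. -/
lemma ftNorm_kerOp_transOp_le {Ω : Set E3} (hΩ : MeasurableSet Ω) (hv : volume Ω < ∞)
    {ν : E3 → ℝ} {ν₀ A : ℝ} (hν : IsFrequency ν ν₀) {k : E3 → E3 → ℝ} (hk : IsGradKernel k A) :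
    ∃ C : ℝ≥0, ∀ g : E3 × E3 → ℝ, IsSupportedL2 Ω g → ∀ ξ,
      ftNorm (kerOp k (transOp ν g)) ξ ≤ C * ftNorm g ξ ∧
      (ξ ≠ 0 → ftNorm (kerOp k (transOp ν g)) ξ ≤ C * (ENNReal.ofReal ‖ξ‖⁻¹ * ftNorm g ξ)) := by
  obtain ⟨C, hC⟩ := lintegral_gradBound_transSymbol_le hν
  have hL := lintegral_vw_gradBoundE_lt_top 0
  simp only [pow_zero, one_mul] at hL
  have hb := measurable_gradBoundE
  set L := ∫⁻ z, gradBoundE z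
  set C' : ℝ≥0 := C + (ENNReal.ofReal (ν₀ ^ 2)⁻¹ * L).toNNReal
  have hLC : ENNReal.ofReal (ν₀ ^ 2)⁻¹ * L ≤ C' := by
    rw [ENNReal.coe_add, ENNReal.coe_toNNReal (ENNReal.mul_lt_top ENNReal.ofReal_lt_top hL).ne]
    exact le_add_self
  have hCC : (C : ℝ≥0∞) ≤ C' := by rw [ENNReal.coe_add]; exact le_self_add
  have hAL : ENNReal.ofReal A ^ 2 * L < ∞ :=
    ENNReal.mul_lt_top (ENNReal.pow_lt_top ENNReal.ofReal_lt_top) hL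
  refine ⟨(ENNReal.ofReal A ^ 2 * L).toNNReal * C', fun g hg ξ => ?_⟩
  rw [ENNReal.coe_mul, ENNReal.coe_toNNReal hAL.ne]
  have hsm : Measurable (transSymbol ν ξ) :=
    (measurable_transSymbol hν.measurable).of_uncurry_left
  have hgm : Measurable (ft g ξ) := (measurable_ft hg.measurable).of_uncurry_left
  have e : ftNorm (kerOp k (transOp ν g)) ξ =
      ∫⁻ v, ‖∫ w, (k v w : ℂ) * (transSymbol ν ξ w * ft g ξ w)‖ₑ ^ 2 :=
    lintegral_congr fun v => by rw [(ft_kerOp_transOp hΩ hv hν hk hg v).2 ξ]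
  rw [e]
  -- The first bound uses only |symbol|² ≤ ν₀⁻² and serves large translations; the second uses the
  -- averaging decay in |ξ|.
  refine ⟨lintegral_kernel_mul_sq_le hk hsm hgm fun v => le_trans ?_ hLC, fun hξ => ?_⟩
  · simp only [L]
    rw [← lintegral_sub_left_eq_self gradBoundE v, ← lintegral_const_mul _ (by fun_prop)]
    refine lintegral_mono fun w => ?_
    rw [mul_comm]
    refine mul_le_mul_left ((enorm_transSymbol_sq_le hν ξ w).trans
      (ENNReal.ofReal_le_ofReal ?_)) _
    have := hν.pos
    exact inv_anti₀ (by positivity) (le_add_of_nonneg_right (sq_nonneg _))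
  · refine (lintegral_kernel_mul_sq_le hk hsm hgm fun v => (hC ξ hξ v).trans
      (mul_le_mul_left hCC _)).trans (le_of_eq ?_)
    rw [ftNorm]; ring

/-- Velocity averaging: `K S` maps `L²` to functions with half a derivative in space. -/
lemma diffNorm_kerOp_transOp_le {Ω : Set E3} (hΩ : MeasurableSet Ω) (hv : volume Ω < ∞)
    {ν : E3 → ℝ} {ν₀ A : ℝ} (hν : IsFrequency ν ν₀) {k : E3 → E3 → ℝ} (hk : IsGradKernel k A) :
    ∃ C : ℝ≥0, ∀ g : E3 × E3 → ℝ, IsSupportedL2 Ω g → ∀ h,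
      diffNorm h (kerOp k (transOp ν g)) ≤ C * wNorm 0 g ∧
      diffNorm h (kerOp k (transOp ν g)) ≤ C * (ENNReal.ofReal ‖h‖ * wNorm 0 g) := by
  obtain ⟨C, hC⟩ := ftNorm_kerOp_transOp_le hΩ hv hν hk
  refine ⟨(4 * Real.pi).toNNReal * C, fun g hg h => ?_⟩
  rw [diffNorm_eq (isSpaceRegular_kerOp_transOp hΩ hv hν hk hg),
    ← lintegral_ftNorm (hg.isSpaceRegular hΩ hv), ENNReal.coe_mul]
  have hpi : ((4 * Real.pi).toNNReal : ℝ≥0∞) = ENNReal.ofReal (4 * Real.pi) := rfl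
  rw [hpi, ← lintegral_const_mul' _ _ (ENNReal.mul_ne_top ENNReal.ofReal_ne_top
    ENNReal.coe_ne_top), ← lintegral_const_mul' _ _ ENNReal.ofReal_ne_top,
    ← lintegral_const_mul' _ _ (ENNReal.mul_ne_top ENNReal.ofReal_ne_top ENNReal.coe_ne_top)]
  constructor
  · refine lintegral_mono fun ξ => ?_
    rw [mul_assoc]
    refine mul_le_mul' ((diffSymbol_le_four h ξ).trans ?_) (hC g hg ξ).1
    rw [show (4 : ℝ≥0∞) = ENNReal.ofReal 4 by norm_num]
    exact ENNReal.ofReal_le_ofReal (by linarith [Real.pi_gt_three])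
  · refine lintegral_mono_ae (ae_ne_zero.mono fun ξ hξ => ?_)
    calc _ ≤ diffSymbol h ξ * (C * (ENNReal.ofReal ‖ξ‖⁻¹ * ftNorm g ξ)) :=
          mul_le_mul_right ((hC g hg ξ).2 hξ) _
      _ = (diffSymbol h ξ * ENNReal.ofReal ‖ξ‖⁻¹) * (C * ftNorm g ξ) := by ring
      _ ≤ ENNReal.ofReal (4 * Real.pi * ‖h‖) * (C * ftNorm g ξ) :=
          mul_le_mul_left (diffSymbol_mul_inv_le h ξ hξ) _
      _ = _ := by rw [ENNReal.ofReal_mul (by positivity)]; ring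

/-! ### Slobodeckij norms on the whole space -/

/-- The squared Slobodeckij seminorm on the whole space, with kernel `|h|^{-p}`. -/
def slobNorm (p : ℝ) (g : E3 × E3 → ℝ) : ℝ≥0∞ := ∫⁻ h, powWeight p h * diffNorm h g

/-- The symbol of the squared Slobodeckij seminorm. -/
def diffIntegral (p : ℝ) (ξ : E3) : ℝ≥0∞ := ∫⁻ h, powWeight p h * diffSymbol h ξ

lemma slobNorm_eq {g : E3 × E3 → ℝ} (hg : IsSpaceRegular g) (p : ℝ) :
    slobNorm p g = ∫⁻ ξ, diffIntegral p ξ * ftNorm g ξ := by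
  have hd := measurable_diffSymbol
  have hf := measurable_ftNorm hg.measurable
  have hp := measurable_powWeight p
  have hdx : ∀ ξ, Measurable fun h => diffSymbol h ξ := fun ξ =>
    hd.comp (f := fun h => (h, ξ)) (by fun_prop)
  calc slobNorm p g = ∫⁻ h, ∫⁻ ξ, powWeight p h * (diffSymbol h ξ * ftNorm g ξ) := by
        refine lintegral_congr fun h => ?_
        rw [diffNorm_eq hg]
        exact (lintegral_const_mul' _ _ ENNReal.ofReal_ne_top).symm
    _ = ∫⁻ ξ, ∫⁻ h, powWeight p h * (diffSymbol h ξ * ftNorm g ξ) := by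
        rw [lintegral_lintegral_swap]
        exact ((hp.comp measurable_fst).mul (hd.mul (hf.comp measurable_snd))).aemeasurable
    _ = _ := by
        refine lintegral_congr fun ξ => ?_
        have := hdx ξ
        rw [diffIntegral, ← lintegral_mul_const _ (by fun_prop)]
        exact lintegral_congr fun h => by ring

/-- Scaling u = |ξ|h gives the power of |ξ|. The majorant min(4, (2π|u|)²)|u|^(-q) is integrable
near 0 because q < 5 and at infinity because q > 3. -/
lemma diffIntegral_le {q : ℝ} (hq : 3 < q) (hq5 : q < 5) : ∃ C : ℝ≥0, ∀ ξ : E3, ξ ≠ 0 →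
    diffIntegral q ξ ≤ C * ENNReal.ofReal (‖ξ‖ ^ (q - 3)) := by
  have hpw := measurable_powWeight
  set H : E3 → ℝ≥0∞ := fun u => (Metric.ball (0 : E3) 1).indicator
      (fun u => ENNReal.ofReal ((2 * Real.pi) ^ 2) * powWeight (q - 2) u) u +
    (Metric.ball (0 : E3) 1)ᶜ.indicator (fun u => 4 * powWeight q u) u
  have hH1 : Measurable ((Metric.ball (0 : E3) 1).indicator
      (fun u => ENNReal.ofReal ((2 * Real.pi) ^ 2) * powWeight (q - 2) u)) :=
    ((hpw _).const_mul _).indicator measurableSet_ball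
  have hHm : Measurable H :=
    hH1.add (((hpw q).const_mul _).indicator measurableSet_ball.compl)
  have hH : ∫⁻ u, H u < ∞ := by
    simp only [H]
    rw [lintegral_add_left hH1, lintegral_indicator measurableSet_ball,
      lintegral_indicator measurableSet_ball.compl, lintegral_const_mul _ (hpw _),
      lintegral_const_mul _ (hpw _)]
    exact ENNReal.add_lt_top.2 ⟨ENNReal.mul_lt_top ENNReal.ofReal_lt_top
      (lintegral_powWeight_ball_lt_top (by linarith)), ENNReal.mul_lt_top (by norm_num)
      (lintegral_powWeight_compl_ball_lt_top hq)⟩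
  refine ⟨(∫⁻ u, H u).toNNReal, fun ξ hξ => ?_⟩
  rw [ENNReal.coe_toNNReal hH.ne]
  have hx : 0 < ‖ξ‖ := norm_pos_iff.2 hξ
  have key : ∀ h : E3, h ≠ 0 → powWeight q h * diffSymbol h ξ ≤
      ENNReal.ofReal (‖ξ‖ ^ q) * H (‖ξ‖ • h) := by
    intro h hh
    have hh' : 0 < ‖h‖ := norm_pos_iff.2 hh
    have e : ∀ r : ℝ, powWeight r (‖ξ‖ • h) = ENNReal.ofReal (‖ξ‖ ^ (-r) * ‖h‖ ^ (-r)) := fun r => by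
      rw [powWeight, norm_smul, norm_norm, Real.mul_rpow hx.le hh'.le]
    simp only [H]
    by_cases hu : ‖ξ‖ • h ∈ Metric.ball (0 : E3) 1
    · rw [indicator_of_mem hu, indicator_of_notMem (by simpa using hu), add_zero, e]
      refine (mul_le_mul_right (diffSymbol_le_sq h ξ) _).trans (le_of_eq ?_)
      rw [powWeight, ← ENNReal.ofReal_mul (by positivity), ← ENNReal.ofReal_mul (by positivity),
        ← ENNReal.ofReal_mul (by positivity)]
      congr 1
      have e1 : ‖ξ‖ ^ q * ‖ξ‖ ^ (-(q - 2)) = ‖ξ‖ ^ 2 := by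
        rw [← Real.rpow_add hx, ← Real.rpow_natCast]; congr 1; push_cast; ring
      have e2 : ‖h‖ ^ (-(q - 2)) = ‖h‖ ^ (-q) * ‖h‖ ^ 2 := by
        rw [← Real.rpow_natCast ‖h‖ 2, ← Real.rpow_add hh']; congr 1; push_cast; ring
      calc _ = (2 * Real.pi) ^ 2 * ‖ξ‖ ^ 2 * (‖h‖ ^ (-q) * ‖h‖ ^ 2) := by ring
        _ = _ := by rw [← e1, ← e2]; ring
    · rw [indicator_of_notMem hu, indicator_of_mem (by exact hu), zero_add, e]
      refine (mul_le_mul_right (diffSymbol_le_four h ξ) _).trans (le_of_eq ?_)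
      rw [show (4 : ℝ≥0∞) = ENNReal.ofReal 4 by norm_num, powWeight,
        ← ENNReal.ofReal_mul (by positivity), ← ENNReal.ofReal_mul (by positivity),
        ← ENNReal.ofReal_mul (by positivity)]
      congr 1
      have e1 : ‖ξ‖ ^ q * ‖ξ‖ ^ (-q) = 1 := by rw [← Real.rpow_add hx]; simp
      calc _ = 4 * 1 * ‖h‖ ^ (-q) := by ring
        _ = _ := by rw [← e1]; ring
  calc diffIntegral q ξ ≤ ∫⁻ h, ENNReal.ofReal (‖ξ‖ ^ q) * H (‖ξ‖ • h) :=
        lintegral_mono_ae (ae_ne_zero.mono key)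
    _ = ENNReal.ofReal (‖ξ‖ ^ q) * (ENNReal.ofReal (‖ξ‖ ^ (-3 : ℝ)) * ∫⁻ u, H u) := by
        rw [lintegral_const_mul' _ _ ENNReal.ofReal_ne_top, lintegral_comp_smul hx hHm]
    _ = _ := by
        rw [← mul_assoc, ← ENNReal.ofReal_mul (by positivity), ← Real.rpow_add hx, mul_comm]
        rfl

/-- The converse bound, needed to return from the Fourier weight to the seminorm of the input. On a
ball of radius comparable to 1/|ξ| where h·ξ is near 1/2, the symbol is at least 1 and |h| ≤ 1/|ξ|.
-/
lemma le_diffIntegral {p : ℝ} (hp : 0 ≤ p) : ∃ C : ℝ≥0, ∀ ξ : E3, ξ ≠ 0 →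
    ENNReal.ofReal (‖ξ‖ ^ (p - 3)) ≤ C * diffIntegral p ξ := by
  set V := volume (Metric.ball (0 : E3) 1)
  have hV0 : V ≠ 0 := (Metric.measure_ball_pos _ _ one_pos).ne'
  have hVt : V ≠ ∞ := measure_ball_lt_top.ne
  set c := ENNReal.ofReal ((1 / 8) ^ 3) * V
  have hc0 : c ≠ 0 := mul_ne_zero (by norm_num) hV0
  have hct : c ≠ ∞ := ENNReal.mul_ne_top ENNReal.ofReal_ne_top hVt
  refine ⟨(c⁻¹).toNNReal, fun ξ hξ => ?_⟩
  rw [ENNReal.coe_toNNReal (ENNReal.inv_ne_top.2 hc0)]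
  have hx : 0 < ‖ξ‖ := norm_pos_iff.2 hξ
  -- The centre satisfies h₀·ξ = 1/2 exactly. The radius 1/(8|ξ|) keeps h·ξ within 1/8 of it, so π
  -- h·ξ stays within π/8 of π/2 and its sine exceeds 1/2.
  set h₀ : E3 := (2 * ‖ξ‖ ^ 2)⁻¹ • ξ
  set ρ : ℝ := 1 / 8 * ‖ξ‖⁻¹
  have hρ : 0 < ρ := by positivity
  have hh₀ : ⟪h₀, ξ⟫ = 1 / 2 := by
    simp only [h₀]
    rw [real_inner_smul_left, real_inner_self_eq_norm_sq]; field_simp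
  have hnh₀ : ‖h₀‖ = 1 / 2 * ‖ξ‖⁻¹ := by
    simp only [h₀]
    rw [norm_smul, Real.norm_of_nonneg (by positivity)]; field_simp
  have key : ∀ h ∈ Metric.ball h₀ ρ,
      ENNReal.ofReal (‖ξ‖ ^ p) ≤ powWeight p h * diffSymbol h ξ := by
    intro h hh
    rw [Metric.mem_ball, dist_eq_norm] at hh
    have hin : |⟪h, ξ⟫ - 1 / 2| ≤ 1 / 8 := by
      rw [← hh₀, ← inner_sub_left]
      refine (abs_real_inner_le_norm _ _).trans ?_
      calc ‖h - h₀‖ * ‖ξ‖ ≤ ρ * ‖ξ‖ := by gcongr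
        _ = 1 / 8 := by simp only [ρ]; field_simp
    have hin' := abs_le.1 hin
    have hle : ‖h‖ ≤ ‖ξ‖⁻¹ := by
      calc ‖h‖ ≤ ‖h - h₀‖ + ‖h₀‖ := by simpa using norm_add_le (h - h₀) h₀
        _ ≤ ρ + 1 / 2 * ‖ξ‖⁻¹ := by rw [hnh₀]; gcongr
        _ ≤ _ := by simp only [ρ]; nlinarith [inv_pos.2 hx]
    have hh0 : h ≠ 0 := by
      rintro rfl
      simp at hin'
      linarith [hin'.1]
    have h1 : ENNReal.ofReal (‖ξ‖ ^ p) ≤ powWeight p h := by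
      refine ENNReal.ofReal_le_ofReal ?_
      rw [Real.rpow_neg (norm_nonneg h), ← Real.inv_rpow (norm_nonneg h)]
      refine Real.rpow_le_rpow hx.le ?_ hp
      rw [← inv_inv ‖ξ‖]
      exact inv_anti₀ (norm_pos_iff.2 hh0) hle
    have h2 : 1 ≤ diffSymbol h ξ := by
      refine one_le_pow₀ ?_
      rw [← ofReal_norm, ENNReal.one_le_ofReal, Complex.norm_exp_I_mul_ofReal_sub_one,
        norm_mul, Real.norm_of_nonneg (by norm_num : (0 : ℝ) ≤ 2),
        show 2 * Real.pi * ⟪h, ξ⟫ / 2 = Real.pi * ⟪h, ξ⟫ by ring]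
      have hs : 1 / 2 ≤ Real.sin (Real.pi * ⟪h, ξ⟫) := by
        have hpi := Real.pi_pos
        rw [← Real.cos_pi_div_two_sub, ← Real.cos_abs, ← Real.cos_pi_div_three]
        refine Real.cos_le_cos_of_nonneg_of_le_pi (abs_nonneg _) (by linarith) ?_
        rw [abs_le]
        constructor <;> nlinarith
      calc (1 : ℝ) = 2 * (1 / 2) := by norm_num
        _ ≤ 2 * Real.sin (Real.pi * ⟪h, ξ⟫) := by gcongr
        _ ≤ _ := by gcongr; exact Real.le_norm_self _
    calc _ = ENNReal.ofReal (‖ξ‖ ^ p) * 1 := (mul_one _).symm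
      _ ≤ _ := mul_le_mul' h1 h2
  have hball : volume (Metric.ball h₀ ρ) = ENNReal.ofReal (‖ξ‖ ^ (-3 : ℝ)) * c := by
    rw [Measure.addHaar_ball _ _ hρ.le, finrank_euclideanSpace_fin, ← mul_assoc,
      ← ENNReal.ofReal_mul (by positivity)]
    congr 2
    simp only [ρ]
    rw [mul_pow, Real.rpow_neg hx.le, mul_comm]
    norm_cast
    rw [inv_pow]
  calc ENNReal.ofReal (‖ξ‖ ^ (p - 3))
      = c⁻¹ * (ENNReal.ofReal (‖ξ‖ ^ p) * volume (Metric.ball h₀ ρ)) := by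
        rw [hball, ← mul_assoc (ENNReal.ofReal _), ← ENNReal.ofReal_mul (by positivity),
          ← Real.rpow_add hx, mul_comm, mul_assoc, ENNReal.mul_inv_cancel hc0 hct, mul_one]
        rfl
    _ = c⁻¹ * ∫⁻ _ in Metric.ball h₀ ρ, ENNReal.ofReal (‖ξ‖ ^ p) := by rw [setLIntegral_const]
    _ ≤ c⁻¹ * ∫⁻ h in Metric.ball h₀ ρ, powWeight p h * diffSymbol h ξ :=
        mul_le_mul_right (setLIntegral_mono' measurableSet_ball key) _
    _ ≤ _ := mul_le_mul_right (setLIntegral_le_lintegral _ _) _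

/-- `K S` gains half a derivative in space. -/
lemma slobNorm_kerOp_transOp_le {Ω : Set E3} (hΩ : MeasurableSet Ω) (hv : volume Ω < ∞)
    {ν : E3 → ℝ} {ν₀ A : ℝ} (hν : IsFrequency ν ν₀) {k : E3 → E3 → ℝ} (hk : IsGradKernel k A)
    {p : ℝ} (hp : 3 < p) (hp4 : p < 4) :
    ∃ C : ℝ≥0, ∀ g : E3 × E3 → ℝ, IsSupportedL2 Ω g →
      slobNorm (p + 1) (kerOp k (transOp ν g)) ≤ C * slobNorm p g := by
  obtain ⟨C₁, hC₁⟩ := ftNorm_kerOp_transOp_le hΩ hv hν hk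
  obtain ⟨C₂, hC₂⟩ := diffIntegral_le (q := p + 1) (by linarith) (by linarith)
  obtain ⟨C₃, hC₃⟩ := le_diffIntegral (p := p) (by linarith)
  refine ⟨C₁ * C₂ * C₃, fun g hg => ?_⟩
  rw [slobNorm_eq (isSpaceRegular_kerOp_transOp hΩ hv hν hk hg),
    slobNorm_eq (hg.isSpaceRegular hΩ hv), ← lintegral_const_mul' _ _ ENNReal.coe_ne_top]
  refine lintegral_mono_ae (ae_ne_zero.mono fun ξ hξ => ?_)
  have hx : 0 < ‖ξ‖ := norm_pos_iff.2 hξ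
  -- The upper symbol bound at p + 1, the averaging factor |ξ|⁻¹ and the lower symbol bound at p
  -- combine frequency by frequency.
  calc _ ≤ (C₂ * ENNReal.ofReal (‖ξ‖ ^ (p + 1 - 3))) *
        (C₁ * (ENNReal.ofReal ‖ξ‖⁻¹ * ftNorm g ξ)) := mul_le_mul' (hC₂ ξ hξ) ((hC₁ g hg ξ).2 hξ)
    _ = C₁ * C₂ * (ENNReal.ofReal (‖ξ‖ ^ (p + 1 - 3)) * ENNReal.ofReal ‖ξ‖⁻¹) * ftNorm g ξ := by
        ring
    _ = C₁ * C₂ * ENNReal.ofReal (‖ξ‖ ^ (p - 3)) * ftNorm g ξ := by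
        rw [← ENNReal.ofReal_mul (by positivity)]
        congr 3
        rw [← Real.rpow_neg_one, ← Real.rpow_add hx]
        congr 1; ring
    _ ≤ C₁ * C₂ * (C₃ * diffIntegral p ξ) * ftNorm g ξ := by gcongr; exact hC₃ ξ hξ
    _ = _ := by push_cast; ring

/-- `K S` maps `L²` functions supported in `Ω` to functions with almost half a derivative. -/
lemma slobNorm_kerOp_transOp_le_wNorm {Ω : Set E3} (hΩ : MeasurableSet Ω) (hv : volume Ω < ∞)
    {ν : E3 → ℝ} {ν₀ A : ℝ} (hν : IsFrequency ν ν₀) {k : E3 → E3 → ℝ} (hk : IsGradKernel k A)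
    {p : ℝ} (hp : 3 < p) (hp4 : p < 4) :
    ∃ C : ℝ≥0, ∀ g : E3 × E3 → ℝ, IsSupportedL2 Ω g →
      slobNorm p (kerOp k (transOp ν g)) ≤ C * wNorm 0 g := by
  obtain ⟨C, hC⟩ := diffNorm_kerOp_transOp_le hΩ hv hν hk
  have hpw := measurable_powWeight
  -- Near 0 the averaging gain |h| leaves the exponent p - 1 < 3; far away the trivial bound is
  -- enough because p > 3.
  set J := (∫⁻ h in Metric.ball (0 : E3) 1, powWeight (p - 1) h) +
    ∫⁻ h in (Metric.ball (0 : E3) 1)ᶜ, powWeight p h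
  have hJ : J < ∞ := ENNReal.add_lt_top.2 ⟨lintegral_powWeight_ball_lt_top (by linarith),
    lintegral_powWeight_compl_ball_lt_top hp⟩
  refine ⟨J.toNNReal * C, fun g hg => ?_⟩
  rw [ENNReal.coe_mul, ENNReal.coe_toNNReal hJ.ne, slobNorm,
    ← lintegral_add_compl _ (measurableSet_ball (x := (0 : E3)) (ε := 1)), mul_assoc, add_mul,
    ← lintegral_mul_const _ (hpw _), ← lintegral_mul_const _ (hpw _)]
  refine add_le_add ?_ (lintegral_mono fun h => mul_le_mul_right (hC g hg h).1 _)
  refine lintegral_mono_ae (ae_restrict_of_ae (ae_ne_zero.mono fun h hh => ?_))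
  refine (mul_le_mul_right (hC g hg h).2 _).trans (le_of_eq ?_)
  rw [← powWeight_mul hh, Real.rpow_one]; ring

/-! ### Cutting off at the boundary -/

lemma add_three_sq_le (a b c : ℝ≥0∞) : (a + b + c) ^ 2 ≤ 3 * (a ^ 2 + b ^ 2 + c ^ 2) := by
  rcases eq_or_ne a ∞ with rfl | ha
  · simp
  rcases eq_or_ne b ∞ with rfl | hb
  · simp
  rcases eq_or_ne c ∞ with rfl | hc
  · simp
  lift a to ℝ≥0 using ha
  lift b to ℝ≥0 using hb
  lift c to ℝ≥0 using hc
  norm_cast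
  rw [← NNReal.coe_le_coe]
  push_cast
  nlinarith [sq_nonneg ((a : ℝ) - b), sq_nonneg ((a : ℝ) - c), sq_nonneg ((b : ℝ) - c)]

/-- The difference of a function cut off at the boundary. -/
lemma enorm_cut_sub_le (Ω : Set E3) (a : E3 × E3 → ℝ) (z h v : E3) :
    ‖cut Ω a (z + h, v) - cut Ω a (z, v)‖ₑ ≤ ‖a (z + h, v) - a (z, v)‖ₑ +
      (exitSet Ω h).indicator (fun z => ‖cut Ω a (z, v)‖ₑ) z +
      (exitSet Ω (-h)).indicator (fun z => ‖cut Ω a (z, v)‖ₑ) (z + h) := by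
  by_cases h1 : z ∈ Ω <;> by_cases h2 : z + h ∈ Ω
  · rw [cut_of_mem h1, cut_of_mem h2, add_assoc]; exact le_self_add
  · have e1 : z ∈ exitSet Ω h := ⟨h1, h2⟩
    rw [cut_of_notMem h2, indicator_of_mem e1, zero_sub, enorm_neg]
    exact le_add_right le_add_self
  · have e1 : z + h ∈ exitSet Ω (-h) := ⟨h2, by simpa using h1⟩
    rw [cut_of_notMem h1, indicator_of_mem e1, sub_zero]
    exact le_add_self
  · rw [cut_of_notMem h1, cut_of_notMem h2, sub_zero, enorm_zero]; exact zero_le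

lemma measurable_velocity_slice {g : E3 × E3 → ℝ} (hg : Measurable g) (v : E3) :
    Measurable fun x => ‖g (x, v)‖ₑ := (hg.comp (f := fun x => (x, v)) (by fun_prop)).enorm

lemma lintegral_velNorm_zero {N : Set E3} {g : E3 × E3 → ℝ} (hg : Measurable g) :
    ∫⁻ v, ∫⁻ x in N, ‖g (x, v)‖ₑ ^ 2 = ∫⁻ x in N, velNorm 0 g x := by
  simp only [velNorm, mul_zero, pow_zero, one_mul]
  rw [lintegral_lintegral_swap]
  exact ((hg.comp measurable_swap).enorm.pow_const 2).aemeasurable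

/-- A difference of the cut-off function is a difference of a when both points lie in Ω. Otherwise
only the value at the point inside remains, and that point exits under h or, after a shift of
variable, under -h. -/
lemma diffNorm_cut_le {Ω : Set E3} (hΩ : MeasurableSet Ω) {a : E3 × E3 → ℝ} (ha : Measurable a)
    (h : E3) : diffNorm h (cut Ω a) ≤ 3 * (diffNorm h a + (∫⁻ x in exitSet Ω h, velNorm 0 a x) +
      ∫⁻ x in exitSet Ω (-h), velNorm 0 a x) := by
  have hN := measurableSet_exitSet hΩ h
  have hN' := measurableSet_exitSet hΩ (-h)
  have hsl := measurable_velocity_slice ha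
  have hm : Measurable fun v => ∫⁻ x, ‖a (x + h, v) - a (x, v)‖ₑ ^ 2 := by
    have : Measurable fun q : E3 × E3 => ‖a (q.2 + h, q.1) - a (q.2, q.1)‖ₑ ^ 2 := by fun_prop
    exact this.lintegral_prod_right'
  have hm' : ∀ N : Set E3, Measurable fun v => ∫⁻ x in N, ‖a (x, v)‖ₑ ^ 2 := fun N => by
    have : Measurable fun q : E3 × E3 => ‖a (q.2, q.1)‖ₑ ^ 2 := by fun_prop
    exact this.lintegral_prod_right'
  have hi : ∀ N : Set E3, ∀ v z, (N.indicator (fun z => ‖cut Ω a (z, v)‖ₑ) z) ^ 2 ≤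
      N.indicator (fun z => ‖a (z, v)‖ₑ ^ 2) z := by
    intro N v z
    by_cases hz : z ∈ N
    · rw [indicator_of_mem hz, indicator_of_mem hz]
      exact pow_le_pow_left' (enorm_cut_le _ _ _) 2
    · simp [hz]
  rw [← lintegral_velNorm_zero ha, ← lintegral_velNorm_zero ha, diffNorm, diffNorm,
    ← lintegral_add_left hm, ← lintegral_add_right _ (hm' _),
    ← lintegral_const_mul' _ _ (by norm_num)]
  refine lintegral_mono fun v => ?_
  have hd : Measurable fun x => ‖a (x + h, v) - a (x, v)‖ₑ ^ 2 := by
    have h1 : Measurable fun x => a (x, v) := ha.comp (f := fun x => (x, v)) (by fun_prop)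
    have h2 : Measurable fun x => a (x + h, v) := ha.comp (f := fun x => (x + h, v)) (by fun_prop)
    fun_prop
  have hs := hsl v
  calc _ ≤ ∫⁻ x, 3 * (‖a (x + h, v) - a (x, v)‖ₑ ^ 2 +
        (exitSet Ω h).indicator (fun z => ‖a (z, v)‖ₑ ^ 2) x +
        (exitSet Ω (-h)).indicator (fun z => ‖a (z, v)‖ₑ ^ 2) (x + h)) := by
        refine lintegral_mono fun x => ?_
        refine (pow_le_pow_left' (enorm_cut_sub_le Ω a x h v) 2).trans
          ((add_three_sq_le _ _ _).trans ?_)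
        gcongr
        · exact hi _ v x
        · exact hi _ v (x + h)
    _ = _ := by
        have hd2 : Measurable fun x => ‖a (x + h, v) - a (x, v)‖ₑ ^ 2 +
            (exitSet Ω h).indicator (fun z => ‖a (z, v)‖ₑ ^ 2) x :=
          hd.add ((hs.pow_const 2).indicator hN)
        rw [lintegral_const_mul' _ _ (by norm_num), lintegral_add_left hd2,
          lintegral_add_left hd,
          lintegral_add_right_eq_self
            (fun x => (exitSet Ω (-h)).indicator (fun z => ‖a (z, v)‖ₑ ^ 2) x) h,
          lintegral_indicator hN, lintegral_indicator hN']

lemma lintegral_powWeight_exitSet_neg (Ω : Set E3) (p : ℝ) (G : E3 → ℝ≥0∞) :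
    ∫⁻ h, powWeight p h * ∫⁻ y in exitSet Ω (-h), G y =
      ∫⁻ h, powWeight p h * ∫⁻ y in exitSet Ω h, G y := by
  rw [← lintegral_neg_eq_self]
  refine lintegral_congr fun h => ?_
  rw [neg_neg, powWeight, norm_neg, powWeight]

lemma measurable_lintegral_exitSet {Ω : Set E3} (hΩ : MeasurableSet Ω) {G : E3 → ℝ≥0∞}
    (hG : Measurable G) : Measurable fun h => ∫⁻ y in exitSet Ω h, G y := by
  have hi : Measurable (Ω.indicator G) := hG.indicator hΩ
  have hc : Measurable (Ωᶜ.indicator (1 : E3 → ℝ≥0∞)) := measurable_one.indicator hΩ.compl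
  have : Measurable fun q : E3 × E3 => Ω.indicator G q.2 * Ωᶜ.indicator 1 (q.2 + q.1) := by
    fun_prop
  refine (congrArg Measurable (funext fun h => ?_)).mp
    (this.lintegral_prod_right' (ν := (volume : Measure E3)))
  rw [← lintegral_indicator (measurableSet_exitSet hΩ h)]
  refine lintegral_congr fun y => ?_
  by_cases h1 : y ∈ Ω <;> by_cases h2 : y + h ∈ Ω <;> simp [exitSet, h1, h2]

/-- Integrating the exit-set terms against |h|^(-p) produces the boundary weight by Tonelli. The two
signs of h contribute equally, hence the factor 2. -/
lemma slobNorm_cut_le {Ω : Set E3} (hΩ : MeasurableSet Ω) {a : E3 × E3 → ℝ} (ha : Measurable a)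
    (p : ℝ) : slobNorm p (cut Ω a) ≤
      3 * (slobNorm p a + 2 * ∫⁻ x in Ω, bdryWeight Ω p x * velNorm 0 a x) := by
  have hm := measurable_velNorm 0 ha
  have hpw := measurable_powWeight p
  have hE := measurable_lintegral_exitSet hΩ hm
  have hE' : Measurable fun h => ∫⁻ y in exitSet Ω (-h), velNorm 0 a y := hE.comp measurable_neg
  rw [two_mul, lintegral_bdryWeight_mul hΩ p hm]
  nth_rewrite 2 [← lintegral_powWeight_exitSet_neg]
  rw [slobNorm, slobNorm, ← lintegral_add_left (by fun_prop), ← lintegral_add_right _ (by fun_prop),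
    ← lintegral_const_mul' _ _ (by norm_num)]
  refine lintegral_mono fun h => ?_
  refine (mul_le_mul_right (diffNorm_cut_le hΩ ha h) _).trans (le_of_eq ?_)
  ring

/-! ### The last transport step -/

/-- Integrating damped rays that start in a bounded set. -/
lemma vw_mul_lintegral_ray_le {Ω : Set E3} (hΩ : MeasurableSet Ω) {D ν₀ : ℝ} (hν₀ : 0 < ν₀)
    (hD : ∀ x ∈ Ω, ∀ y ∈ Ω, ‖x - y‖ ≤ D) {G : E3 → ℝ≥0∞} (hG : Measurable G)
    (hGs : ∀ z ∉ Ω, G z = 0) (v : E3) :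
    vw v * ∫⁻ x in Ω, ∫⁻ s in Ioi (0 : ℝ), ENNReal.ofReal (Real.exp (-(ν₀ * s))) *
      G (x - s • v) ≤ ENNReal.ofReal (2 / ν₀ + 2 * D) * ∫⁻ z, G z := by
  have hi : Measurable (Ω.indicator (1 : E3 → ℝ≥0∞)) := measurable_one.indicator hΩ
  have hGm : Measurable fun q : E3 × ℝ => G (q.1 - q.2 • v) :=
    hG.comp (f := fun q : E3 × ℝ => q.1 - q.2 • v) (by fun_prop)
  have hj : Measurable fun q : ℝ × E3 => Ω.indicator (1 : E3 → ℝ≥0∞) (q.2 + q.1 • v) :=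
    hi.comp (by fun_prop : Measurable fun q : ℝ × E3 => q.2 + q.1 • v)
  calc _ = vw v * ∫⁻ s in Ioi (0 : ℝ), ∫⁻ x in Ω, ENNReal.ofReal (Real.exp (-(ν₀ * s))) *
      G (x - s • v) := by
        rw [lintegral_lintegral_swap]
        exact Measurable.aemeasurable (by fun_prop)
    _ = vw v * ∫⁻ s in Ioi (0 : ℝ), ∫⁻ z, ENNReal.ofReal (Real.exp (-(ν₀ * s))) *
        Ω.indicator 1 (z + s • v) * G z := by
        congr 1
        refine lintegral_congr fun s => ?_
        rw [← lintegral_indicator hΩ, ← lintegral_add_right_eq_self _ (s • v)]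
        refine lintegral_congr fun z => ?_
        by_cases hz : z + s • v ∈ Ω <;> simp [hz]
    _ = ∫⁻ z, (vw v * ∫⁻ s in Ioi (0 : ℝ), ENNReal.ofReal (Real.exp (-(ν₀ * s))) *
        Ω.indicator 1 (z + s • v)) * G z := by
        rw [lintegral_lintegral_swap, ← lintegral_const_mul' _ _ (vw_ne_top v)]
        · refine lintegral_congr fun z => ?_
          rw [mul_assoc, lintegral_mul_const]
          exact Measurable.mul (by fun_prop)
            (hj.comp (by fun_prop : Measurable fun s : ℝ => (s, z)))
        · refine Measurable.aemeasurable ?_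
          exact Measurable.mul (Measurable.mul
            (f := fun q : ℝ × E3 => ENNReal.ofReal (Real.exp (-(ν₀ * q.1)))) (by fun_prop) hj)
            (hG.comp measurable_snd)
    _ ≤ ∫⁻ z, ENNReal.ofReal (2 / ν₀ + 2 * D) * G z := by
        refine lintegral_mono fun z => ?_
        by_cases hz : z ∈ Ω
        · exact mul_le_mul_left (vw_mul_chord_time_le hν₀ hD hz v) _
        · simp [hGs z hz]
    _ = _ := lintegral_const_mul' _ _ ENNReal.ofReal_ne_top

/-- Cauchy–Schwarz on the part of the ray inside N costs at most the chord length of N along the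
line. That length is constant along the line, so it can be evaluated at z = x - sv and kept next to
F(z)². -/
lemma vw_mul_lintegral_exit_ray_sq_le {Ω N : Set E3} (hΩ : MeasurableSet Ω) (hN : MeasurableSet N)
    (hNΩ : N ⊆ Ω) {D ν₀ : ℝ} (hν₀ : 0 < ν₀) (hD : ∀ x ∈ Ω, ∀ y ∈ Ω, ‖x - y‖ ≤ D)
    {F : E3 → ℝ≥0∞} (hF : Measurable F) (v : E3) :
    vw v * ∫⁻ x in Ω, (∫⁻ s in Ioi (0 : ℝ), ENNReal.ofReal (Real.exp (-(ν₀ * s))) *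
      N.indicator F (x - s • v)) ^ 2 ≤ ENNReal.ofReal (2 / ν₀ + 2 * D) *
        ∫⁻ z in N, F z ^ 2 * ∫⁻ t : ℝ, N.indicator 1 (z + t • v) := by
  have hi : Measurable (N.indicator (1 : E3 → ℝ≥0∞)) := measurable_one.indicator hN
  set ℓ : E3 → ℝ≥0∞ := fun z => ∫⁻ t : ℝ, N.indicator 1 (z + t • v)
  have hℓ : Measurable ℓ := by
    have : Measurable fun q : E3 × ℝ => N.indicator (1 : E3 → ℝ≥0∞) (q.1 + q.2 • v) :=
      hi.comp (f := fun q : E3 × ℝ => q.1 + q.2 • v) (by fun_prop)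
    exact this.lintegral_prod_right'
  have hℓs : ∀ x (s : ℝ), ℓ (x - s • v) = ℓ x := by
    intro x s
    simp only [ℓ]
    rw [← lintegral_add_right_eq_self _ s]
    refine lintegral_congr fun t => ?_
    congr 1
    module
  set G : E3 → ℝ≥0∞ := N.indicator fun z => F z ^ 2 * ℓ z
  have hG : Measurable G := ((hF.pow_const 2).mul hℓ).indicator hN
  have hGs : ∀ z ∉ Ω, G z = 0 := fun z hz => indicator_of_notMem (fun h => hz (hNΩ h)) _
  have hGi : ∫⁻ z, G z = ∫⁻ z in N, F z ^ 2 * ℓ z := lintegral_indicator hN _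
  rw [← hGi]
  refine le_trans (mul_le_mul_right (lintegral_mono fun x => ?_) _)
    (vw_mul_lintegral_ray_le hΩ hν₀ hD hG hGs v)
  have hFs : Measurable fun s : ℝ => F (x - s • v) :=
    hF.comp (f := fun s : ℝ => x - s • v) (by fun_prop)
  have his : Measurable fun s : ℝ => N.indicator (1 : E3 → ℝ≥0∞) (x - s • v) :=
    hi.comp (f := fun s : ℝ => x - s • v) (by fun_prop)
  calc _ = (∫⁻ s in Ioi (0 : ℝ), (ENNReal.ofReal (Real.exp (-(ν₀ * s))) *
        N.indicator 1 (x - s • v)) * F (x - s • v)) ^ 2 := by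
        congr 1
        refine lintegral_congr fun s => ?_
        by_cases hs : x - s • v ∈ N <;> simp [hs]
    _ ≤ (∫⁻ s in Ioi (0 : ℝ), ENNReal.ofReal (Real.exp (-(ν₀ * s))) *
        N.indicator 1 (x - s • v)) * ∫⁻ s in Ioi (0 : ℝ), (ENNReal.ofReal (Real.exp (-(ν₀ * s))) *
        N.indicator 1 (x - s • v)) * F (x - s • v) ^ 2 :=
        lintegral_mul_sq_le_weighted (by fun_prop) (by fun_prop)
    _ ≤ ℓ x * ∫⁻ s in Ioi (0 : ℝ), (ENNReal.ofReal (Real.exp (-(ν₀ * s))) *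
        N.indicator 1 (x - s • v)) * F (x - s • v) ^ 2 := by
        refine mul_le_mul_left ?_ _
        calc _ ≤ ∫⁻ s in Ioi (0 : ℝ), N.indicator 1 (x - s • v) := by
              refine setLIntegral_mono' measurableSet_Ioi fun s hs => ?_
              refine mul_le_of_le_one_left zero_le ?_
              rw [ENNReal.ofReal_le_one, Real.exp_le_one_iff]
              nlinarith [mem_Ioi.1 hs]
          _ ≤ ∫⁻ s : ℝ, N.indicator 1 (x - s • v) := setLIntegral_le_lintegral _ _
          _ = ℓ x := by
              simp only [ℓ]
              rw [← lintegral_neg_eq_self]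
              refine lintegral_congr fun s => ?_
              rw [neg_smul, sub_neg_eq_add]
    _ = ∫⁻ s in Ioi (0 : ℝ), ℓ x * ((ENNReal.ofReal (Real.exp (-(ν₀ * s))) *
        N.indicator 1 (x - s • v)) * F (x - s • v) ^ 2) := by
        rw [lintegral_const_mul _ (by fun_prop)]
    _ = _ := by
        refine lintegral_congr fun s => ?_
        by_cases hs : x - s • v ∈ N
        · simp only [G]
          rw [indicator_of_mem hs, indicator_of_mem hs, hℓs, Pi.one_apply]
          ring
        · simp [G, hs]

/-- Integrating the length of the chords of `N` through `z` over all velocities. -/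
lemma lintegral_chord_le {N : Set E3} (hN : MeasurableSet N) (z : E3) :
    ∫⁻ v, (vw v)⁻¹ ^ 3 * ∫⁻ t : ℝ, N.indicator 1 (z + t • v) ≤
      2 * ∫⁻ y in N, powWeight 2 (y - z) := by
  have hi : Measurable (N.indicator (1 : E3 → ℝ≥0∞)) := measurable_one.indicator hN
  have e : ∫⁻ y, powWeight 2 (z - y) * N.indicator 1 y = ∫⁻ y in N, powWeight 2 (y - z) := by
    rw [← lintegral_indicator hN]
    refine lintegral_congr fun y => ?_
    by_cases hy : y ∈ N
    · simp [hy, powWeight_sub_comm 2 z y]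
    · simp [hy]
  have h1 := lintegral_ray_le hi z
  have h2 := lintegral_ray_sub_le hi z
  rw [e] at h1 h2
  have hv := measurable_vw
  have hm : Measurable fun v => (vw v)⁻¹ ^ 3 * ∫⁻ s in Ioi (0 : ℝ), N.indicator 1 (z + s • v) := by
    have : Measurable fun q : E3 × ℝ => N.indicator (1 : E3 → ℝ≥0∞) (z + q.2 • q.1) :=
      hi.comp (f := fun q : E3 × ℝ => z + q.2 • q.1) (by fun_prop)
    exact (hv.inv.pow_const 3).mul this.lintegral_prod_right'
  rw [two_mul]
  refine le_trans (le_of_eq ?_) (add_le_add h1 h2)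
  rw [← lintegral_add_left hm]
  refine lintegral_congr fun v => ?_
  rw [← mul_add]
  congr 1
  -- Splitting at t = 0 gives a forward and a backward ray, each bounded by the same potential;
  -- hence the factor 2.
  rw [← lintegral_add_compl _ (measurableSet_Ioi (a := (0 : ℝ))), compl_Ioi]
  congr 1
  rw [setLIntegral_congr Iio_ae_eq_Iic.symm, ← lintegral_indicator measurableSet_Iio,
    ← lintegral_indicator measurableSet_Ioi, ← lintegral_neg_eq_self]
  refine lintegral_congr fun t => ?_
  by_cases ht : 0 < t
  · have e1 : -t ∈ Iio (0 : ℝ) := by simpa using ht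
    have e2 : t ∈ Ioi (0 : ℝ) := ht
    rw [indicator_of_mem e1, indicator_of_mem e2, neg_smul, sub_eq_add_neg]
  · have e1 : -t ∉ Iio (0 : ℝ) := by simpa using ht
    have e2 : t ∉ Ioi (0 : ℝ) := ht
    rw [indicator_of_notMem e1, indicator_of_notMem e2]

lemma ae_integrable_ray {ν : E3 → ℝ} {ν₀ : ℝ} (hν : IsFrequency ν ν₀) {g : E3 × E3 → ℝ}
    (hg : Measurable g) {v : E3} (h1 : Integrable fun x => g (x, v)) :
    ∀ᵐ x, IntegrableOn (fun s : ℝ => Real.exp (-(ν v * s)) * g (x - s • v, v)) (Ioi 0) := by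
  have hm : Measurable fun q : E3 × ℝ => g (q.1 - q.2 • v, v) :=
    hg.comp (f := fun q : E3 × ℝ => (q.1 - q.2 • v, v)) (by fun_prop)
  have hm' : Measurable fun q : E3 × ℝ => ENNReal.ofReal (Real.exp (-(ν₀ * q.2))) *
      ‖g (q.1 - q.2 • v, v)‖ₑ := by fun_prop
  have hfin : ∫⁻ x, ∫⁻ s in Ioi (0 : ℝ), ENNReal.ofReal (Real.exp (-(ν₀ * s))) *
      ‖g (x - s • v, v)‖ₑ ≠ ∞ := by
    rw [lintegral_lintegral_swap hm'.aemeasurable]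
    have : ∀ s : ℝ, ∫⁻ x, ENNReal.ofReal (Real.exp (-(ν₀ * s))) * ‖g (x - s • v, v)‖ₑ =
        ENNReal.ofReal (Real.exp (-(ν₀ * s))) * ∫⁻ x, ‖g (x, v)‖ₑ := fun s => by
      rw [lintegral_const_mul' _ _ ENNReal.ofReal_ne_top,
        lintegral_sub_right_eq_self (fun x => ‖g (x, v)‖ₑ) (s • v)]
    simp only [this]
    rw [lintegral_mul_const _ (by fun_prop), lintegral_exp_neg hν.pos]
    exact ENNReal.mul_ne_top ENNReal.ofReal_ne_top h1.2.ne
  filter_upwards [ae_lt_top (hm'.lintegral_prod_right' (ν := volume.restrict (Ioi (0 : ℝ)))) hfin]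
    with x hx
  refine ⟨Measurable.aestronglyMeasurable (Measurable.mul (by fun_prop)
    (hg.comp (f := fun s : ℝ => (x - s • v, v)) (by fun_prop))), ?_⟩
  rw [hasFiniteIntegral_iff_enorm]
  refine lt_of_le_of_lt (setLIntegral_mono' measurableSet_Ioi fun s hs => ?_) hx
  rw [enorm_mul, Real.enorm_of_nonneg (Real.exp_pos _).le]
  gcongr
  · exact (mem_Ioi.1 hs).le
  · exact hν.bound v

/-- Subtracting the two ray integrals requires both to converge, since a divergent one has the
default value 0. The estimate is therefore claimed only for almost every x. -/
lemma ae_enorm_transOp_sub_le {ν : E3 → ℝ} {ν₀ : ℝ} (hν : IsFrequency ν ν₀) {g : E3 × E3 → ℝ}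
    (hg : Measurable g) {v : E3} (h1 : Integrable fun x => g (x, v)) (h : E3) :
    ∀ᵐ x, ‖transOp ν g (x + h, v) - transOp ν g (x, v)‖ₑ ≤ ∫⁻ s in Ioi (0 : ℝ),
      ENNReal.ofReal (Real.exp (-(ν₀ * s))) * ‖g (x - s • v + h, v) - g (x - s • v, v)‖ₑ := by
  filter_upwards [ae_integrable_ray hν hg h1, (measurePreserving_add_right
    (volume : Measure E3) h).quasiMeasurePreserving.ae (ae_integrable_ray hν hg h1)] with x i1 i2
  simp only [transOp]
  rw [← integral_sub i2 i1]
  refine (enorm_integral_le_lintegral_enorm _).trans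
    (setLIntegral_mono' measurableSet_Ioi fun s hs => ?_)
  rw [← mul_sub, enorm_mul, Real.enorm_of_nonneg (Real.exp_pos _).le,
    show x + h - s • v = x - s • v + h by abel]
  gcongr
  · exact (mem_Ioi.1 hs).le
  · exact hν.bound v

/-- The squared `L²` norm of a difference, over the points that stay in `Ω`. -/
def innerDiff (Ω : Set E3) (h : E3) (f : E3 × E3 → ℝ) : ℝ≥0∞ :=
  ∫⁻ v, ∫⁻ x in {x | x ∈ Ω ∧ x + h ∈ Ω}, ‖f (x + h, v) - f (x, v)‖ₑ ^ 2

/-- The contribution of the rays leaving `Ω` under translation to the last transport step. -/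
lemma lintegral_exit_ray_le {Ω : Set E3} (hΩ : MeasurableSet Ω) (hc : Convex ℝ Ω) {D ν₀ A : ℝ}
    (hν₀ : 0 < ν₀) (hD : ∀ x ∈ Ω, ∀ y ∈ Ω, ‖x - y‖ ≤ D) {k : E3 → E3 → ℝ}
    (hk : IsGradKernel k A) {η : ℝ} (hη0 : 0 < η) (hη : η < 1) :
    ∃ C : ℝ≥0, ∀ u : E3 × E3 → ℝ, Measurable u → ∀ h : E3, h ≠ 0 →
      ∫⁻ v, ∫⁻ x in Ω, (∫⁻ s in Ioi (0 : ℝ), ENNReal.ofReal (Real.exp (-(ν₀ * s))) *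
        (exitSet Ω h).indicator (fun z => ‖cut Ω (kerOp k u) (z, v)‖ₑ) (x - s • v)) ^ 2 ≤
      C * (ENNReal.ofReal (‖h‖ ^ (1 - η)) * ∫⁻ z in exitSet Ω h, velNorm 1 u z) := by
  obtain ⟨C₁, hC₁⟩ := enorm_kerOp_sq_le 1 hk
  obtain ⟨C₂, hC₂⟩ := exitSet_singular_integral_le hΩ hc hD hη0 hη
  set c := ENNReal.ofReal (2 / ν₀ + 2 * D)
  refine ⟨c.toNNReal * C₁ * (2 * C₂), fun u hu h hh => ?_⟩
  have hN := measurableSet_exitSet hΩ h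
  set N := exitSet Ω h
  have hNΩ : N ⊆ Ω := fun z hz => hz.1
  have hm := measurable_velNorm 1 hu
  have hv := measurable_vw
  set ℓ : E3 → E3 → ℝ≥0∞ := fun z v => ∫⁻ t : ℝ, N.indicator 1 (z + t • v)
  have hℓ : Measurable fun q : E3 × E3 => ℓ q.1 q.2 := by
    have hi : Measurable (N.indicator (1 : E3 → ℝ≥0∞)) := measurable_one.indicator hN
    have : Measurable fun q : (E3 × E3) × ℝ => N.indicator (1 : E3 → ℝ≥0∞) (q.1.1 + q.2 • q.1.2) :=
      hi.comp (f := fun q : (E3 × E3) × ℝ => q.1.1 + q.2 • q.1.2) (by fun_prop)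
    exact this.lintegral_prod_right'
  have hb := measurable_cut hΩ (measurable_kerOp hk.measurable hu)
  -- Transport gives (1+|v|)⁻¹ and K gives (1+|v|)⁻². Together they form the weight (1+|v|)⁻³ under
  -- which chord lengths integrate over v to the |y-z|⁻² mass of the layer, of order |h|^(1-η).
  have key : ∀ v, ∫⁻ x in Ω, (∫⁻ s in Ioi (0 : ℝ), ENNReal.ofReal (Real.exp (-(ν₀ * s))) *
        N.indicator (fun z => ‖cut Ω (kerOp k u) (z, v)‖ₑ) (x - s • v)) ^ 2 ≤
      ∫⁻ z in N, c * C₁ * (velNorm 1 u z * ((vw v)⁻¹ ^ 3 * ℓ z v)) := by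
    intro v
    have hvi : (vw v)⁻¹ * vw v = 1 := ENNReal.inv_mul_cancel (vw_ne_zero v) (vw_ne_top v)
    have hlv : Measurable fun z => ℓ z v := hℓ.comp (f := fun z => (z, v)) (by fun_prop)
    have hbv : Measurable fun z => ‖cut Ω (kerOp k u) (z, v)‖ₑ := measurable_velocity_slice hb v
    calc _ = (vw v)⁻¹ * (vw v * ∫⁻ x in Ω, (∫⁻ s in Ioi (0 : ℝ),
          ENNReal.ofReal (Real.exp (-(ν₀ * s))) *
          N.indicator (fun z => ‖cut Ω (kerOp k u) (z, v)‖ₑ) (x - s • v)) ^ 2) := by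
          rw [← mul_assoc, hvi, one_mul]
      _ ≤ (vw v)⁻¹ * (c * ∫⁻ z in N, ‖cut Ω (kerOp k u) (z, v)‖ₑ ^ 2 * ℓ z v) :=
          mul_le_mul_right (vw_mul_lintegral_exit_ray_sq_le hΩ hN hNΩ hν₀ hD hbv v) _
      _ ≤ (vw v)⁻¹ * (c * ∫⁻ z in N, C₁ * ((vw v)⁻¹ ^ (2 * 1) * velNorm 1 u z) * ℓ z v) := by
          gcongr with z
          exact (pow_le_pow_left' (enorm_cut_le _ _ _) 2).trans (hC₁ u hu z v)
      _ = _ := by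
          rw [← lintegral_const_mul _ (by fun_prop), ← lintegral_const_mul _ (by fun_prop)]
          refine lintegral_congr fun z => ?_
          ring
  calc _ ≤ ∫⁻ v, ∫⁻ z in N, c * C₁ * (velNorm 1 u z * ((vw v)⁻¹ ^ 3 * ℓ z v)) :=
        lintegral_mono key
    _ = ∫⁻ z in N, ∫⁻ v, c * C₁ * (velNorm 1 u z * ((vw v)⁻¹ ^ 3 * ℓ z v)) := by
        rw [lintegral_lintegral_swap]
        refine Measurable.aemeasurable ?_
        refine Measurable.const_mul (Measurable.mul (hm.comp measurable_snd)
          (Measurable.mul (f := fun q : E3 × E3 => (vw q.1)⁻¹ ^ 3) (by fun_prop)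
          (hℓ.comp measurable_swap))) _
    _ ≤ ∫⁻ z in N, c * C₁ * (velNorm 1 u z * (2 * (C₂ * ENNReal.ofReal (‖h‖ ^ (1 - η))))) := by
        refine setLIntegral_mono' hN fun z hz => ?_
        have hlz : Measurable fun v => ℓ z v := hℓ.comp (f := fun v => (z, v)) (by fun_prop)
        rw [lintegral_const_mul _ (by fun_prop), lintegral_const_mul _ (by fun_prop)]
        gcongr
        refine (lintegral_chord_le hN z).trans ?_
        gcongr
        exact hC₂ z (hNΩ hz) h hh
    _ = _ := by
        rw [lintegral_const_mul _ (by fun_prop), lintegral_mul_const _ hm]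
        push_cast
        rw [ENNReal.coe_toNNReal ENNReal.ofReal_ne_top]
        ring

/-- Differences of one step of the iteration. -/
lemma innerDiff_stepOp_le {Ω : Set E3} (hΩ : MeasurableSet Ω) (hv : volume Ω < ∞)
    (hc : Convex ℝ Ω) {D ν₀ A : ℝ} {ν : E3 → ℝ} (hν : IsFrequency ν ν₀)
    (hD : ∀ x ∈ Ω, ∀ y ∈ Ω, ‖x - y‖ ≤ D) {k : E3 → E3 → ℝ}
    (hk : IsGradKernel k A) {η : ℝ} (hη0 : 0 < η) (hη : η < 1) :
    ∃ C : ℝ≥0, ∀ u a : E3 × E3 → ℝ, Measurable u → Measurable a →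
      cut Ω (kerOp k u) = cut Ω a → IsSupportedL2 Ω (cut Ω a) → ∀ h : E3, h ≠ 0 →
      innerDiff Ω h (stepOp Ω ν k u) ≤ C * (diffNorm h a + ENNReal.ofReal (‖h‖ ^ (1 - η)) *
        ((∫⁻ z in exitSet Ω h, velNorm 1 u z) + ∫⁻ z in exitSet Ω (-h), velNorm 1 u z)) := by
  obtain ⟨C, hC⟩ := lintegral_exit_ray_le hΩ hc hν.pos hD hk hη0 hη
  set c := ENNReal.ofReal (1 / ν₀) ^ 2
  have hct : c ≠ ∞ := ENNReal.pow_ne_top ENNReal.ofReal_ne_top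
  refine ⟨3 * (c.toNNReal + C), fun u a hu ha hua hreg h hh => ?_⟩
  have hb := hreg.measurable
  rw [stepOp, hua]
  set b := cut Ω a
  set e : ℝ → ℝ≥0∞ := fun s => ENNReal.ofReal (Real.exp (-(ν₀ * s)))
  have he : Measurable e := by simp only [e]; fun_prop
  -- Here a is a whole-space function agreeing with K u in Ω, whose differences are controlled
  -- across the boundary. T₁ averages these differences along the ray; R collects the times at which
  -- exactly one of the two translated points lies in Ω.
  set T₁ : E3 → E3 → ℝ≥0∞ := fun v x =>
    ∫⁻ s in Ioi (0 : ℝ), e s * ‖a (x - s • v + h, v) - a (x - s • v, v)‖ₑ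
  set R : E3 → E3 → E3 → ℝ≥0∞ := fun h' v x => ∫⁻ s in Ioi (0 : ℝ), e s *
    (exitSet Ω h').indicator (fun z => ‖b (z, v)‖ₑ) (x - s • v)
  have hdm : Measurable fun q : E3 × E3 => ‖a (q.1 + h, q.2) - a q‖ₑ := by
    have := ha.comp (f := fun q : E3 × E3 => (q.1 + h, q.2)) (by fun_prop)
    exact (this.sub ha).enorm
  have hT₁ : Measurable fun q : E3 × E3 => T₁ q.1 q.2 := by
    have : Measurable fun q : (E3 × E3) × ℝ => e q.2 *
        ‖a (q.1.2 - q.2 • q.1.1 + h, q.1.1) - a (q.1.2 - q.2 • q.1.1, q.1.1)‖ₑ :=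
      (he.comp measurable_snd).mul (hdm.comp
        (f := fun q : (E3 × E3) × ℝ => (q.1.2 - q.2 • q.1.1, q.1.1)) (by fun_prop))
    exact this.lintegral_prod_right'
  have hR : ∀ h', Measurable fun q : E3 × E3 => R h' q.1 q.2 := by
    intro h'
    have h1 : Measurable fun q : E3 × E3 =>
        (exitSet Ω h').indicator (fun z => ‖b (z, q.2)‖ₑ) q.1 := by
      have : Measurable ((exitSet Ω h' ×ˢ univ).indicator fun q : E3 × E3 => ‖b q‖ₑ) :=
        hb.enorm.indicator ((measurableSet_exitSet hΩ h').prod MeasurableSet.univ)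
      refine (congrArg Measurable (funext fun q => ?_)).mp this
      by_cases hq : q.1 ∈ exitSet Ω h' <;> simp [indicator, hq]
    have : Measurable fun q : (E3 × E3) × ℝ => e q.2 * (exitSet Ω h').indicator
        (fun z => ‖b (z, q.1.1)‖ₑ) (q.1.2 - q.2 • q.1.1) :=
      (he.comp measurable_snd).mul (h1.comp
        (f := fun q : (E3 × E3) × ℝ => (q.1.2 - q.2 • q.1.1, q.1.1)) (by fun_prop))
    exact this.lintegral_prod_right'
  set P := {x | x ∈ Ω ∧ x + h ∈ Ω}
  have hPm : MeasurableSet P := hΩ.inter (hΩ.preimage (by fun_prop : Measurable fun x : E3 => x + h))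
  have key : ∀ᵐ v, ∫⁻ x in P, ‖cut Ω (transOp ν b) (x + h, v) - cut Ω (transOp ν b) (x, v)‖ₑ ^ 2 ≤
      3 * (c * (∫⁻ x, ‖a (x + h, v) - a (x, v)‖ₑ ^ 2) + (∫⁻ x in Ω, R h v x ^ 2) +
        ∫⁻ x in Ω, R (-h) v x ^ 2) := by
    filter_upwards [(hreg.isSpaceRegular hΩ hv).integrable] with v hiv
    have hT₁v : Measurable fun x => T₁ v x := hT₁.comp (f := fun x => (v, x)) (by fun_prop)
    have hRv : ∀ h', Measurable fun x => R h' v x := fun h' =>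
      (hR h').comp (f := fun x => (v, x)) (by fun_prop)
    have hbv := measurable_velocity_slice hb v
    have hiM : ∀ h', Measurable ((exitSet Ω h').indicator (fun z => ‖b (z, v)‖ₑ)) := fun h' =>
      hbv.indicator (measurableSet_exitSet hΩ h')
    calc _ ≤ ∫⁻ x in P, 3 * (T₁ v x ^ 2 + R h v x ^ 2 + R (-h) v (x + h) ^ 2) := by
          refine lintegral_mono_ae ?_
          filter_upwards [ae_restrict_of_ae (ae_enorm_transOp_sub_le hν hb hiv h),
            ae_restrict_mem hPm] with x hx hxP
          rw [cut_of_mem hxP.1, cut_of_mem hxP.2]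
          refine (pow_le_pow_left' (hx.trans ?_) 2).trans (add_three_sq_le _ _ _)
          have m1 : Measurable fun s : ℝ =>
              e s * ‖a (x - s • v + h, v) - a (x - s • v, v)‖ₑ :=
            he.mul (hdm.comp (f := fun s : ℝ => (x - s • v, v)) (by fun_prop))
          have m2 : Measurable fun s : ℝ => e s *
              (exitSet Ω h).indicator (fun z => ‖b (z, v)‖ₑ) (x - s • v) :=
            he.mul ((hiM h).comp (f := fun s : ℝ => x - s • v) (by fun_prop))
          have m3 : Measurable fun s : ℝ => e s * ‖a (x - s • v + h, v) - a (x - s • v, v)‖ₑ +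
              e s * (exitSet Ω h).indicator (fun z => ‖b (z, v)‖ₑ) (x - s • v) := m1.add m2
          simp only [T₁, R]
          rw [← lintegral_add_left m1, ← lintegral_add_left m3]
          refine lintegral_mono fun s => ?_
          have := enorm_cut_sub_le Ω a (x - s • v) h v
          rw [show x + h - s • v = x - s • v + h by abel, ← mul_add, ← mul_add]
          exact mul_le_mul_right this _
      _ = 3 * ((∫⁻ x in P, T₁ v x ^ 2) + (∫⁻ x in P, R h v x ^ 2) +
            ∫⁻ x in P, R (-h) v (x + h) ^ 2) := by
          have := hRv h
          rw [lintegral_const_mul' _ _ (by norm_num), lintegral_add_left (by fun_prop),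
            lintegral_add_left (by fun_prop)]
      _ ≤ _ := by
          refine mul_le_mul_right (add_le_add (add_le_add ?_
            (lintegral_mono_set fun x hx => hx.1)) ?_) _
          · refine (setLIntegral_le_lintegral _ _).trans ?_
            exact lintegral_damped_ray_sq_le hν.pos (F := fun x => ‖a (x + h, v) - a (x, v)‖ₑ)
              (hdm.comp (f := fun x => (x, v)) (by fun_prop)) v
          · rw [← lintegral_indicator hPm, ← lintegral_indicator hΩ,
              ← lintegral_add_right_eq_self (fun x => Ω.indicator (fun x => R (-h) v x ^ 2) x) h]
            refine lintegral_mono fun x => ?_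
            by_cases hx : x ∈ P
            · rw [indicator_of_mem hx, indicator_of_mem hx.2]
            · rw [indicator_of_notMem hx]; exact zero_le
  have hRi : ∀ h', Measurable fun v => ∫⁻ x in Ω, R h' v x ^ 2 := fun h' =>
    ((hR h').pow_const 2).lintegral_prod_right'
  have hCh : ∀ h' : E3, h' ≠ 0 → ∫⁻ v, ∫⁻ x in Ω, R h' v x ^ 2 ≤
      C * (ENNReal.ofReal (‖h'‖ ^ (1 - η)) * ∫⁻ z in exitSet Ω h', velNorm 1 u z) := by
    intro h' hh'
    have := hC u hu h' hh'
    rw [hua] at this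
    exact this
  calc innerDiff Ω h (cut Ω (transOp ν b)) ≤ ∫⁻ v, 3 * (c * (∫⁻ x, ‖a (x + h, v) - a (x, v)‖ₑ ^ 2) +
        (∫⁻ x in Ω, R h v x ^ 2) + ∫⁻ x in Ω, R (-h) v x ^ 2) := lintegral_mono_ae key
    _ = 3 * (c * diffNorm h a + (∫⁻ v, ∫⁻ x in Ω, R h v x ^ 2) +
        ∫⁻ v, ∫⁻ x in Ω, R (-h) v x ^ 2) := by
        rw [lintegral_const_mul' _ _ (by norm_num), lintegral_add_right _ (hRi _),
          lintegral_add_right _ (hRi _), lintegral_const_mul' _ _ hct, diffNorm]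
    _ ≤ 3 * (c * diffNorm h a +
        C * (ENNReal.ofReal (‖h‖ ^ (1 - η)) * ∫⁻ z in exitSet Ω h, velNorm 1 u z) +
        C * (ENNReal.ofReal (‖-h‖ ^ (1 - η)) * ∫⁻ z in exitSet Ω (-h), velNorm 1 u z)) := by
        gcongr
        · exact hCh h hh
        · exact hCh (-h) (neg_ne_zero.2 hh)
    _ ≤ _ := by
        rw [norm_neg]
        push_cast
        rw [ENNReal.coe_toNNReal hct]
        set X := ∫⁻ z in exitSet Ω h, velNorm 1 u z
        set Y := ∫⁻ z in exitSet Ω (-h), velNorm 1 u z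
        set Z := ENNReal.ofReal (‖h‖ ^ (1 - η))
        calc _ = 3 * (c * diffNorm h a + C * (Z * (X + Y))) := by ring
          _ ≤ 3 * ((c + C) * diffNorm h a + (c + C) * (Z * (X + Y))) := by
              gcongr
              · exact le_self_add
              · exact le_add_self
          _ = _ := by ring

/-! ### Regularity of the fourth iterate -/

/-- The squared Slobodeckij seminorm over `Ω`, in terms of differences. -/
def innerSlob (Ω : Set E3) (q : ℝ) (f : E3 × E3 → ℝ) : ℝ≥0∞ :=
  ∫⁻ h, powWeight q h * innerDiff Ω h f

lemma wNorm_zero_le (n : ℕ) (g : E3 × E3 → ℝ) : wNorm 0 g ≤ wNorm n g := by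
  refine lintegral_mono fun x => lintegral_mono fun v => mul_le_mul_left ?_ _
  simpa using one_le_pow₀ (one_le_vw v)

/-- K acts separately at each position, so inside Ω it does not see the outer cutoff of `stepOp`.
The function K S applied to the cut-off K g is thus an extension of K(S_Ω K g) to the whole space
without a new jump at the boundary, and averaging applies to it. -/
lemma cut_kerOp_stepOp (Ω : Set E3) (ν : E3 → ℝ) (k : E3 → E3 → ℝ) (g : E3 × E3 → ℝ) :
    cut Ω (kerOp k (stepOp Ω ν k g)) = cut Ω (kerOp k (transOp ν (cut Ω (kerOp k g)))) := by
  funext ⟨x, v⟩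
  by_cases hx : x ∈ Ω
  · rw [cut_of_mem hx, cut_of_mem hx]
    simp only [kerOp, stepOp, cut_of_mem hx]
  · rw [cut_of_notMem hx, cut_of_notMem hx]

lemma isSupportedL2_cut_kerOp {Ω : Set E3} (hΩ : MeasurableSet Ω) {k : E3 → E3 → ℝ} {A : ℝ}
    (hk : IsGradKernel k A) {g : E3 × E3 → ℝ} (hg : Measurable g) (hfin : wNorm 0 g < ∞) :
    IsSupportedL2 Ω (cut Ω (kerOp k g)) := by
  refine ⟨measurable_cut hΩ (measurable_kerOp hk.measurable hg),
    fun x hx v => cut_of_notMem hx _ _, ?_⟩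
  obtain ⟨C, hC⟩ := wNorm_kerOp_le 0 hk
  exact ((wNorm_cut_le 0 Ω _).trans (hC g hg)).trans_lt (ENNReal.mul_lt_top ENNReal.coe_lt_top hfin)

/-- Almost half a derivative for `K` applied to the second iterate, cut off at the boundary. -/
lemma slobNorm_cut_kerOp_stepOp_le {Ω : Set E3} (hΩ : MeasurableSet Ω) (hv : volume Ω < ∞)
    (hc : Convex ℝ Ω) {D ν₀ A : ℝ} {ν : E3 → ℝ} (hν : IsFrequency ν ν₀)
    (hD : ∀ x ∈ Ω, ∀ y ∈ Ω, ‖x - y‖ ≤ D) {k : E3 → E3 → ℝ}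
    (hk : IsGradKernel k A) {p : ℝ} (hp : 3 < p) (hp4 : p < 4) :
    ∃ C : ℝ≥0, ∀ g : E3 × E3 → ℝ, Measurable g → wNorm 0 g < ∞ →
      slobNorm p (cut Ω (kerOp k (stepOp Ω ν k g))) ≤ C * wNorm 1 g := by
  obtain ⟨C₁, hC₁⟩ := slobNorm_kerOp_transOp_le_wNorm hΩ hv hν hk hp hp4
  obtain ⟨C₂, hC₂⟩ := wNorm_kerOp_le 0 hk
  obtain ⟨C₃, hC₃⟩ := kerOp_weighted_L2 0 hk
  obtain ⟨C₄, hC₄⟩ := hardy_stepOp 0 hΩ hc hν hD hk hp hp4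
  refine ⟨3 * (C₁ * C₂ + 2 * (C₃ * C₄)), fun g hg hfin => ?_⟩
  have hb := isSupportedL2_cut_kerOp hΩ hk hg hfin
  set b := cut Ω (kerOp k g)
  have hA := measurable_kerOp hk.measurable (measurable_transOp hν.measurable hb.measurable)
  have hgs := measurable_stepOp hΩ hν.measurable hk.measurable hg
  have hW := measurable_bdryWeight hΩ p
  have hm := measurable_velNorm 0 hgs
  rw [cut_kerOp_stepOp]
  have h1 : slobNorm p (kerOp k (transOp ν b)) ≤ C₁ * C₂ * wNorm 1 g := by
    refine (hC₁ b hb).trans ?_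
    rw [mul_assoc]
    exact mul_le_mul_right (((wNorm_cut_le 0 Ω _).trans (hC₂ g hg)).trans
      (mul_le_mul_right (wNorm_zero_le 1 g) _)) _
  -- The boundary term of the cutoff: K is bounded on L² in velocity at each position, which reduces
  -- it to the Hardy inequality for one step.
  have h2 : ∫⁻ x in Ω, bdryWeight Ω p x * velNorm 0 (kerOp k (transOp ν b)) x ≤
      C₃ * C₄ * wNorm 1 g := by
    calc _ ≤ ∫⁻ x in Ω, C₃ * (bdryWeight Ω p x * velNorm 0 (stepOp Ω ν k g) x) := by
          refine setLIntegral_mono' hΩ fun x hx => ?_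
          rw [mul_left_comm]
          refine mul_le_mul_right (le_trans (le_of_eq ?_) (hC₃ _ hgs x)) _
          refine lintegral_congr fun v => ?_
          simp only [kerOp, stepOp, cut_of_mem hx, b]
      _ = C₃ * ∫⁻ x in Ω, bdryWeight Ω p x * velNorm 0 (stepOp Ω ν k g) x :=
          lintegral_const_mul' _ _ ENNReal.coe_ne_top
      _ ≤ C₃ * (C₄ * wNorm (0 + 1) g) := mul_le_mul_right (hC₄ g hg) _
      _ = _ := by rw [mul_assoc]
  refine (slobNorm_cut_le hΩ hA p).trans ?_
  calc _ ≤ 3 * (C₁ * C₂ * wNorm 1 g + 2 * (C₃ * C₄ * wNorm 1 g)) := by gcongr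
    _ = _ := by push_cast; ring

/-- Almost one derivative for the fourth iterate. -/
lemma innerSlob_iterate_le {Ω : Set E3} (hΩ : MeasurableSet Ω) (hv : volume Ω < ∞)
    (hc : Convex ℝ Ω) {D ν₀ A : ℝ} {ν : E3 → ℝ} (hν : IsFrequency ν ν₀)
    (hD : ∀ x ∈ Ω, ∀ y ∈ Ω, ‖x - y‖ ≤ D) {k : E3 → E3 → ℝ}
    (hk : IsGradKernel k A) {ε : ℝ} (hε : 0 < ε) (hε2 : ε < 1 / 2) :
    ∃ C : ℝ≥0, ∀ g : E3 × E3 → ℝ, Measurable g → wNorm 0 g < ∞ →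
      innerSlob Ω (5 - 2 * ε) ((stepOp Ω ν k)^[4] g) ≤ C * wNorm 0 g := by
  -- Exponents, with p = 3 + 2s: 4 - 2ε is s = 1/2 - ε, and one application of K S raises it to 5 -
  -- 2ε, that is s = 1 - ε. The exit term brings |h|^(1-ε), leaving 4 - ε, still below 4. Its Hardy
  -- bound with n = 1 needs `wNorm 2` of the second iterate, which the first two steps provide.
  obtain ⟨C₁, hC₁⟩ := innerDiff_stepOp_le hΩ hv hc hν hD hk hε (by linarith)
  obtain ⟨C₂, hC₂⟩ := slobNorm_kerOp_transOp_le hΩ hv hν hk (p := 4 - 2 * ε) (by linarith)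
    (by linarith)
  obtain ⟨C₃, hC₃⟩ := slobNorm_cut_kerOp_stepOp_le hΩ hv hc hν hD hk (p := 4 - 2 * ε) (by linarith)
    (by linarith)
  obtain ⟨C₄, hC₄⟩ := hardy_stepOp 1 hΩ hc hν hD hk (p := 4 - ε) (by linarith) (by linarith)
  obtain ⟨C₅, hC₅⟩ := wNorm_stepOp_le 0 hΩ hν hD hk
  obtain ⟨C₆, hC₆⟩ := wNorm_stepOp_le 1 hΩ hν hD hk
  refine ⟨C₁ * (C₂ * C₃ * C₅ + 2 * (C₄ * C₆ * C₅)), fun g hg hfin => ?_⟩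
  have hU : ∀ {g : E3 × E3 → ℝ}, Measurable g → Measurable (stepOp Ω ν k g) := fun hg =>
    measurable_stepOp hΩ hν.measurable hk.measurable hg
  have hF : ∀ {g : E3 × E3 → ℝ}, Measurable g → wNorm 0 g < ∞ → wNorm 0 (stepOp Ω ν k g) < ∞ :=
    fun hg hfin => ((wNorm_zero_le 1 _).trans (hC₅ _ hg)).trans_lt
      (ENNReal.mul_lt_top ENNReal.coe_lt_top hfin)
  rw [show (stepOp Ω ν k)^[4] g =
    stepOp Ω ν k (stepOp Ω ν k (stepOp Ω ν k (stepOp Ω ν k g))) from rfl]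
  set g₁ := stepOp Ω ν k g
  set g₂ := stepOp Ω ν k g₁
  set g₃ := stepOp Ω ν k g₂
  have m₁ : Measurable g₁ := hU hg
  have m₂ : Measurable g₂ := hU m₁
  have m₃ : Measurable g₃ := hU m₂
  have f₁ : wNorm 0 g₁ < ∞ := hF hg hfin
  have f₂ : wNorm 0 g₂ < ∞ := hF m₁ f₁
  have f₃ : wNorm 0 g₃ < ∞ := hF m₂ f₂
  have w₁ : wNorm 1 g₁ ≤ C₅ * wNorm 0 g := hC₅ g hg
  have w₂ : wNorm 2 g₂ ≤ C₆ * wNorm 1 g₁ := hC₆ g₁ m₁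
  have hb := isSupportedL2_cut_kerOp hΩ hk m₂ f₂
  set b := cut Ω (kerOp k g₂)
  have hA := measurable_kerOp hk.measurable (measurable_transOp hν.measurable hb.measurable)
  have hcut : cut Ω (kerOp k g₃) = cut Ω (kerOp k (transOp ν b)) := cut_kerOp_stepOp Ω ν k g₂
  have hb3 : IsSupportedL2 Ω (cut Ω (kerOp k (transOp ν b))) :=
    hcut ▸ isSupportedL2_cut_kerOp hΩ hk m₃ f₃
  have hv3 := measurable_velNorm 1 m₃
  have hpw := measurable_powWeight
  have hE := measurable_lintegral_exitSet hΩ hv3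
  have hE' : Measurable fun h => ∫⁻ y in exitSet Ω (-h), velNorm 1 g₃ y := hE.comp measurable_neg
  have hS : slobNorm (5 - 2 * ε) (kerOp k (transOp ν b)) ≤ C₂ * C₃ * C₅ * wNorm 0 g := by
    have := hC₂ b hb
    rw [show 4 - 2 * ε + 1 = 5 - 2 * ε by ring] at this
    calc _ ≤ C₂ * slobNorm (4 - 2 * ε) b := this
      _ ≤ C₂ * (C₃ * (C₅ * wNorm 0 g)) := by
          gcongr
          exact (hC₃ g₁ m₁ f₁).trans (mul_le_mul_right w₁ _)
      _ = _ := by ring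
  have hH : ∫⁻ h, powWeight (4 - ε) h * ∫⁻ z in exitSet Ω h, velNorm 1 g₃ z ≤
      C₄ * C₆ * C₅ * wNorm 0 g := by
    rw [← lintegral_bdryWeight_mul hΩ _ hv3]
    calc _ ≤ C₄ * wNorm 2 g₂ := hC₄ g₂ m₂
      _ ≤ C₄ * (C₆ * (C₅ * wNorm 0 g)) := by
          gcongr
          exact w₂.trans (mul_le_mul_right w₁ _)
      _ = _ := by ring
  calc innerSlob Ω (5 - 2 * ε) (stepOp Ω ν k g₃)
      ≤ ∫⁻ h, C₁ * (powWeight (5 - 2 * ε) h * diffNorm h (kerOp k (transOp ν b)) +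
          (powWeight (4 - ε) h * (∫⁻ z in exitSet Ω h, velNorm 1 g₃ z) +
          powWeight (4 - ε) h * ∫⁻ z in exitSet Ω (-h), velNorm 1 g₃ z)) := by
        refine lintegral_mono_ae (ae_ne_zero.mono fun h hh => ?_)
        refine (mul_le_mul_right (hC₁ g₃ _ m₃ hA hcut hb3 h hh) _).trans (le_of_eq ?_)
        have e : powWeight (4 - ε) h = powWeight (5 - 2 * ε) h * ENNReal.ofReal (‖h‖ ^ (1 - ε)) := by
          rw [powWeight_mul hh]; congr 1; ring
        rw [e]
        ring
    _ = C₁ * (slobNorm (5 - 2 * ε) (kerOp k (transOp ν b)) +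
          ((∫⁻ h, powWeight (4 - ε) h * ∫⁻ z in exitSet Ω h, velNorm 1 g₃ z) +
          ∫⁻ h, powWeight (4 - ε) h * ∫⁻ z in exitSet Ω (-h), velNorm 1 g₃ z)) := by
        rw [lintegral_const_mul' _ _ ENNReal.coe_ne_top, lintegral_add_right _ (by fun_prop),
          lintegral_add_left (by fun_prop), slobNorm]
    _ ≤ C₁ * (C₂ * C₃ * C₅ * wNorm 0 g +
          (C₄ * C₆ * C₅ * wNorm 0 g + C₄ * C₆ * C₅ * wNorm 0 g)) := by
        rw [lintegral_powWeight_exitSet_neg]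
        gcongr
    _ = _ := by push_cast; ring

/-! ### Identification of the operators -/

lemma measurable_collisionFreq {B : ℝ → ℝ → ℝ} (hB : Measurable (Function.uncurry B)) :
    Measurable (collisionFreq B) := by
  have hM := measurable_maxwellian
  have e : collisionFreq B = fun v => ∫ vs : E3, ∫ _ε in Ioc (0 : ℝ) (2 * Real.pi),
      ∫ θ in Ioc (0 : ℝ) (Real.pi / 2), maxwellian vs * B ‖v - vs‖ θ := by
    funext v
    refine integral_congr_ae (ae_of_all _ fun vs => ?_)
    simp only
    rw [intervalIntegral.integral_of_le (by positivity)]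
    refine integral_congr_ae (ae_of_all _ fun ε => ?_)
    simp only
    rw [intervalIntegral.integral_of_le (by positivity)]
  rw [e]
  have h1 : Measurable fun q : (E3 × E3) × ℝ => maxwellian q.1.2 * B ‖q.1.1 - q.1.2‖ q.2 :=
    (by fun_prop : Measurable fun q : (E3 × E3) × ℝ => maxwellian q.1.2).mul
      (hB.comp (f := fun q : (E3 × E3) × ℝ => (‖q.1.1 - q.1.2‖, q.2)) (by fun_prop))
  have h2 : Measurable fun q : E3 × E3 =>
      ∫ θ in Ioc (0 : ℝ) (Real.pi / 2), maxwellian q.2 * B ‖q.1 - q.2‖ θ :=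
    h1.stronglyMeasurable.integral_prod_right'.measurable
  have h3 : Measurable fun q : E3 × E3 => ∫ _ε in Ioc (0 : ℝ) (2 * Real.pi),
      ∫ θ in Ioc (0 : ℝ) (Real.pi / 2), maxwellian q.2 * B ‖q.1 - q.2‖ θ := by
    have h : Measurable fun q : (E3 × E3) × ℝ =>
        ∫ θ in Ioc (0 : ℝ) (Real.pi / 2), maxwellian q.1.2 * B ‖q.1.1 - q.1.2‖ θ :=
      h2.comp measurable_fst
    exact h.stronglyMeasurable.integral_prod_right'.measurable
  exact h3.stronglyMeasurable.integral_prod_right'.measurable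

/-- The integral along the backward characteristic inside a bounded convex set. -/
lemma opS_eq {Ω : Set E3} (hc : Convex ℝ Ω) (hb : Bornology.IsBounded Ω) (B : ℝ → ℝ → ℝ)
    (h : E3 × E3 → ℝ) {x v : E3} (hx : x ∈ Ω) (hv : v ≠ 0) :
    opS Ω B h (x, v) = transOp (collisionFreq B) (cut Ω h) (x, v) := by
  set S := {t : ℝ | 0 < t ∧ x - t • v ∉ Ω}
  have hv' : 0 < ‖v‖ := norm_pos_iff.2 hv
  -- Boundedness of Ω and v ≠ 0 ensure that the ray leaves; otherwise the infimum would be the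
  -- default value 0 of the empty set.
  have hne : S.Nonempty := by
    obtain ⟨R, hR⟩ := hb.subset_ball x
    refine ⟨(|R| + 1) / ‖v‖, by positivity, fun hmem => ?_⟩
    have := hR hmem
    rw [Metric.mem_ball, dist_eq_norm, sub_sub_cancel_left, norm_neg, norm_smul,
      Real.norm_of_nonneg (by positivity), div_mul_cancel₀ _ hv'.ne'] at this
    linarith [le_abs_self R]
  have hbd : BddBelow S := ⟨0, fun t ht => ht.1.le⟩
  set τ := exitTime Ω x v
  have hτ : τ = sInf S := rfl
  have hτ0 : 0 ≤ τ := Real.sInf_nonneg fun t ht => ht.1.le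
  have hin : ∀ t, 0 < t → t < τ → x - t • v ∈ Ω := by
    intro t ht htτ
    by_contra hn
    exact absurd (csInf_le hbd (show t ∈ S from ⟨ht, hn⟩)) (not_le.2 htτ)
  -- By convexity a ray that has left Ω never returns, so the cutoff along the whole half line is
  -- the cutoff at the exit time.
  have hout : ∀ t, τ < t → x - t • v ∉ Ω := by
    intro t ht hmem
    obtain ⟨t', ht'S, ht't⟩ := exists_lt_of_csInf_lt hne (hτ ▸ ht)
    refine ht'S.2 ?_
    have ht0 : 0 < t := ht'S.1.trans ht't
    have := hc hx hmem (a := 1 - t' / t) (b := t' / t)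
      (by rw [sub_nonneg, div_le_one ht0]; exact ht't.le)
      (div_nonneg ht'S.1.le ht0.le) (by ring)
    convert this using 1
    have e : t' / t * t = t' := by field_simp
    nth_rewrite 1 [← e]
    module
  have e1 : transOp (collisionFreq B) (cut Ω h) (x, v) =
      ∫ s in Ioc 0 τ, Real.exp (-(collisionFreq B v * s)) * cut Ω h (x - s • v, v) := by
    refine (setIntegral_eq_of_subset_of_forall_sdiff_eq_zero measurableSet_Ioi
      (fun s hs => hs.1) fun s hs => ?_)
    have : τ < s := by
      by_contra hn
      exact hs.2 ⟨hs.1, not_lt.1 hn⟩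
    rw [cut_of_notMem (hout s this), mul_zero]
  rw [e1, opS, intervalIntegral.integral_of_le hτ0, ← restrict_Ioo_eq_restrict_Ioc]
  refine setIntegral_congr_fun measurableSet_Ioo fun s hs => ?_
  simp only
  rw [cut_of_mem (hin s hs.1 hs.2)]

/-- A product null set criterion with the order of integration reversed. -/
lemma ae_phase_of_ae_ae {Ω : Set E3} {p : E3 × E3 → Prop} (hp : MeasurableSet {q | p q})
    (h : ∀ᵐ v : E3, ∀ᵐ x ∂(volume.restrict Ω), p (x, v)) : ∀ᵐ q ∂phaseMeasure Ω, p q := by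
  rw [Measure.ae_prod_iff_ae_ae hp]
  exact (Measure.ae_ae_comm (p := fun v x => p (x, v)) (hp.preimage measurable_swap)).1 h

lemma ae_ae_of_ae_phase {Ω : Set E3} {p : E3 × E3 → Prop} (h : ∀ᵐ q ∂phaseMeasure Ω, p q) :
    ∀ᵐ v : E3, ∀ᵐ x ∂(volume.restrict Ω), p (x, v) := by
  have : ∀ᵐ q ∂(volume : Measure E3).prod (volume.restrict Ω), p q.swap :=
    (Measure.measurePreserving_swap (μ := (volume : Measure E3))
      (ν := volume.restrict Ω)).quasiMeasurePreserving.ae h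
  exact Measure.ae_ae_of_ae_prod this

lemma ae_phase_mem {Ω : Set E3} (hΩ : MeasurableSet Ω) : ∀ᵐ q ∂phaseMeasure Ω, q.1 ∈ Ω := by
  refine ae_phase_of_ae_ae (hΩ.preimage measurable_fst) (ae_of_all _ fun v => ?_)
  exact ae_restrict_mem hΩ

lemma ae_phase_ne_zero (Ω : Set E3) : ∀ᵐ q ∂phaseMeasure Ω, q.2 ≠ 0 := by
  refine ae_phase_of_ae_ae ((measurableSet_singleton (0 : E3)).compl.preimage measurable_snd) ?_
  exact ae_ne_zero.mono fun v hv => ae_of_all _ fun x => hv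

/-- Almost every characteristic meets a null set in a null set of times. -/
lemma ae_phase_ray {Ω : Set E3} {p : E3 → Prop} (hp : ∀ᵐ y : E3, p y) :
    ∀ᵐ q ∂phaseMeasure Ω, ∀ᵐ s ∂(volume.restrict (Ioi (0 : ℝ))), p (q.1 - s • q.2) := by
  set Z := toMeasurable volume {y | ¬ p y}
  have hZm : MeasurableSet Z := measurableSet_toMeasurable _ _
  have hZ : volume Z = 0 := by rw [measure_toMeasurable]; exact hp
  have hZp : ∀ y ∉ Z, p y := fun y hy => by
    by_contra hn
    exact hy (subset_toMeasurable _ _ hn)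
  have hi : Measurable (Z.indicator (1 : E3 → ℝ≥0∞)) := measurable_one.indicator hZm
  have him : Measurable fun q : (E3 × E3) × ℝ => Z.indicator (1 : E3 → ℝ≥0∞) (q.1.1 - q.2 • q.1.2) :=
    hi.comp (f := fun q : (E3 × E3) × ℝ => q.1.1 - q.2 • q.1.2) (by fun_prop)
  have hI : Measurable fun q : E3 × E3 =>
      ∫⁻ s in Ioi (0 : ℝ), Z.indicator (1 : E3 → ℝ≥0∞) (q.1 - s • q.2) := him.lintegral_prod_right'
  have key : ∀ᵐ q ∂phaseMeasure Ω,
      ∫⁻ s in Ioi (0 : ℝ), Z.indicator (1 : E3 → ℝ≥0∞) (q.1 - s • q.2) = 0 := by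
    refine ae_phase_of_ae_ae (hI (measurableSet_singleton 0)) (ae_of_all _ fun v => ?_)
    refine ae_restrict_of_ae ?_
    have hIv : Measurable fun x : E3 =>
        ∫⁻ s in Ioi (0 : ℝ), Z.indicator (1 : E3 → ℝ≥0∞) (x - s • v) :=
      hI.comp (f := fun x => (x, v)) (by fun_prop)
    refine (lintegral_eq_zero_iff hIv).1 ?_
    rw [lintegral_lintegral_swap]
    · refine (lintegral_eq_zero_iff' ?_).2 (ae_of_all _ fun s => ?_)
      · have : Measurable fun q : ℝ × E3 => Z.indicator (1 : E3 → ℝ≥0∞) (q.2 - q.1 • v) :=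
          hi.comp (f := fun q : ℝ × E3 => q.2 - q.1 • v) (by fun_prop)
        exact this.lintegral_prod_right'.aemeasurable
      · simp only
        rw [lintegral_sub_right_eq_self (fun x => Z.indicator (1 : E3 → ℝ≥0∞) x) (s • v),
          lintegral_indicator_one hZm, hZ]
        rfl
    · exact (hi.comp (f := fun q : E3 × ℝ => q.1 - q.2 • v) (by fun_prop)).aemeasurable
  refine key.mono fun q hq => ?_
  have hq' := (lintegral_eq_zero_iff
    (hi.comp (f := fun s : ℝ => q.1 - s • q.2) (by fun_prop))).1 hq
  refine hq'.mono fun s hs => hZp _ fun hmem => ?_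
  simp [hmem] at hs

/-- Almost every characteristic integral converges absolutely. -/
lemma ae_phase_integrable_ray {Ω : Set E3} {ν : E3 → ℝ} {ν₀ : ℝ} (hν : IsFrequency ν ν₀)
    {b : E3 × E3 → ℝ} (hb : IsSpaceRegular b) :
    ∀ᵐ q ∂phaseMeasure Ω, IntegrableOn
      (fun s : ℝ => Real.exp (-(ν q.2 * s)) * b (q.1 - s • q.2, q.2)) (Ioi 0) := by
  have hνm := hν.measurable
  have hbm := hb.measurable
  have hm : Measurable fun q : (E3 × E3) × ℝ =>
      Real.exp (-(ν q.1.2 * q.2)) * b (q.1.1 - q.2 • q.1.2, q.1.2) :=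
    Measurable.mul (by fun_prop)
      (hbm.comp (f := fun q : (E3 × E3) × ℝ => (q.1.1 - q.2 • q.1.2, q.1.2)) (by fun_prop))
  have hI : Measurable fun q : E3 × E3 => ∫⁻ s in Ioi (0 : ℝ),
      ‖Real.exp (-(ν q.2 * s)) * b (q.1 - s • q.2, q.2)‖ₑ := hm.enorm.lintegral_prod_right'
  have key : ∀ᵐ q ∂phaseMeasure Ω, ∫⁻ s in Ioi (0 : ℝ),
      ‖Real.exp (-(ν q.2 * s)) * b (q.1 - s • q.2, q.2)‖ₑ < ∞ := by
    refine ae_phase_of_ae_ae (hI measurableSet_Iio) ?_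
    filter_upwards [hb.integrable] with v hv
    exact ae_restrict_of_ae ((ae_integrable_ray hν hbm hv).mono fun x hx => hx.2)
  refine key.mono fun q hq => ⟨?_, hq⟩
  exact (hm.comp (f := fun s : ℝ => (q, s)) (by fun_prop)).aestronglyMeasurable

lemma ae_velNorm_lt_top {g : E3 × E3 → ℝ} (hg : Measurable g) (hfin : wNorm 0 g < ∞) :
    ∀ᵐ x, velNorm 0 g x < ∞ := ae_lt_top (measurable_velNorm 0 hg) hfin.ne

lemma lintegral_gradBoundE_mul_lt_top {φ : E3 → ℝ} (hφ : Measurable φ)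
    (hfin : ∫⁻ w, ‖φ w‖ₑ ^ 2 < ∞) (v : E3) : ∫⁻ w, gradBoundE (v - w) * ‖φ w‖ₑ < ∞ := by
  have hb := measurable_gradBoundE
  have h1 := lintegral_mul_sq_le (μ := (volume : Measure E3)) (f := fun w => gradBoundE (v - w))
    (g := fun w => ‖φ w‖ₑ) (by fun_prop) (by fun_prop)
  have h2 := lintegral_vw_gradBoundE_sq_lt_top 0
  simp only [pow_zero, one_mul] at h2
  rw [lintegral_sub_left_eq_self (fun z => gradBoundE z ^ 2) v] at h1
  have h3 := h1.trans_lt (ENNReal.mul_lt_top h2 hfin)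
  by_contra hc
  rw [not_lt, top_le_iff] at hc
  rw [hc] at h3
  simp at h3

lemma integrable_kernel_mul {k : E3 → E3 → ℝ} {A : ℝ} (hk : IsGradKernel k A) {φ : E3 → ℝ}
    (hφ : Measurable φ) (hfin : ∫⁻ w, ‖φ w‖ₑ ^ 2 < ∞) (v : E3) :
    Integrable fun w => k v w * φ w := by
  have hkm : Measurable (k v) := hk.measurable.of_uncurry_left
  refine ⟨(hkm.mul hφ).aestronglyMeasurable, ?_⟩
  rw [hasFiniteIntegral_iff_enorm]
  calc ∫⁻ w, ‖k v w * φ w‖ₑ ≤ ∫⁻ w, ENNReal.ofReal A * (gradBoundE (v - w) * ‖φ w‖ₑ) := by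
        refine lintegral_mono fun w => ?_
        rw [enorm_mul, ← mul_assoc]
        gcongr
        rw [gradBoundE, ← ENNReal.ofReal_mul hk.nonneg, Real.enorm_eq_ofReal_abs]
        exact ENNReal.ofReal_le_ofReal (hk.bound v w)
    _ = ENNReal.ofReal A * ∫⁻ w, gradBoundE (v - w) * ‖φ w‖ₑ :=
        lintegral_const_mul' _ _ ENNReal.ofReal_ne_top
    _ < ∞ := ENNReal.mul_lt_top ENNReal.ofReal_lt_top (lintegral_gradBoundE_mul_lt_top hφ hfin v)

/-! ### The operators on square integrable functions -/

/-- On functions that are square integrable in velocity, `K` is the integral operator with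
kernel `gradKer B`. -/
lemma ae_opK_eq {Ω : Set E3} (hΩ : MeasurableSet Ω) {B : ℝ → ℝ → ℝ}
    (hBm : Measurable (Function.uncurry B)) {C γ : ℝ} (hC : 0 ≤ C) (hγ : γ ∈ Icc (0 : ℝ) 1)
    (hB : CutoffBound B C γ) {f g : E3 × E3 → ℝ} (hg : Measurable g) (hfin : wNorm 0 g < ∞)
    (hfg : f =ᵐ[phaseMeasure Ω] g) :
    ∀ᵐ y, y ∈ Ω → ∀ v, opK B f (y, v) = kerOp (gradKer B) g (y, v) := by
  -- The exceptional set depends on the position only and the identity holds for every v. This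
  -- uniformity allows it to be used along rays, where v is fixed and the position moves.
  have h1 : ∀ᵐ y ∂volume.restrict Ω, ∀ᵐ w, f (y, w) = g (y, w) := Measure.ae_ae_of_ae_prod hfg
  rw [ae_restrict_iff' hΩ] at h1
  filter_upwards [h1, ae_velNorm_lt_top hg hfin] with y hy hvn hyΩ v
  have hfg := hy hyΩ
  have hgy : Measurable fun w => g (y, w) := hg.comp (f := fun w => (y, w)) (by fun_prop)
  have hfin' : ∫⁻ w, ‖g (y, w)‖ₑ ^ 2 < ∞ := by simpa [velNorm] using hvn
  have hb : ∫⁻ w, ENNReal.ofReal (gradBound (v - w)) * ‖f (y, w)‖ₑ < ∞ := by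
    refine lt_of_eq_of_lt (lintegral_congr_ae ?_) (lintegral_gradBoundE_mul_lt_top hgy hfin' v)
    filter_upwards [hfg] with w hw
    rw [hw, gradBoundE]
  rw [opK, linearizedL_add_collisionFreq hBm hC hγ hB v
    (hgy.aestronglyMeasurable.congr (EventuallyEq.symm hfg)) hb, kerOp]
  refine integral_congr_ae ?_
  filter_upwards [hfg] with w hw
  rw [hw]

/-- The two forms of K differ only over a null set of positions, and almost every ray meets a null
set in a null set of times, so the ray integrals agree. This also shows that the literal operators
depend only on the almost everywhere class of f. -/
lemma opS_opK_ae_eq {Ω : Set E3} (hΩ : MeasurableSet Ω) (hc : Convex ℝ Ω)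
    (hb : Bornology.IsBounded Ω) {B : ℝ → ℝ → ℝ}
    (hBm : Measurable (Function.uncurry B)) {C γ : ℝ} (hC : 0 ≤ C) (hγ : γ ∈ Icc (0 : ℝ) 1)
    (hB : CutoffBound B C γ) {f g : E3 × E3 → ℝ} (hg : Measurable g) (hfin : wNorm 0 g < ∞)
    (hfg : f =ᵐ[phaseMeasure Ω] g) :
    opS Ω B (opK B f) =ᵐ[phaseMeasure Ω] stepOp Ω (collisionFreq B) (gradKer B) g := by
  filter_upwards [ae_phase_mem hΩ, ae_phase_ne_zero Ω,
    ae_phase_ray (ae_opK_eq hΩ hBm hC hγ hB hg hfin hfg)] with ⟨x, v⟩ hx hv hr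
  rw [opS_eq hc hb B _ hx hv, stepOp, cut_of_mem hx]
  refine integral_congr_ae (hr.mono fun s hs => ?_)
  simp only at hs ⊢
  by_cases hy : x - s • v ∈ Ω
  · rw [cut_of_mem hy, cut_of_mem hy, hs hy]
  · rw [cut_of_notMem hy, cut_of_notMem hy]

/-- Bochner integrals are additive only where they converge, so both the velocity and the ray
integrals are shown to converge almost everywhere. The hypothesis is itself almost everywhere, so
linearity and well-definedness on classes are obtained together. -/
lemma stepOp_ae_linear {Ω : Set E3} (hΩ : MeasurableSet Ω) (hv : volume Ω < ∞) {ν : E3 → ℝ}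
    {ν₀ A : ℝ} (hν : IsFrequency ν ν₀) {k : E3 → E3 → ℝ} (hk : IsGradKernel k A)
    {g g₁ g₂ : E3 × E3 → ℝ} (hg₁ : Measurable g₁) (hg₂ : Measurable g₂)
    (hf₁ : wNorm 0 g₁ < ∞) (hf₂ : wNorm 0 g₂ < ∞) (a c : ℝ)
    (h : ∀ᵐ q ∂phaseMeasure Ω, g q = a * g₁ q + c * g₂ q) :
    ∀ᵐ q ∂phaseMeasure Ω,
      stepOp Ω ν k g q = a * stepOp Ω ν k g₁ q + c * stepOp Ω ν k g₂ q := by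
  have h1 : ∀ᵐ y ∂volume.restrict Ω, ∀ᵐ w, g (y, w) = a * g₁ (y, w) + c * g₂ (y, w) :=
    Measure.ae_ae_of_ae_prod h
  rw [ae_restrict_iff' hΩ] at h1
  have h2 : ∀ᵐ y, y ∈ Ω → ∀ v,
      kerOp k g (y, v) = a * kerOp k g₁ (y, v) + c * kerOp k g₂ (y, v) := by
    filter_upwards [h1, ae_velNorm_lt_top hg₁ hf₁, ae_velNorm_lt_top hg₂ hf₂]
      with y hy hn₁ hn₂ hyΩ v
    have hi₁ := integrable_kernel_mul hk
      (hg₁.comp (f := fun w => (y, w)) (by fun_prop)) (by simpa [velNorm] using hn₁) v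
    have hi₂ := integrable_kernel_mul hk
      (hg₂.comp (f := fun w => (y, w)) (by fun_prop)) (by simpa [velNorm] using hn₂) v
    simp only [kerOp, ← integral_const_mul]
    simp only [Function.comp_apply] at hi₁ hi₂
    rw [← integral_add (hi₁.const_mul a) (hi₂.const_mul c)]
    refine integral_congr_ae ((hy hyΩ).mono fun w hw => ?_)
    simp only [hw]
    ring
  filter_upwards [ae_phase_mem hΩ, ae_phase_ray h2,
    ae_phase_integrable_ray hν ((isSupportedL2_cut_kerOp hΩ hk hg₁ hf₁).isSpaceRegular hΩ hv),
    ae_phase_integrable_ray hν ((isSupportedL2_cut_kerOp hΩ hk hg₂ hf₂).isSpaceRegular hΩ hv)]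
    with ⟨x, v⟩ hx hr hi₁ hi₂
  simp only [stepOp, cut_of_mem hx, transOp, ← integral_const_mul]
  rw [← integral_add (hi₁.const_mul a) (hi₂.const_mul c)]
  refine integral_congr_ae (hr.mono fun s hs => ?_)
  simp only at hs ⊢
  by_cases hy : x - s • v ∈ Ω
  · simp only [cut_of_mem hy, hs hy]
    ring
  · simp only [cut_of_notMem hy]
    ring

lemma stepOp_ae_congr {Ω : Set E3} (hΩ : MeasurableSet Ω) (hv : volume Ω < ∞) {ν : E3 → ℝ}
    {ν₀ A : ℝ} (hν : IsFrequency ν ν₀) {k : E3 → E3 → ℝ} (hk : IsGradKernel k A)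
    {g g₁ : E3 × E3 → ℝ} (hg₁ : Measurable g₁) (hf₁ : wNorm 0 g₁ < ∞)
    (h : g =ᵐ[phaseMeasure Ω] g₁) :
    stepOp Ω ν k g =ᵐ[phaseMeasure Ω] stepOp Ω ν k g₁ := by
  have := stepOp_ae_linear hΩ hv hν hk hg₁ hg₁ hf₁ hf₁ 1 0 (h.mono fun q hq => by simpa using hq)
  exact this.mono fun q hq => by simpa using hq

lemma cut_ae_eq {Ω : Set E3} (hΩ : MeasurableSet Ω) (g : E3 × E3 → ℝ) :
    cut Ω g =ᵐ[phaseMeasure Ω] g :=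
  (ae_phase_mem hΩ).mono fun q hq => cut_of_mem hq g q.2

lemma eLpNorm_sq_eq_wNorm {Ω : Set E3} (hΩ : MeasurableSet Ω) {g : E3 × E3 → ℝ}
    (hg : Measurable g) : eLpNorm g 2 (phaseMeasure Ω) ^ 2 = wNorm 0 (cut Ω g) := by
  rw [eLpNorm_eq_lintegral_rpow_enorm_toReal (by norm_num) (by norm_num), ← ENNReal.rpow_natCast,
    ← ENNReal.rpow_mul]
  norm_num
  have hm : Measurable fun q => ‖g q‖ₑ ^ 2 := by fun_prop
  rw [lintegral_prod _ hm.aemeasurable, ← lintegral_indicator hΩ, wNorm]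
  refine lintegral_congr fun x => ?_
  by_cases hx : x ∈ Ω
  · simp [hx, cut_of_mem hx]
  · simp [hx, cut_of_notMem hx]

lemma eLpNorm_sq_le_wNorm {Ω : Set E3} (hΩ : MeasurableSet Ω) {g : E3 × E3 → ℝ}
    (hg : Measurable g) : eLpNorm g 2 (phaseMeasure Ω) ^ 2 ≤ wNorm 0 g :=
  (eLpNorm_sq_eq_wNorm hΩ hg).trans_le (wNorm_cut_le 0 Ω g)

lemma memLp_of_wNorm_lt_top {Ω : Set E3} (hΩ : MeasurableSet Ω) {g : E3 × E3 → ℝ}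
    (hg : Measurable g) (hfin : wNorm 0 g < ∞) : MemLp g 2 (phaseMeasure Ω) :=
  ⟨hg.aestronglyMeasurable,
    (ENNReal.pow_lt_top_iff.1 ((eLpNorm_sq_le_wNorm hΩ hg).trans_lt hfin)).resolve_right
      two_ne_zero⟩

lemma measurable_cut_Lp {Ω : Set E3} (hΩ : MeasurableSet Ω) (F : Lp ℝ 2 (phaseMeasure Ω)) :
    Measurable (cut Ω F) := measurable_cut hΩ (Lp.stronglyMeasurable F).measurable

lemma wNorm_cut_Lp {Ω : Set E3} (hΩ : MeasurableSet Ω) (F : Lp ℝ 2 (phaseMeasure Ω)) :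
    wNorm 0 (cut Ω F) = ‖F‖ₑ ^ 2 := by
  rw [← eLpNorm_sq_eq_wNorm hΩ (Lp.stronglyMeasurable F).measurable, Lp.enorm_def]

lemma wNorm_cut_Lp_lt_top {Ω : Set E3} (hΩ : MeasurableSet Ω) (F : Lp ℝ 2 (phaseMeasure Ω)) :
    wNorm 0 (cut Ω F) < ∞ := by
  rw [wNorm_cut_Lp hΩ]; exact ENNReal.pow_lt_top enorm_lt_top

lemma exists_wNorm_stepOp_le {Ω : Set E3} (hΩ : MeasurableSet Ω) {D ν₀ A : ℝ} {ν : E3 → ℝ}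
    (hν : IsFrequency ν ν₀) (hD : ∀ x ∈ Ω, ∀ y ∈ Ω, ‖x - y‖ ≤ D) {k : E3 → E3 → ℝ}
    (hk : IsGradKernel k A) : ∃ C : ℝ≥0, ∀ g : E3 × E3 → ℝ, Measurable g →
      wNorm 0 (stepOp Ω ν k g) ≤ C * wNorm 0 g := by
  obtain ⟨C, hC⟩ := wNorm_stepOp_le 0 hΩ hν hD hk
  exact ⟨C, fun g hg => (wNorm_zero_le _ _).trans (hC g hg)⟩

/-- One step of the iteration as a bounded operator on `L²`. -/
lemma exists_stepL2 {Ω : Set E3} (hΩ : MeasurableSet Ω) (hv : volume Ω < ∞) {D ν₀ A : ℝ}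
    {ν : E3 → ℝ} (hν : IsFrequency ν ν₀) (hD : ∀ x ∈ Ω, ∀ y ∈ Ω, ‖x - y‖ ≤ D)
    {k : E3 → E3 → ℝ} (hk : IsGradKernel k A) :
    ∃ T : Lp ℝ 2 (phaseMeasure Ω) →L[ℝ] Lp ℝ 2 (phaseMeasure Ω),
      ∀ (F : Lp ℝ 2 (phaseMeasure Ω)) (g : E3 × E3 → ℝ), Measurable g → wNorm 0 g < ∞ →
        F =ᵐ[phaseMeasure Ω] g → T F =ᵐ[phaseMeasure Ω] stepOp Ω ν k g := by
  obtain ⟨C, hC⟩ := exists_wNorm_stepOp_le hΩ hν hD hk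
  have hm := fun F : Lp ℝ 2 (phaseMeasure Ω) =>
    measurable_stepOp hΩ hν.measurable hk.measurable (measurable_cut_Lp hΩ F)
  have hle : ∀ F : Lp ℝ 2 (phaseMeasure Ω),
      wNorm 0 (stepOp Ω ν k (cut Ω F)) ≤ C * ‖F‖ₑ ^ 2 := fun F =>
    (hC _ (measurable_cut_Lp hΩ F)).trans_eq (by rw [wNorm_cut_Lp hΩ])
  have hL : ∀ F : Lp ℝ 2 (phaseMeasure Ω),
      MemLp (stepOp Ω ν k (cut Ω F)) 2 (phaseMeasure Ω) := fun F =>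
    memLp_of_wNorm_lt_top hΩ (hm F) ((hle F).trans_lt
      (ENNReal.mul_lt_top ENNReal.coe_lt_top (ENNReal.pow_lt_top enorm_lt_top)))
  let T₀ : Lp ℝ 2 (phaseMeasure Ω) →ₗ[ℝ] Lp ℝ 2 (phaseMeasure Ω) :=
    { toFun := fun F => (hL F).toLp _
      map_add' := fun F G => by
        refine Lp.ext ?_
        have h := stepOp_ae_linear hΩ hv hν hk (g := cut Ω (F + G : Lp ℝ 2 (phaseMeasure Ω)))
          (measurable_cut_Lp hΩ F)
          (measurable_cut_Lp hΩ G) (wNorm_cut_Lp_lt_top hΩ F) (wNorm_cut_Lp_lt_top hΩ G) 1 1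
          (by
            filter_upwards [cut_ae_eq hΩ F, cut_ae_eq hΩ G,
              cut_ae_eq hΩ (F + G : Lp ℝ 2 (phaseMeasure Ω)), Lp.coeFn_add F G]
              with q h₁ h₂ h₃ h₄
            rw [h₁, h₂, h₃, h₄, Pi.add_apply, one_mul, one_mul])
        filter_upwards [h, (hL F).coeFn_toLp, (hL G).coeFn_toLp, (hL (F + G)).coeFn_toLp,
          Lp.coeFn_add ((hL F).toLp _) ((hL G).toLp _)] with q h₁ h₂ h₃ h₄ h₅
        rw [h₄, h₅, Pi.add_apply, h₂, h₃, h₁, one_mul, one_mul]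
      map_smul' := fun c F => by
        refine Lp.ext ?_
        have h := stepOp_ae_linear hΩ hv hν hk (g := cut Ω (c • F : Lp ℝ 2 (phaseMeasure Ω)))
          (measurable_cut_Lp hΩ F)
          (measurable_cut_Lp hΩ F) (wNorm_cut_Lp_lt_top hΩ F) (wNorm_cut_Lp_lt_top hΩ F) c 0
          (by
            filter_upwards [cut_ae_eq hΩ F,
              cut_ae_eq hΩ (c • F : Lp ℝ 2 (phaseMeasure Ω)), Lp.coeFn_smul c F]
              with q h₁ h₂ h₃
            rw [h₁, h₂, h₃, Pi.smul_apply, smul_eq_mul, zero_mul, add_zero])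
        filter_upwards [h, (hL F).coeFn_toLp, (hL (c • F)).coeFn_toLp,
          Lp.coeFn_smul c ((hL F).toLp _)] with q h₁ h₂ h₃ h₄
        rw [h₃, RingHom.id_apply, h₄, Pi.smul_apply, h₂, h₁, smul_eq_mul, zero_mul, add_zero] }
  have hT₀ : ∀ F, ‖T₀ F‖ ≤ √(C : ℝ) * ‖F‖ := by
    intro F
    have h1 : ‖T₀ F‖ₑ ^ 2 ≤ C * ‖F‖ₑ ^ 2 := by
      have hF : T₀ F =ᵐ[phaseMeasure Ω] stepOp Ω ν k (cut Ω F) := (hL F).coeFn_toLp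
      rw [Lp.enorm_def, eLpNorm_congr_ae hF]
      exact (eLpNorm_sq_le_wNorm hΩ (hm F)).trans (hle F)
    have h2 : ‖T₀ F‖ ^ 2 ≤ C * ‖F‖ ^ 2 := by
      simp only [enorm_eq_nnnorm] at h1
      exact_mod_cast h1
    refine le_of_sq_le_sq ?_ (by positivity)
    rwa [mul_pow, Real.sq_sqrt C.coe_nonneg]
  refine ⟨T₀.mkContinuous _ hT₀, fun F g hg hfin hFg => ?_⟩
  refine (hL F).coeFn_toLp.trans ?_
  exact stepOp_ae_congr hΩ hv hν hk hg hfin ((cut_ae_eq hΩ F).trans hFg)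

lemma measurable_wNorm_iterate_stepOp {Ω : Set E3} (hΩ : MeasurableSet Ω) {D ν₀ A : ℝ}
    {ν : E3 → ℝ} (hν : IsFrequency ν ν₀) (hD : ∀ x ∈ Ω, ∀ y ∈ Ω, ‖x - y‖ ≤ D)
    {k : E3 → E3 → ℝ} (hk : IsGradKernel k A) (n : ℕ) : ∃ C : ℝ≥0, ∀ g : E3 × E3 → ℝ,
      Measurable g → Measurable ((stepOp Ω ν k)^[n] g) ∧
        wNorm 0 ((stepOp Ω ν k)^[n] g) ≤ C * wNorm 0 g := by
  obtain ⟨C, hC⟩ := exists_wNorm_stepOp_le hΩ hν hD hk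
  induction n with
  | zero => exact ⟨1, fun g hg => ⟨hg, by simp⟩⟩
  | succ n ih =>
    obtain ⟨C', hC'⟩ := ih
    refine ⟨C * C', fun g hg => ?_⟩
    obtain ⟨h1, h2⟩ := hC' g hg
    rw [Function.iterate_succ_apply']
    refine ⟨measurable_stepOp hΩ hν.measurable hk.measurable h1, (hC _ h1).trans ?_⟩
    rw [ENNReal.coe_mul, mul_assoc]
    exact mul_le_mul_right h2 _

/-! ### The Slobodeckij seminorm -/

lemma slobodeckijSq_congr {Ω : Set E3} (s : ℝ) {f g : E3 × E3 → ℝ}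
    (h : f =ᵐ[phaseMeasure Ω] g) : slobodeckijSq Ω s f = slobodeckijSq Ω s g := by
  refine lintegral_congr_ae ((ae_ae_of_ae_phase h).mono fun v hv => ?_)
  refine lintegral_congr_ae (hv.mono fun y hy => ?_)
  refine lintegral_congr_ae (hv.mono fun x hx => ?_)
  simp only [hx, hy]

/-- Substitute x = y + h and use Tonelli to bring h outside; the pairs in Ω × Ω become the points
that stay in Ω under h. -/
lemma slobodeckijSq_eq_innerSlob {Ω : Set E3} (hΩ : MeasurableSet Ω) (s : ℝ)
    {g : E3 × E3 → ℝ} (hg : Measurable g) :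
    slobodeckijSq Ω s g = innerSlob Ω (3 + 2 * s) g := by
  set q := 3 + 2 * s with hq
  have hw := measurable_powWeight q
  set Φ : E3 × E3 × E3 → ℝ≥0∞ := fun z =>
    ({y | y ∈ Ω ∧ y + z.2.2 ∈ Ω} : Set E3).indicator
      (fun y => powWeight q z.2.2 * ‖g (y + z.2.2, z.1) - g (y, z.1)‖ₑ ^ 2) z.2.1 with hΦ
  have hΦm : Measurable Φ := by
    have hS : MeasurableSet {z : E3 × E3 × E3 | z.2.1 ∈ Ω ∧ z.2.1 + z.2.2 ∈ Ω} :=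
      (hΩ.preimage (by fun_prop : Measurable fun z : E3 × E3 × E3 => z.2.1)).inter
        (hΩ.preimage (by fun_prop : Measurable fun z : E3 × E3 × E3 => z.2.1 + z.2.2))
    have h1 : Measurable fun z : E3 × E3 × E3 => g (z.2.1 + z.2.2, z.1) :=
      hg.comp (f := fun z : E3 × E3 × E3 => (z.2.1 + z.2.2, z.1)) (by fun_prop)
    have h2 : Measurable fun z : E3 × E3 × E3 => g (z.2.1, z.1) :=
      hg.comp (f := fun z : E3 × E3 × E3 => (z.2.1, z.1)) (by fun_prop)
    have h3 : Measurable fun z : E3 × E3 × E3 =>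
        powWeight q z.2.2 * ‖g (z.2.1 + z.2.2, z.1) - g (z.2.1, z.1)‖ₑ ^ 2 := by fun_prop
    exact h3.indicator hS
  have hS : ∀ h : E3, MeasurableSet {y | y ∈ Ω ∧ y + h ∈ Ω} := fun h =>
    hΩ.inter (hΩ.preimage (by fun_prop : Measurable fun y : E3 => y + h))
  calc slobodeckijSq Ω s g = ∫⁻ v, ∫⁻ y, ∫⁻ h, Φ (v, y, h) := by
        refine lintegral_congr fun v => ?_
        rw [← lintegral_indicator hΩ]
        refine lintegral_congr fun y => ?_
        by_cases hy : y ∈ Ω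
        · rw [indicator_of_mem hy, ← lintegral_indicator hΩ,
            ← lintegral_add_left_eq_self _ y]
          refine lintegral_congr fun h => ?_
          by_cases hh : y + h ∈ Ω
          · have hyh : y ∈ {y | y ∈ Ω ∧ y + h ∈ Ω} := ⟨hy, hh⟩
            rw [indicator_of_mem hh, hΦ]
            simp only
            rw [indicator_of_mem hyh, powWeight, Real.enorm_eq_ofReal_abs,
              ← ENNReal.ofReal_pow (abs_nonneg _), ← ENNReal.ofReal_mul (by positivity),
              add_sub_cancel_left, Real.rpow_neg (norm_nonneg h), div_eq_inv_mul]
          · simp [hΦ, hh]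
        · simp [hΦ, hy]
    _ = ∫⁻ v, ∫⁻ h, ∫⁻ y, Φ (v, y, h) := by
        refine lintegral_congr fun v => ?_
        exact lintegral_lintegral_swap
          (hΦm.comp (f := fun z : E3 × E3 => (v, z.1, z.2)) (by fun_prop)).aemeasurable
    _ = ∫⁻ h, ∫⁻ v, ∫⁻ y, Φ (v, y, h) := by
        have : Measurable fun z : (E3 × E3) × E3 => Φ (z.1.1, z.2, z.1.2) :=
          hΦm.comp (f := fun z : (E3 × E3) × E3 => (z.1.1, z.2, z.1.2)) (by fun_prop)
        exact lintegral_lintegral_swap this.lintegral_prod_right'.aemeasurable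
    _ = innerSlob Ω q g := by
        refine lintegral_congr fun h => ?_
        have hfin : powWeight q h ≠ ∞ := ENNReal.ofReal_ne_top
        rw [innerDiff, ← lintegral_const_mul' _ _ hfin]
        refine lintegral_congr fun v => ?_
        rw [← lintegral_const_mul' _ _ hfin, ← lintegral_indicator (hS h)]

/-- The fourth iterate is bounded from `L²` to `L²_v(H^{1-ε}_x)`. -/
lemma exists_l2hNorm_iterate_le {Ω : Set E3} (hΩ : MeasurableSet Ω) (hv : volume Ω < ∞)
    (hc : Convex ℝ Ω) {D ν₀ A : ℝ} {ν : E3 → ℝ} (hν : IsFrequency ν ν₀)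
    (hD : ∀ x ∈ Ω, ∀ y ∈ Ω, ‖x - y‖ ≤ D) {k : E3 → E3 → ℝ}
    (hk : IsGradKernel k A) {ε : ℝ} (hε : 0 < ε) (hε2 : ε < 1 / 2) :
    ∃ C : ℝ≥0, ∀ F : Lp ℝ 2 (phaseMeasure Ω), ∀ f : E3 × E3 → ℝ,
      f =ᵐ[phaseMeasure Ω] (stepOp Ω ν k)^[4] (cut Ω F) →
        MemL2H Ω (1 - ε) f ∧ l2hNorm Ω (1 - ε) f ≤ C * ‖F‖ₑ := by
  obtain ⟨C₁, hC₁⟩ := measurable_wNorm_iterate_stepOp hΩ hν hD hk 4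
  obtain ⟨C₂, hC₂⟩ := innerSlob_iterate_le hΩ hv hc hν hD hk hε hε2
  refine ⟨(C₁ + C₂) ^ (1 / 2 : ℝ), fun F f hf => ?_⟩
  have hgm := measurable_cut_Lp hΩ F
  have hgf := wNorm_cut_Lp_lt_top hΩ F
  obtain ⟨hm, hn⟩ := hC₁ _ hgm
  have hs := hC₂ _ hgm hgf
  rw [show 5 - 2 * ε = 3 + 2 * (1 - ε) by ring, ← slobodeckijSq_eq_innerSlob hΩ _ hm,
    ← slobodeckijSq_congr _ hf] at hs
  have hn' := (eLpNorm_sq_le_wNorm hΩ hm).trans hn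
  have hL := memLp_of_wNorm_lt_top hΩ hm (hn.trans_lt (ENNReal.mul_lt_top ENNReal.coe_lt_top hgf))
  rw [← eLpNorm_congr_ae hf] at hn'
  refine ⟨⟨hL.ae_eq hf.symm, hs.trans_lt (ENNReal.mul_lt_top ENNReal.coe_lt_top hgf)⟩, ?_⟩
  have h : eLpNorm f 2 (phaseMeasure Ω) ^ 2 + slobodeckijSq Ω (1 - ε) f ≤
      ((C₁ + C₂ : ℝ≥0) : ℝ≥0∞) * ‖F‖ₑ ^ 2 := by
    rw [← wNorm_cut_Lp hΩ, ENNReal.coe_add, add_mul]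
    exact add_le_add hn' hs
  calc l2hNorm Ω (1 - ε) f ≤ (((C₁ + C₂ : ℝ≥0) : ℝ≥0∞) * ‖F‖ₑ ^ 2) ^ (1 / 2 : ℝ) :=
        ENNReal.rpow_le_rpow h (by norm_num)
    _ = _ := by
        rw [ENNReal.mul_rpow_of_nonneg _ _ (by norm_num), ENNReal.coe_rpow_of_nonneg _ (by norm_num),
          ← ENNReal.rpow_natCast, ← ENNReal.rpow_mul]
        norm_num

lemma exists_iterate_stepL2 {Ω : Set E3} (hΩ : MeasurableSet Ω) (hv : volume Ω < ∞) {D ν₀ A : ℝ}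
    {ν : E3 → ℝ} (hν : IsFrequency ν ν₀) (hD : ∀ x ∈ Ω, ∀ y ∈ Ω, ‖x - y‖ ≤ D)
    {k : E3 → E3 → ℝ} (hk : IsGradKernel k A) (n : ℕ) :
    ∃ T : Lp ℝ 2 (phaseMeasure Ω) →L[ℝ] Lp ℝ 2 (phaseMeasure Ω),
      ∀ F : Lp ℝ 2 (phaseMeasure Ω),
        T F =ᵐ[phaseMeasure Ω] (stepOp Ω ν k)^[n] (cut Ω F) := by
  obtain ⟨T₁, hT₁⟩ := exists_stepL2 hΩ hv hν hD hk
  induction n with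
  | zero => exact ⟨ContinuousLinearMap.id ℝ _, fun F => (cut_ae_eq hΩ F).symm⟩
  | succ n ih =>
    obtain ⟨T, hT⟩ := ih
    obtain ⟨C, hC⟩ := measurable_wNorm_iterate_stepOp hΩ hν hD hk n
    refine ⟨T₁.comp T, fun F => ?_⟩
    obtain ⟨hm, hn⟩ := hC _ (measurable_cut_Lp hΩ F)
    rw [Function.iterate_succ_apply']
    exact hT₁ (T F) _ hm (hn.trans_lt
      (ENNReal.mul_lt_top ENNReal.coe_lt_top (wNorm_cut_Lp_lt_top hΩ F))) (hT F)

lemma picard_ae_eq {Ω : Set E3} (hΩ : MeasurableSet Ω) (hc : Convex ℝ Ω)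
    (hb : Bornology.IsBounded Ω) {B : ℝ → ℝ → ℝ} (hBm : Measurable (Function.uncurry B))
    {C γ : ℝ} (hC : 0 ≤ C) (hγ : γ ∈ Icc (0 : ℝ) 1) (hB : CutoffBound B C γ) {D ν₀ A : ℝ}
    (hν : IsFrequency (collisionFreq B) ν₀) (hD : ∀ x ∈ Ω, ∀ y ∈ Ω, ‖x - y‖ ≤ D)
    (hk : IsGradKernel (gradKer B) A) {f : E3 × E3 → ℝ} (hf : MemLp f 2 (phaseMeasure Ω))
    (n : ℕ) : picard Ω B n f =ᵐ[phaseMeasure Ω]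
      (stepOp Ω (collisionFreq B) (gradKer B))^[n] (cut Ω (hf.toLp f)) := by
  induction n with
  | zero => exact ((cut_ae_eq hΩ _).trans hf.coeFn_toLp).symm
  | succ n ih =>
    obtain ⟨C', hC'⟩ := measurable_wNorm_iterate_stepOp hΩ hν hD hk n
    obtain ⟨hm, hn⟩ := hC' _ (measurable_cut_Lp hΩ (hf.toLp f))
    rw [picard, Function.iterate_succ_apply', Function.iterate_succ_apply']
    exact opS_opK_ae_eq hΩ hc hb hBm hC hγ hB hm (hn.trans_lt
      (ENNReal.mul_lt_top ENNReal.coe_lt_top (wNorm_cut_Lp_lt_top hΩ _))) ih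

end LinBoltzmann

end

/-! ### Assembly of the main theorem -/

theorem mainTheorem4 (Ω : Set LinBoltzmann.E3)
    (hΩ : LinBoltzmann.IsPositiveCurvatureDomain Ω)
    (γ : ℝ) (hγ : γ ∈ Set.Icc (0 : ℝ) 1)
    (B : ℝ → ℝ → ℝ) (hBm : Measurable (Function.uncurry B))
    (hB : LinBoltzmann.IsAngularCutoff B γ)
    (hν : ∃ ν₀ : ℝ, 0 < ν₀ ∧
      ∀ v : LinBoltzmann.E3, ν₀ * (1 + ‖v‖) ^ γ ≤ LinBoltzmann.collisionFreq B v) :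
    ∃ T : Lp ℝ 2 (LinBoltzmann.phaseMeasure Ω) →L[ℝ] Lp ℝ 2 (LinBoltzmann.phaseMeasure Ω),
      (∀ (f : LinBoltzmann.E3 × LinBoltzmann.E3 → ℝ)
          (hf : MemLp f 2 (LinBoltzmann.phaseMeasure Ω)),
        T (hf.toLp f) =ᵐ[LinBoltzmann.phaseMeasure Ω] LinBoltzmann.picard Ω B 4 f) ∧
      ∀ ε ∈ Set.Ioo (0 : ℝ) (1 / 2),
        (∃ C : ℝ≥0, ∀ f : Lp ℝ 2 (LinBoltzmann.phaseMeasure Ω),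
          LinBoltzmann.MemL2H Ω (1 - ε) (T f) ∧
          LinBoltzmann.l2hNorm Ω (1 - ε) (T f) ≤ C * ‖f‖ₑ) ∧
        ∀ f : LinBoltzmann.E3 × LinBoltzmann.E3 → ℝ,
          MemLp f 2 (LinBoltzmann.phaseMeasure Ω) →
            LinBoltzmann.MemL2H Ω (1 - ε) (LinBoltzmann.picard Ω B 4 f) := by
  obtain ⟨C, hC⟩ := hB
  obtain ⟨ν₀, hν₀, hνb⟩ := hν
  have hΩm := hΩ.isOpen.measurableSet
  have hvol : volume Ω < ∞ := hΩ.isBounded.measure_lt_top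
  obtain ⟨D, hD'⟩ := Metric.isBounded_iff.1 hΩ.isBounded
  have hD : ∀ x ∈ Ω, ∀ y ∈ Ω, ‖x - y‖ ≤ D := fun x hx y hy => by
    rw [← dist_eq_norm]; exact hD' hx hy
  -- The cutoff constant carries no sign, so it is replaced by max C 0; this is harmless because the
  -- factors multiplying it are nonnegative.
  have hcut : LinBoltzmann.CutoffBound B (max C 0) γ := fun V hV θ hθ => by
    refine ⟨(hC V hV θ hθ).1, (hC V hV θ hθ).2.trans ?_⟩
    have hcos : 0 ≤ Real.cos θ :=
      Real.cos_nonneg_of_mem_Icc ⟨by linarith [hθ.1, Real.pi_pos], hθ.2⟩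
    have hsin : 0 ≤ Real.sin θ :=
      Real.sin_nonneg_of_nonneg_of_le_pi hθ.1 (by linarith [hθ.2, Real.pi_pos])
    have hVγ : 0 ≤ V ^ γ := Real.rpow_nonneg hV γ
    gcongr
    exact le_max_left _ _
  have hC0 : (0 : ℝ) ≤ max C 0 := le_max_right _ _
  obtain ⟨A, hA, -, hkb⟩ := LinBoltzmann.abs_gradKer_le hC0 hγ hcut
  have hk : LinBoltzmann.IsGradKernel (LinBoltzmann.gradKer B) (3 * A) :=
    ⟨LinBoltzmann.measurable_gradKer hBm, by positivity, hkb⟩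
  -- Since γ ≥ 0, the factor (1 + |v|)^γ is at least 1, which gives the uniform damping rate ν₀.
  have hfreq : LinBoltzmann.IsFrequency (LinBoltzmann.collisionFreq B) ν₀ := by
    refine ⟨LinBoltzmann.measurable_collisionFreq hBm, hν₀, fun v => le_trans ?_ (hνb v)⟩
    exact le_mul_of_one_le_right hν₀.le
      (Real.one_le_rpow (by linarith [norm_nonneg v]) hγ.1)
  obtain ⟨T, hT⟩ := LinBoltzmann.exists_iterate_stepL2 hΩm hvol hfreq hD hk 4
  have hpic : ∀ (f : LinBoltzmann.E3 × LinBoltzmann.E3 → ℝ)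
      (hf : MemLp f 2 (LinBoltzmann.phaseMeasure Ω)),
      LinBoltzmann.picard Ω B 4 f =ᵐ[LinBoltzmann.phaseMeasure Ω]
        (LinBoltzmann.stepOp Ω (LinBoltzmann.collisionFreq B) (LinBoltzmann.gradKer B))^[4]
          (LinBoltzmann.cut Ω (hf.toLp f)) := fun f hf =>
    LinBoltzmann.picard_ae_eq hΩm hΩ.convex hΩ.isBounded hBm hC0 hγ hcut hfreq hD hk hf 4
  refine ⟨T, fun f hf => (hT _).trans (hpic f hf).symm, fun ε hε => ?_⟩
  obtain ⟨C', hC'⟩ := LinBoltzmann.exists_l2hNorm_iterate_le hΩm hvol hΩ.convex hfreq hD hk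
    hε.1 hε.2
  exact ⟨⟨C', fun F => hC' F (T F) (hT F)⟩, fun f hf => (hC' (hf.toLp f) _ (hpic f hf)).1⟩
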